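/- Let $\Gamma$ be a discrete subgroup of the Euclidean group $E(n)=\{(g,a): g\in O(n),\,a\in\mathbb R^n\}$, $(g,a)x=gx+a$, whose non-identity elements have no fixed point, and suppose that the complete flat manifold $M=\mathbb R^n/\Gamma$ is noncompact. *The group $\Gamma_2$.* Let $\Gamma^*$ be the intersection of $\Gamma$ with the identity component of the closure of $\Gamma\cdot\mathbb R^n$ in $E(n)$ ($\mathbb R^n$ being the group of translations). Then there is a vector subspace $V\subset\mathbb R^n$ such that, for a suitable choice of the origin of $\mathbb R^n$ and some toral (compact connected abelian) subgroup $T$ of $O(n)$ acting trivially on $V$, one has $\Gamma^*\subset T\cdot V$ and the projection $T\cdot V\to V$ maps $\Gamma^*$ bijectively onto a discrete cocompact subgroup of $V$. For any such $V$ put $$\Gamma_1=\{(g,a)\in\Gamma : g|_{V^\perp}=\mathrm{id}\},\quad \Gamma^{**}=\Gamma^*\cap\Gamma_1,\quad V_2=\mathrm{span}(\Gamma^{**}),\quad V_1=V\cap V_2^\perp,\quad \Gamma_2=\{(g,a)\in\Gamma_1 : g|_{V_1}=\mathrm{id}\},$$ where $\mathrm{span}(\Gamma^{**})$ is the linear span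 of the vectors $v$ for which the translation by $v$ lies in $\Gamma^{**}$. *The bottoms of the spectra.* For $X=\mathbb R^n/\Gamma$ or $X=\mathbb R^n/\Gamma_2$ and $0\le k\le n$, let $\Delta=d\delta+\delta d$ be the Hodge Laplacian on $k$-forms, let $$\lambda_0(k,X)=\inf\left\{\frac{\int_X\langle\Delta\omega,\omega\rangle}{\int_X|\omega|^2} : \omega\in C_c^\infty(\Lambda^k(X)),\ \omega\ne0\right\},$$ and let $\lambda_0^{\rm ess}(k,X)$ be the infimum (in $[-\infty,\infty]$) of the essential spectrum of the self-adjoint operator that $\Delta$ defines on $L^2$ $k$-forms (its Friedrichs extension); the essential spectrum consists of the cluster points of the spectrum and of the eigenvalues of infinite multiplicity. Then for every $0\le k\le n$ $$\lambda_0(k,M)\ \ge\ \lambda_0(k,\mathbb R^n/\Gamma_2),\qquad \lambda_0^{\rm ess}(k,M)\ \ge\ \lambda_0^{\rm ess}(k,\mathbb R^n/\Gamma_2)=\lambda_0(k,\mathbb R^n/\Gamma_2).$$ -/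

import Mathlib

open Set Filter Topology MeasureTheory

namespace FlatForms

/-! ### Euclidean space, the Euclidean group, flat quotients -/

/-- Euclidean `n`-space. -/
abbrev Euc (n : ℕ) : Type := EuclideanSpace ℝ (Fin n)

/-- The Euclidean group `E(n)`: the isometries `x ↦ g x + a` of `ℝⁿ`. -/
abbrev EucGroup (n : ℕ) : Type := Euc n ≃ᵃⁱ[ℝ] Euc n

/-- The rotational part `g ∈ O(n)` of an isometry `(g, a)`, as a continuous linear map. -/
noncomputable def rot {n : ℕ} (γ : EucGroup n) : Euc n →L[ℝ] Euc n :=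
  (γ.linearIsometryEquiv.toContinuousLinearEquiv : Euc n →L[ℝ] Euc n)

/-- The usual topology of `E(n)`: that of the pair `(g, a)`, where `a` is the image of `0`. -/
noncomputable instance eucGroupTopology (n : ℕ) : TopologicalSpace (EucGroup n) :=
  TopologicalSpace.induced (fun γ : EucGroup n => (rot γ, γ 0)) inferInstance

/-- The translation `x ↦ v + x`. -/
noncomputable def transl {n : ℕ} (v : Euc n) : EucGroup n :=
  AffineIsometryEquiv.constVAdd ℝ (Euc n) v

/-- No element of `Γ` other than the identity has a fixed point. -/
def FixedPointFree {n : ℕ} (Γ : Subgroup (EucGroup n)) : Prop :=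
  ∀ γ ∈ Γ, (∃ x : Euc n, γ x = x) → γ = 1

/-- The equivalence relation on `ℝⁿ` whose classes are the orbits of `Γ`. -/
def orbitSetoid {n : ℕ} (Γ : Subgroup (EucGroup n)) : Setoid (Euc n) where
  r x y := ∃ γ ∈ Γ, γ x = y
  iseqv :=
    { refl := fun x => ⟨1, Γ.one_mem, by simp⟩
      symm := by
        rintro x y ⟨γ, hγ, rfl⟩
        exact ⟨γ⁻¹, Γ.inv_mem hγ, by simp⟩
      trans := by
        rintro x y z ⟨γ, hγ, rfl⟩ ⟨γ', hγ', rfl⟩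
        exact ⟨γ' * γ, Γ.mul_mem hγ' hγ, by simp⟩ }

/-- The orbit space `ℝⁿ/Γ` with its quotient topology. -/
abbrev FlatQuotient {n : ℕ} (Γ : Subgroup (EucGroup n)) : Type := Quotient (orbitSetoid Γ)

/-! ### The subgroup `Γ₂` -/

/-- `Γ*`: the intersection of `Γ` with the identity component of the closure of `Γ · ℝⁿ`,
where `ℝⁿ` is the group of translations. -/
def gammaStar {n : ℕ} (Γ : Subgroup (EucGroup n)) : Set (EucGroup n) :=
  (Γ : Set (EucGroup n)) ∩
    connectedComponentIn (closure {g | ∃ γ ∈ Γ, ∃ v : Euc n, g = γ * transl v}) 1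

/-- `T` is a toral subgroup of `O(n)`: abelian, compact and connected. -/
def IsToral {n : ℕ} (T : Subgroup (Euc n ≃ₗᵢ[ℝ] Euc n)) : Prop :=
  (∀ g ∈ T, ∀ h ∈ T, g * h = h * g) ∧
  IsCompact ((fun g : Euc n ≃ₗᵢ[ℝ] Euc n =>
    (g.toContinuousLinearEquiv : Euc n →L[ℝ] Euc n)) '' (T : Set (Euc n ≃ₗᵢ[ℝ] Euc n))) ∧
  IsConnected ((fun g : Euc n ≃ₗᵢ[ℝ] Euc n =>
    (g.toContinuousLinearEquiv : Euc n →L[ℝ] Euc n)) '' (T : Set (Euc n ≃ₗᵢ[ℝ] Euc n)))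

/-- The property that singles out the vector subspace `V` attached to `Γ`: for a suitable reference
point `c` and a toral subgroup `T` of `O(n)` that acts trivially on `V`, one has `Γ* ⊆ T · V` (with
respect to the origin `c`, so that the translational part of `γ` is `γ c - c`), and the projection
`T · V → V` maps `Γ*` bijectively onto a discrete uniform (that is, cocompact) subgroup `L`
of `V`. -/
def IsLatticeSubspace {n : ℕ} (Γ : Subgroup (EucGroup n)) (V : Submodule ℝ (Euc n)) : Prop :=
  ∃ (c : Euc n) (T : Subgroup (Euc n ≃ₗᵢ[ℝ] Euc n)) (L : AddSubgroup (Euc n)),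
    IsToral T ∧
    (∀ g ∈ T, ∀ v ∈ V, g v = v) ∧
    (∀ γ ∈ gammaStar Γ, γ.linearIsometryEquiv ∈ T ∧ γ c - c ∈ V) ∧
    DiscreteTopology L ∧
    (∀ l ∈ L, l ∈ V) ∧
    (∃ K : Set (Euc n), IsCompact K ∧ ∀ v ∈ V, ∃ l ∈ L, v - l ∈ K) ∧
    BijOn (fun γ : EucGroup n => γ c - c) (gammaStar Γ) (L : Set (Euc n))

/-- The elements of the group `Γ` whose rotational part is the identity on the subspace `W`. -/
def rotFixing {n : ℕ} (Γ : Subgroup (EucGroup n)) (W : Submodule ℝ (Euc n)) :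
    Subgroup (EucGroup n) where
  carrier := {γ | γ ∈ Γ ∧ ∀ w ∈ W, γ.linearIsometryEquiv w = w}
  one_mem' := ⟨Γ.one_mem, fun _ _ => rfl⟩
  mul_mem' := by
    rintro a b ⟨ha, ha'⟩ ⟨hb, hb'⟩
    refine ⟨Γ.mul_mem ha hb, fun w hw => ?_⟩
    change a.linearIsometryEquiv (b.linearIsometryEquiv w) = w
    rw [hb' w hw, ha' w hw]
  inv_mem' := by
    rintro a ⟨ha, ha'⟩
    refine ⟨Γ.inv_mem ha, fun w hw => ?_⟩
    change a.linearIsometryEquiv.symm w = w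
    rw [LinearIsometryEquiv.symm_apply_eq, ha' w hw]

/-- `Γ₁ = {(g, a) ∈ Γ | g = id on V⊥}`. -/
noncomputable def gammaOne {n : ℕ} (Γ : Subgroup (EucGroup n)) (V : Submodule ℝ (Euc n)) :
    Subgroup (EucGroup n) :=
  rotFixing Γ Vᗮ

/-- `Γ** = Γ* ∩ Γ₁`. -/
noncomputable def gammaStarStar {n : ℕ} (Γ : Subgroup (EucGroup n)) (V : Submodule ℝ (Euc n)) :
    Set (EucGroup n) :=
  gammaStar Γ ∩ (gammaOne Γ V : Set (EucGroup n))

/-- `V₂`, the linear span of `Γ**` (a group of translations, identified with vectors). -/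
noncomputable def vTwo {n : ℕ} (Γ : Subgroup (EucGroup n)) (V : Submodule ℝ (Euc n)) : Submodule ℝ (Euc n) :=
  Submodule.span ℝ {v | transl v ∈ gammaStarStar Γ V}

/-- `V₁`, the orthogonal complement of `V₂` in `V`. -/
noncomputable def vOne {n : ℕ} (Γ : Subgroup (EucGroup n)) (V : Submodule ℝ (Euc n)) : Submodule ℝ (Euc n) :=
  V ⊓ (vTwo Γ V)ᗮ

/-- `Γ₂ = {(g, a) ∈ Γ₁ | g = id on V₁}`. -/
noncomputable def gammaTwo {n : ℕ} (Γ : Subgroup (EucGroup n)) (V : Submodule ℝ (Euc n)) :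
    Subgroup (EucGroup n) :=
  rotFixing (gammaOne Γ V) (vOne Γ V)

/-! ### Differential forms on `ℝⁿ/Γ`

When `Γ` is discrete and acts freely, pull-back along the covering `ℝⁿ → ℝⁿ/Γ` identifies the
`k`-forms on `ℝⁿ/Γ` with the `Γ`-invariant `k`-forms on `ℝⁿ`. -/

/-- `k`-covectors on `ℝⁿ`. -/
abbrev Covec (n k : ℕ) : Type := Euc n [⋀^Fin k]→L[ℝ] ℝ

/-- The standard basis of `ℝⁿ`. -/
noncomputable def stdVec {n : ℕ} (i : Fin n) : Euc n := EuclideanSpace.basisFun (Fin n) ℝ i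

/-- The inner product of `k`-covectors for which the `dx_{i₁} ∧ ⋯ ∧ dx_{i_k}`, `i₁ < ⋯ < i_k`, are
orthonormal. The sum runs over all `k`-tuples of indices and is divided by `k!`. -/
noncomputable def covecInner {n k : ℕ} (α β : Covec n k) : ℝ :=
  (k.factorial : ℝ)⁻¹ * ∑ I : Fin k → Fin n, α (fun j => stdVec (I j)) * β (fun j => stdVec (I j))

/-- The smooth compactly supported `k`-forms on `ℝⁿ/Γ`: smooth `k`-forms `ω` on `ℝⁿ` with
`γ^* ω = ω` for `γ ∈ Γ`, that vanish off the preimage of some compact subset of `ℝⁿ/Γ`. -/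
def ccSubmodule {n : ℕ} (Γ : Subgroup (EucGroup n)) (k : ℕ) :
    Submodule ℝ (Euc n → Covec n k) where
  carrier := {ω | ContDiff ℝ (⊤ : ℕ∞) ω ∧
    (∀ γ ∈ Γ, ∀ x, (ω (γ x)).compContinuousLinearMap (rot γ) = ω x) ∧
    ∃ K : Set (Euc n), IsCompact K ∧ ∀ x, ω x ≠ 0 → ∃ γ ∈ Γ, γ x ∈ K}
  zero_mem' := ⟨contDiff_const, fun _ _ _ => by ext; simp, ∅, isCompact_empty, by simp⟩
  add_mem' := by
    rintro a b ⟨ha, ha', K, hK, hKa⟩ ⟨hb, hb', K', hK', hKb⟩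
    refine ⟨ha.add hb, fun γ hγ x => ?_, K ∪ K', hK.union hK', fun x hx => ?_⟩
    · change (a (γ x) + b (γ x)).compContinuousLinearMap (rot γ) = a x + b x
      rw [← ha' γ hγ x, ← hb' γ hγ x]
      ext v
      simp
    · by_cases h : a x = 0
      · obtain ⟨γ, hγ, h'⟩ := hKb x (by intro h'; exact hx (by simp [h, h']))
        exact ⟨γ, hγ, Or.inr h'⟩
      · obtain ⟨γ, hγ, h'⟩ := hKa x h
        exact ⟨γ, hγ, Or.inl h'⟩
  smul_mem' := by
    rintro c a ⟨ha, ha', K, hK, hKa⟩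
    refine ⟨ha.const_smul c, fun γ hγ x => ?_, K, hK, fun x hx => ?_⟩
    · change (c • a (γ x)).compContinuousLinearMap (rot γ) = c • a x
      rw [← ha' γ hγ x]
      ext v
      simp
    · exact hKa x (by intro h; exact hx (by simp [h]))

/-- The space `C_c^∞(Λ^k(ℝⁿ/Γ))` of smooth compactly supported `k`-forms on `ℝⁿ/Γ`. -/
def CcForm {n : ℕ} (Γ : Subgroup (EucGroup n)) (k : ℕ) : Type := ↥(ccSubmodule Γ k)

noncomputable instance {n : ℕ} (Γ : Subgroup (EucGroup n)) (k : ℕ) : AddCommGroup (CcForm Γ k) :=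
  inferInstanceAs (AddCommGroup ↥(ccSubmodule Γ k))

noncomputable instance {n : ℕ} (Γ : Subgroup (EucGroup n)) (k : ℕ) : Module ℝ (CcForm Γ k) :=
  inferInstanceAs (Module ℝ ↥(ccSubmodule Γ k))

/-- The invariant form on `ℝⁿ` that represents a form on `ℝⁿ/Γ`. -/
def CcForm.lift {n : ℕ} {Γ : Subgroup (EucGroup n)} {k : ℕ} (ω : CcForm Γ k) :
    Euc n → Covec n k :=
  (show ↥(ccSubmodule Γ k) from ω).1

theorem CcForm.lift_mem {n : ℕ} {Γ : Subgroup (EucGroup n)} {k : ℕ} (ω : CcForm Γ k) :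
    ω.lift ∈ ccSubmodule Γ k :=
  (show ↥(ccSubmodule Γ k) from ω).2

theorem CcForm.lift_add {n : ℕ} {Γ : Subgroup (EucGroup n)} {k : ℕ} (ω η : CcForm Γ k)
    (x : Euc n) : (ω + η).lift x = ω.lift x + η.lift x := rfl

theorem CcForm.lift_smul {n : ℕ} {Γ : Subgroup (EucGroup n)} {k : ℕ} (c : ℝ) (ω : CcForm Γ k)
    (x : Euc n) : (c • ω).lift x = c • ω.lift x := rfl

/-! ### The `L²` inner product -/

/-- The closed Dirichlet fundamental domain of `Γ` centred at the origin. -/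
def dirichletDomain {n : ℕ} (Γ : Subgroup (EucGroup n)) : Set (Euc n) :=
  {x | ∀ γ ∈ Γ, ‖x‖ ≤ ‖γ x‖}

theorem isClosed_dirichletDomain {n : ℕ} (Γ : Subgroup (EucGroup n)) :
    IsClosed (dirichletDomain Γ) := by
  have h : dirichletDomain Γ = ⋂ γ ∈ Γ, {x : Euc n | ‖x‖ ≤ ‖γ x‖} := by
    ext x; simp [dirichletDomain]
  rw [h]
  exact isClosed_biInter fun γ _ => isClosed_le continuous_norm γ.continuous.norm

/-- The `L²` inner product `∫_{ℝⁿ/Γ} ⟨ω, η⟩`; the integral over `ℝⁿ/Γ` is the integral over the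
Dirichlet fundamental domain. -/
noncomputable def l2Inner {n : ℕ} {Γ : Subgroup (EucGroup n)} {k : ℕ} (ω η : CcForm Γ k) : ℝ :=
  ∫ x in dirichletDomain Γ, covecInner (ω.lift x) (η.lift x)

theorem integrable_covecInner {n : ℕ} {Γ : Subgroup (EucGroup n)} {k : ℕ} (ω η : CcForm Γ k) :
    IntegrableOn (fun x => covecInner (ω.lift x) (η.lift x)) (dirichletDomain Γ) := by
  obtain ⟨hω, -, K, hK, hωK⟩ := ω.lift_mem
  obtain ⟨hη, -, -⟩ := η.lift_mem
  obtain ⟨R, hR⟩ := hK.isBounded.exists_norm_le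
  have hcont : Continuous fun x => covecInner (ω.lift x) (η.lift x) := by
    have h1 : ∀ v : Fin k → Euc n, Continuous fun x => ω.lift x v := fun v =>
      (ContinuousAlternatingMap.apply ℝ (Euc n) ℝ v).continuous.comp hω.continuous
    have h2 : ∀ v : Fin k → Euc n, Continuous fun x => η.lift x v := fun v =>
      (ContinuousAlternatingMap.apply ℝ (Euc n) ℝ v).continuous.comp hη.continuous
    unfold covecInner
    exact continuous_const.mul (continuous_finsetSum _ fun I _ => (h1 _).mul (h2 _))
  have hint : IntegrableOn (fun x => covecInner (ω.lift x) (η.lift x))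
      (dirichletDomain Γ ∩ Metric.closedBall 0 R) :=
    hcont.continuousOn.integrableOn_compact
      ((isCompact_closedBall (0 : Euc n) R).inter_left (isClosed_dirichletDomain Γ))
  refine hint.of_forall_sdiff_eq_zero (isClosed_dirichletDomain Γ).measurableSet ?_
  rintro x ⟨hx, hx'⟩
  have h0 : ω.lift x = 0 := by
    by_contra h
    obtain ⟨γ, hγ, hγx⟩ := hωK x h
    exact hx' ⟨hx, by simpa using (hx γ hγ).trans (hR _ hγx)⟩
  simp [covecInner, h0]

/-- The `L²` inner product makes the smooth compactly supported forms a pre-Hilbert space. -/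
noncomputable abbrev l2Core {n : ℕ} (Γ : Subgroup (EucGroup n)) (k : ℕ) :
    PreInnerProductSpace.Core ℝ (CcForm Γ k) where
  inner := l2Inner
  conj_inner_symm ω η := by
    simp only [l2Inner, covecInner, conj_trivial]
    simp only [mul_comm]
  re_inner_nonneg ω := by
    refine integral_nonneg fun x => ?_
    exact mul_nonneg (by positivity) (Finset.sum_nonneg fun I _ => mul_self_nonneg _)
  add_left ω η θ := by
    rw [l2Inner, l2Inner, l2Inner, ← integral_add (integrable_covecInner _ _)
      (integrable_covecInner _ _)]
    congr 1
    ext x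
    simp [covecInner, CcForm.lift_add, add_mul, Finset.sum_add_distrib, mul_add]
  smul_left ω η c := by
    simp only [conj_trivial]
    rw [l2Inner, l2Inner, ← integral_const_mul]
    congr 1
    ext x
    simp only [covecInner, CcForm.lift_smul, ContinuousAlternatingMap.smul_apply, smul_eq_mul,
      mul_assoc, ← Finset.mul_sum]
    ring

noncomputable instance {n : ℕ} (Γ : Subgroup (EucGroup n)) (k : ℕ) :
    SeminormedAddCommGroup (CcForm Γ k) :=
  @InnerProductSpace.Core.toSeminormedAddCommGroup ℝ (CcForm Γ k) _ _ _ (l2Core Γ k)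

noncomputable instance {n : ℕ} (Γ : Subgroup (EucGroup n)) (k : ℕ) :
    InnerProductSpace ℝ (CcForm Γ k) :=
  InnerProductSpace.ofCore (l2Core Γ k)

theorem inner_eq_l2Inner {n : ℕ} {Γ : Subgroup (EucGroup n)} {k : ℕ} (ω η : CcForm Γ k) :
    inner ℝ ω η = l2Inner ω η := rfl

/-- The Hilbert space of `L²` `k`-forms on `ℝⁿ/Γ`: the completion of the smooth compactly supported
`k`-forms with respect to the `L²` norm. -/
abbrev L2Form {n : ℕ} (Γ : Subgroup (EucGroup n)) (k : ℕ) : Type :=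
  UniformSpace.Completion (CcForm Γ k)

/-! ### The Hodge Laplacian -/

/-- The codifferential `δω = - ∑ᵢ ι_{eᵢ} ∂ᵢ ω` of a form on `ℝⁿ`. -/
noncomputable def codiff {n k : ℕ} (ω : Euc n → Covec n (k + 1)) (x : Euc n) : Covec n k :=
  -∑ i : Fin n, (fderiv ℝ ω x (stdVec i)).curryLeft (stdVec i)

/-- Applying an orthogonally equivariant continuous linear operation to the derivative of an
invariant compactly supported form gives again an invariant compactly supported form. -/
theorem deriv_mem {n : ℕ} {Γ : Subgroup (EucGroup n)} {k l : ℕ}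
    (P : (Euc n →L[ℝ] Covec n k) →L[ℝ] Covec n l)
    (hP : ∀ (γ : EucGroup n) (D D' : Euc n →L[ℝ] Covec n k),
      (∀ v, (D' (rot γ v)).compContinuousLinearMap (rot γ) = D v) →
      (P D').compContinuousLinearMap (rot γ) = P D)
    {ω : Euc n → Covec n k} (h : ω ∈ ccSubmodule Γ k) :
    (fun x => P (fderiv ℝ ω x)) ∈ ccSubmodule Γ l := by
  obtain ⟨hω, hinv, K, hK, hωK⟩ := h
  refine ⟨P.contDiff.comp (hω.fderiv_right le_rfl), fun γ hγ x => hP γ _ _ fun v => ?_,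
    Metric.cthickening 1 K, hK.cthickening, fun x hx => ?_⟩
  · have hγ' : HasFDerivAt (γ : Euc n → Euc n) (rot γ) x := by
      have : (γ : Euc n → Euc n) = fun y => rot γ y + γ 0 := by
        ext1 y
        have := γ.map_vadd 0 y
        simpa [rot] using this
      rw [this]
      exact (rot γ).hasFDerivAt.add_const _
    have hd : HasFDerivAt ω (fderiv ℝ ω (γ x)) (γ x) :=
      (hω.differentiable (by simp) _).hasFDerivAt
    have h1 := ((ContinuousAlternatingMap.compContinuousLinearMapCLM (F := ℝ) (ι := Fin k)
      (rot γ)).hasFDerivAt.comp x (hd.comp x hγ'))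
    have h2 : HasFDerivAt ω _ x := h1.congr_of_eventuallyEq
      (Eventually.of_forall fun y => (hinv γ hγ y).symm)
    rw [h2.fderiv]
    rfl
  · have hx' : x ∈ tsupport ω := by
      by_contra hx'
      refine hx ?_
      have : fderiv ℝ ω x = 0 := by
        rw [(notMem_tsupport_iff_eventuallyEq.1 hx').fderiv_eq]
        simp
      simp [this]
    obtain ⟨y, hy, hxy⟩ := Metric.mem_closure_iff.1 hx' 1 one_pos
    obtain ⟨γ, hγ, hγy⟩ := hωK y hy
    exact ⟨γ, hγ, Metric.mem_cthickening_of_dist_le _ _ _ _ hγy (by simpa using hxy.le)⟩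

theorem extDeriv_mem {n : ℕ} {Γ : Subgroup (EucGroup n)} {k : ℕ} {ω : Euc n → Covec n k}
    (h : ω ∈ ccSubmodule Γ k) : extDeriv ω ∈ ccSubmodule Γ (k + 1) := by
  refine deriv_mem (ContinuousAlternatingMap.alternatizeUncurryFinCLM ℝ (Euc n) ℝ) ?_ h
  intro γ D D' hD
  ext v
  simp only [ContinuousAlternatingMap.alternatizeUncurryFinCLM_apply,
    ContinuousAlternatingMap.compContinuousLinearMap_apply,
    ContinuousAlternatingMap.alternatizeUncurryFin_apply, ← hD]
  rfl

theorem trace_rot {n : ℕ} (γ : EucGroup n) (B : Euc n →ₗ[ℝ] Euc n →L[ℝ] ℝ) :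
    ∑ i : Fin n, B (rot γ (stdVec i)) (rot γ (stdVec i)) =
      ∑ i : Fin n, B (stdVec i) (stdVec i) := by
  let T : Euc n →ₗ[ℝ] Euc n :=
    { toFun := fun x => (InnerProductSpace.toDual ℝ (Euc n)).symm (B x)
      map_add' := by intro x y; simp
      map_smul' := by intro c x; simp }
  have hT : ∀ x y, B x y = inner ℝ y (T x) := by
    intro x y
    rw [real_inner_comm]
    simp [T]
  have h1 := LinearMap.trace_eq_sum_inner T (EuclideanSpace.basisFun (Fin n) ℝ)
  have h2 := LinearMap.trace_eq_sum_inner T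
    ((EuclideanSpace.basisFun (Fin n) ℝ).map γ.linearIsometryEquiv)
  simp only [hT]
  rw [h1] at h2
  simpa [stdVec, rot] using h2.symm

theorem codiff_mem {n : ℕ} {Γ : Subgroup (EucGroup n)} {k : ℕ} {ω : Euc n → Covec n (k + 1)}
    (h : ω ∈ ccSubmodule Γ (k + 1)) : codiff ω ∈ ccSubmodule Γ k := by
  let Q : Fin n → (Euc n →L[ℝ] Covec n (k + 1)) →L[ℝ] Covec n k := fun i =>
    (ContinuousLinearMap.apply ℝ (Covec n k) (stdVec i)) ∘L
      ((ContinuousAlternatingMap.curryLeftLI (𝕜 := ℝ) (E := Euc n) (F := ℝ)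
        (n := k)).toContinuousLinearMap ∘L
      (ContinuousLinearMap.apply ℝ (Covec n (k + 1)) (stdVec i)))
  let P : (Euc n →L[ℝ] Covec n (k + 1)) →L[ℝ] Covec n k := ∑ i : Fin n, Q i
  have hP : ∀ D, P D = ∑ i : Fin n, (D (stdVec i)).curryLeft (stdVec i) := by
    intro D
    change (∑ i : Fin n, Q i) D = _
    rw [sum_apply]
    rfl
  have : codiff ω = -fun x => P (fderiv ℝ ω x) := by
    ext1 x
    rw [Pi.neg_apply, hP, codiff]
  rw [this]
  refine (ccSubmodule Γ k).neg_mem (deriv_mem P ?_ h)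
  intro γ D D' hD
  rw [hP, hP]
  ext v
  have key := trace_rot γ
    { toFun := fun a => (ContinuousAlternatingMap.apply ℝ (Euc n) ℝ fun j => rot γ (v j)) ∘L
        (D' a).curryLeft
      map_add' := by intro a b; ext; simp
      map_smul' := by intro c a; ext; simp }
  simp only [← hD]
  simpa [Matrix.vecCons, Function.comp_def] using key.symm

theorem codiff_add {n k : ℕ} {ω η : Euc n → Covec n (k + 1)} {x : Euc n}
    (hω : DifferentiableAt ℝ ω x) (hη : DifferentiableAt ℝ η x) :
    codiff (ω + η) x = codiff ω x + codiff η x := by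
  have h : ∀ i : Fin n, (fderiv ℝ (ω + η) x (stdVec i)).curryLeft (stdVec i) =
      (fderiv ℝ ω x (stdVec i)).curryLeft (stdVec i) +
        (fderiv ℝ η x (stdVec i)).curryLeft (stdVec i) := by
    intro i
    rw [fderiv_add hω hη]
    rfl
  simp only [codiff, h, Finset.sum_add_distrib, neg_add]

theorem codiff_smul {n k : ℕ} (c : ℝ) {ω : Euc n → Covec n (k + 1)} {x : Euc n}
    (hω : DifferentiableAt ℝ ω x) : codiff (c • ω) x = c • codiff ω x := by
  have h : ∀ i : Fin n, (fderiv ℝ (c • ω) x (stdVec i)).curryLeft (stdVec i) =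
      c • (fderiv ℝ ω x (stdVec i)).curryLeft (stdVec i) := by
    intro i
    rw [fderiv_const_smul hω]
    rfl
  simp only [codiff, h, ← Finset.smul_sum, smul_neg]

/-- The exterior derivative on `C_c^∞(Λ^k(ℝⁿ/Γ))`. -/
noncomputable def dForm {n : ℕ} (Γ : Subgroup (EucGroup n)) (k : ℕ) :
    CcForm Γ k →ₗ[ℝ] CcForm Γ (k + 1) where
  toFun ω := (⟨extDeriv ω.lift, extDeriv_mem ω.lift_mem⟩ : ↥(ccSubmodule Γ (k + 1)))
  map_add' ω η := by
    apply Subtype.ext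
    funext x
    exact extDeriv_add (ω.lift_mem.1.differentiable (by simp) x)
      (η.lift_mem.1.differentiable (by simp) x)
  map_smul' c ω := by
    apply Subtype.ext
    funext x
    exact extDeriv_smul c ω.lift

/-- The codifferential on `C_c^∞(Λ^(k+1)(ℝⁿ/Γ))`. -/
noncomputable def deltaForm {n : ℕ} (Γ : Subgroup (EucGroup n)) (k : ℕ) :
    CcForm Γ (k + 1) →ₗ[ℝ] CcForm Γ k where
  toFun ω := (⟨codiff ω.lift, codiff_mem ω.lift_mem⟩ : ↥(ccSubmodule Γ k))
  map_add' ω η := by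
    apply Subtype.ext
    funext x
    exact codiff_add (ω.lift_mem.1.differentiable (by simp) x)
      (η.lift_mem.1.differentiable (by simp) x)
  map_smul' c ω := by
    apply Subtype.ext
    funext x
    exact codiff_smul c (ω.lift_mem.1.differentiable (by simp) x)

/-- The Hodge Laplacian `Δ = dδ + δd` on smooth compactly supported `k`-forms on `ℝⁿ/Γ`
(`Δ = δd` on functions). -/
noncomputable def hodgeLaplacian {n : ℕ} (Γ : Subgroup (EucGroup n)) :
    (k : ℕ) → CcForm Γ k →ₗ[ℝ] CcForm Γ k
  | 0 => deltaForm Γ 0 ∘ₗ dForm Γ 0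
  | k + 1 => dForm Γ k ∘ₗ deltaForm Γ k + deltaForm Γ (k + 1) ∘ₗ dForm Γ (k + 1)

/-- `λ₀(k, ℝⁿ/Γ)`: the infimum of the Rayleigh quotients `∫ ⟨Δω, ω⟩ / ∫ |ω|²` over the nonzero smooth
compactly supported `k`-forms `ω` on `ℝⁿ/Γ`. -/
noncomputable def bottomRayleigh {n : ℕ} (Γ : Subgroup (EucGroup n)) (k : ℕ) : EReal :=
  ⨅ (ω : CcForm Γ k) (_ : ω ≠ 0),
    ((l2Inner (hodgeLaplacian Γ k ω) ω / l2Inner ω ω : ℝ) : EReal)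

/-! ### The self-adjoint Laplacian and its spectrum -/

section Operator

variable {C : Type*} [SeminormedAddCommGroup C] [InnerProductSpace ℝ C]

/-- The graph of the Friedrichs extension of a symmetric nonnegative operator `A : C → C` on a
pre-Hilbert space `C`, as an operator in the completion of `C`: a pair `(u, f)` belongs to it when
`u` is in the form domain (the limit of a sequence in `C` that is Cauchy for the quadratic form
`⟨A w, w⟩`) and `⟨u, A φ⟩ = ⟨f, φ⟩` for all `φ ∈ C`. -/
def friedrichsGraph (A : C →ₗ[ℝ] C) :
    Set (UniformSpace.Completion C × UniformSpace.Completion C) :=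
  {p | (∃ w : ℕ → C,
      Tendsto (fun j => (w j : UniformSpace.Completion C)) atTop (𝓝 p.1) ∧
      Tendsto (fun ij : ℕ × ℕ => inner ℝ (A (w ij.1 - w ij.2)) (w ij.1 - w ij.2))
        atTop (𝓝 0)) ∧
    ∀ φ : C, inner ℝ p.1 (A φ : UniformSpace.Completion C) =
      inner ℝ p.2 (φ : UniformSpace.Completion C)}

variable {H : Type*} [NormedAddCommGroup H] [InnerProductSpace ℝ H]

/-- The (real) spectrum of the operator `D` with graph `G`: the `μ` for which `D - μ` has no bounded
everywhere defined inverse `R`. -/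
def graphSpectrum (G : Set (H × H)) : Set ℝ :=
  {μ | ¬ ∃ R : H →L[ℝ] H, ∀ u f : H, (u, f + μ • u) ∈ G ↔ u = R f}

/-- The essential spectrum of the operator with graph `G`: the cluster points of the spectrum
and the points of the spectrum that are eigenvalues of infinite multiplicity. -/
def graphEssSpectrum (G : Set (H × H)) : Set ℝ :=
  {μ | μ ∈ graphSpectrum G ∧
    (AccPt μ (𝓟 (graphSpectrum G)) ∨
      ¬ FiniteDimensional ℝ (Submodule.span ℝ {u : H | (u, μ • u) ∈ G}))}

end Operator

/-- The essential spectrum `σ_ess(k, ℝⁿ/Γ)` of the Hodge Laplacian on `L²` `k`-forms. (The manifold is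
complete, so the Friedrichs extension is the unique self-adjoint extension.) -/
noncomputable def essSpectrum {n : ℕ} (Γ : Subgroup (EucGroup n)) (k : ℕ) : Set ℝ :=
  graphEssSpectrum (friedrichsGraph (hodgeLaplacian Γ k))

/-- `λ₀^ess(k, ℝⁿ/Γ)`: the bottom of the essential spectrum (`⊤` if it is empty). -/
noncomputable def bottomEss {n : ℕ} (Γ : Subgroup (EucGroup n)) (k : ℕ) : EReal :=
  ⨅ μ ∈ essSpectrum Γ k, (μ : EReal)

end FlatForms

open FlatForms

/-! Comparison of groups. A translation in `Γ` automatically belongs to `Γ**` and to `Γ₂`, so `V₂`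
is the span of all translations in `Γ`. An element of `Γ₂` has trivial rotational part on `V₂ᗮ`,
which is the sum of `V₁` and `Vᗮ`. Some power of it is a pure translation, hence a translation along
`V₂`, so the element itself does not move points along `V₂ᗮ`. Thus the orthogonal projection `P`
onto `V₂ᗮ` is `Γ₂`-invariant and `Γ₂` acts cocompactly on its level sets
(`cocompactAlong_gammaTwo`). Noncompactness of the quotient is used only to get a nonzero vector of
`V₂ᗮ`.

Comparison of Rayleigh quotients. A test form on `ℝⁿ/Γ` is lifted to `ℝⁿ/Γ₂` and multiplied by a
cut-off `φ(P x / R)`. The cosets of `Γ₂` in `Γ` have polynomial growth, so there are arbitrarily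
large `R` at which the number of cosets is doubling (`exists_doubling`). At such scales the norm and
the energy of the cut-off form are `m` times those of the original form, up to a relative error
`O(1/R)` (`exists_averaging`, `exists_cutoff_approx`). The factor `m` cancels in the quotient
(`bottomRayleigh_le_of_le`). The same averaging, for the covering `ℝⁿ → ℝⁿ/Γ`, proves that `d` and
`δ` are adjoint (`l2Inner_dForm`), without a boundary integral over the fundamental domain.

Essential spectrum. Below the bottom of the Rayleigh quotients the Friedrichs extension has the
bounded resolvent `J J*`, where `J` maps the energy space to `L²` (`exists_resolvent`). This gives
`bottomRayleigh ≤ bottomEss` for both groups. For `Γ₂`, translations along `V₂ᗮ` commute with the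
group, and far translates of one test form are orthonormal after scaling, with the same Rayleigh
quotient (`exists_orthonormal_translates`). If the bottom were an isolated eigenvalue of finite
multiplicity, or outside the spectrum, only boundedly many orthonormal forms could have energy close
to it (`mem_graphEssSpectrum`); hence equality for `Γ₂`.

Existence of `V`. As in Bieberbach's theorem, elements of a discrete group whose rotations are close
to the identity commute (`commute_of_near`), because iterated commutators shrink to the identity.
The abelian group they generate contains `Γ*` and acts by translations on an affine subspace
(`exists_invariant_translations`); the displacements of `Γ*` there span `V`. -/

namespace FlatForms

variable {n : ℕ}

/-! ### Isometries of Euclidean space -/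

/-- The rotational part, as a group homomorphism. -/
noncomputable def lin : EucGroup n →* (Euc n ≃ₗᵢ[ℝ] Euc n) where
  toFun γ := γ.linearIsometryEquiv
  map_one' := rfl
  map_mul' _ _ := rfl

theorem lin_apply (γ : EucGroup n) : lin γ = γ.linearIsometryEquiv := rfl

theorem rot_apply (γ : EucGroup n) (v : Euc n) : rot γ v = lin γ v := rfl

theorem apply_sub_apply (γ : EucGroup n) (x y : Euc n) : γ x - γ y = lin γ (x - y) := by
  have := γ.map_vsub x y
  simpa [lin_apply] using this.symm

theorem apply_add (γ : EucGroup n) (x v : Euc n) : γ (x + v) = γ x + lin γ v := by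
  have := apply_sub_apply γ (x + v) x
  rw [add_sub_cancel_left] at this
  rw [← this, add_sub_cancel]

theorem apply_eq (γ : EucGroup n) (x : Euc n) : γ x = lin γ x + γ 0 := by
  have := apply_add γ 0 x
  rw [zero_add] at this
  rw [this, add_comm]

theorem mul_apply (γ γ' : EucGroup n) (x : Euc n) : (γ * γ') x = γ (γ' x) := rfl

theorem inv_apply_self (γ : EucGroup n) (x : Euc n) : γ⁻¹ (γ x) = x := γ.symm_apply_apply x

theorem apply_inv_self (γ : EucGroup n) (x : Euc n) : γ (γ⁻¹ x) = x := γ.apply_symm_apply x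

theorem lin_mul_apply (g h : Euc n ≃ₗᵢ[ℝ] Euc n) (x : Euc n) : (g * h) x = g (h x) := rfl

theorem lin_inv_apply_self (g : Euc n ≃ₗᵢ[ℝ] Euc n) (x : Euc n) : g⁻¹ (g x) = x :=
  g.symm_apply_apply x

theorem lin_apply_inv_self (g : Euc n ≃ₗᵢ[ℝ] Euc n) (x : Euc n) : g (g⁻¹ x) = x :=
  g.apply_symm_apply x

theorem transl_apply (v x : Euc n) : transl v x = v + x := rfl

theorem lin_transl (v : Euc n) : lin (transl v) = 1 := by
  ext1 x
  have := apply_eq (transl v) x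
  rw [transl_apply, transl_apply, add_zero, add_comm] at this
  exact (add_right_cancel this).symm

theorem ext_lin {γ γ' : EucGroup n} (h : lin γ = lin γ') {x : Euc n} (h0 : γ x = γ' x) :
    γ = γ' := by
  ext1 y
  have h1 := apply_add γ x (y - x)
  have h2 := apply_add γ' x (y - x)
  rw [add_sub_cancel] at h1 h2
  rw [h1, h2, h, h0]

theorem eq_transl_of_lin_eq_one {γ : EucGroup n} (h : lin γ = 1) : γ = transl (γ 0) :=
  ext_lin (x := 0) (by rw [h, lin_transl]) (by rw [transl_apply, add_zero])

theorem norm_apply_sub (γ : EucGroup n) (x y : Euc n) : ‖γ x - γ y‖ = ‖x - y‖ := by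
  rw [apply_sub_apply, LinearIsometryEquiv.norm_map]

theorem norm_apply_le (γ : EucGroup n) (x : Euc n) : ‖γ x‖ ≤ ‖x‖ + ‖γ 0‖ := by
  rw [apply_eq]
  exact (norm_add_le _ _).trans (by rw [LinearIsometryEquiv.norm_map])

theorem norm_apply_zero_le (γ : EucGroup n) (x : Euc n) : ‖γ 0‖ ≤ ‖γ x‖ + ‖x‖ := by
  have : γ 0 = γ x - lin γ x := by rw [apply_eq γ x]; abel
  rw [this]
  exact (norm_sub_le _ _).trans (by rw [LinearIsometryEquiv.norm_map])

theorem rot_mul (γ γ' : EucGroup n) : rot (γ * γ') = (rot γ).comp (rot γ') := rfl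

theorem rot_one : rot (1 : EucGroup n) = ContinuousLinearMap.id ℝ (Euc n) := rfl

theorem rot_transl (v : Euc n) : rot (transl v) = ContinuousLinearMap.id ℝ (Euc n) := by
  ext1 x
  rw [rot_apply, lin_transl]
  rfl

theorem norm_rot_apply (γ : EucGroup n) (v : Euc n) : ‖rot γ v‖ = ‖v‖ :=
  LinearIsometryEquiv.norm_map _ _

/-! ### Discreteness -/

theorem continuous_rot : Continuous (fun γ : EucGroup n => rot γ) :=
  continuous_fst.comp (continuous_induced_dom (f := fun γ : EucGroup n => (rot γ, γ 0)))

/-- In a discrete group, only the identity is close to the identity. -/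
theorem exists_eq_one_of_near {Γ : Subgroup (EucGroup n)} (h : DiscreteTopology Γ) :
    ∃ δ > 0, ∀ γ ∈ Γ, ‖rot γ - rot 1‖ < δ → ‖γ 0‖ < δ → γ = 1 := by
  have h1 : IsOpen ({1} : Set Γ) := isOpen_discrete _
  obtain ⟨t, ht, ht1⟩ := isOpen_induced_iff.1 h1
  obtain ⟨s, hs, hst⟩ := isOpen_induced_iff.1 ht
  have hmem : ((rot (1 : EucGroup n), (1 : EucGroup n) 0) : _ × _) ∈ s := by
    have : (1 : Γ) ∈ (Subtype.val ⁻¹' t : Set Γ) := by rw [ht1]; rfl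
    rw [← hst] at this
    exact this
  obtain ⟨δ, hδ, hball⟩ := Metric.isOpen_iff.1 hs _ hmem
  refine ⟨δ, hδ, fun γ hγ h2 h3 => ?_⟩
  have : (⟨γ, hγ⟩ : Γ) ∈ (Subtype.val ⁻¹' t : Set Γ) := by
    rw [← hst]
    refine hball ?_
    rw [Metric.mem_ball, Prod.dist_eq, max_lt_iff, dist_eq_norm, dist_eq_norm]
    exact ⟨h2, by simpa using h3⟩
  rw [ht1] at this
  exact congrArg Subtype.val this

theorem rot_inv_mul_sub (γ γ' : EucGroup n) : ‖rot (γ⁻¹ * γ') - rot 1‖ = ‖rot γ' - rot γ‖ := by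
  have key : ∀ v, ‖(rot (γ⁻¹ * γ') - rot 1 : Euc n →L[ℝ] Euc n) v‖ =
      ‖(rot γ' - rot γ : Euc n →L[ℝ] Euc n) v‖ := by
    intro v
    simp only [sub_apply, rot_apply, map_mul, map_one]
    rw [← LinearIsometryEquiv.norm_map (lin γ), map_sub, lin_mul_apply, map_inv,
      lin_apply_inv_self]
    rfl
  apply le_antisymm <;> refine ContinuousLinearMap.opNorm_le_bound _ (norm_nonneg _) fun v => ?_
  · rw [key]; exact ContinuousLinearMap.le_opNorm _ _
  · rw [← key]; exact ContinuousLinearMap.le_opNorm _ _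

theorem norm_inv_mul_zero (γ γ' : EucGroup n) : ‖(γ⁻¹ * γ') 0‖ = ‖γ' 0 - γ 0‖ := by
  rw [← norm_apply_sub γ⁻¹ (γ' 0), inv_apply_self, sub_zero, mul_apply]

theorem norm_rot_le (γ : EucGroup n) : ‖rot γ‖ ≤ 1 :=
  ContinuousLinearMap.opNorm_le_bound _ zero_le_one fun v => by rw [norm_rot_apply, one_mul]

/-- A totally bounded set with separated points is finite. -/
theorem finite_of_separated {X : Type*} [PseudoMetricSpace X] {s : Set X} (hs : TotallyBounded s)
    {δ : ℝ} (hδ : 0 < δ) (h : ∀ x ∈ s, ∀ y ∈ s, dist x y < δ → x = y) : s.Finite := by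
  obtain ⟨t, ht, hst⟩ := Metric.totallyBounded_iff.1 hs (δ / 2) (half_pos hδ)
  choose! f hf using fun x (hx : x ∈ s) => mem_iUnion₂.1 (hst hx)
  refine Set.Finite.of_finite_image (f := f) (ht.subset ?_) ?_
  · rintro _ ⟨x, hx, rfl⟩
    exact (hf x hx).1
  · intro x hx y hy hxy
    refine h x hx y hy ?_
    have h1 := Metric.mem_ball.1 (hf x hx).2
    have h2 := Metric.mem_ball.1 (hf y hy).2
    rw [← hxy] at h2
    calc dist x y ≤ dist x (f x) + dist y (f x) := dist_triangle_right _ _ _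
      _ < δ := by linarith

/-- A group of isometries is locally finite when only finitely many elements move the origin by
a bounded amount. -/
def LocFin (Γ : Subgroup (EucGroup n)) : Prop := ∀ R : ℝ, {γ | γ ∈ Γ ∧ ‖γ 0‖ ≤ R}.Finite

/-- The pairs `(rot γ, γ 0)` with `‖γ 0‖ ≤ R` lie in a compact ball. Left multiplication preserves
both distances, so the gap around the identity separates all of them by the same `δ`. -/
theorem locFin_of_discrete {Γ : Subgroup (EucGroup n)} (h : DiscreteTopology Γ) : LocFin Γ := by
  intro R
  obtain ⟨δ, hδ, hΓ⟩ := exists_eq_one_of_near h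
  let f : EucGroup n → (Euc n →L[ℝ] Euc n) × Euc n := fun γ => (rot γ, γ 0)
  have hinj : Function.Injective f := by
    intro γ γ' hh
    have h1 : rot γ = rot γ' := congrArg Prod.fst hh
    refine ext_lin (x := 0) ?_ (congrArg Prod.snd hh)
    ext1 v
    exact congrArg (fun T : Euc n →L[ℝ] Euc n => T v) h1
  refine Set.Finite.of_finite_image (f := f) ?_ hinj.injOn
  refine finite_of_separated (δ := δ) ?_ hδ ?_
  · refine (isCompact_closedBall (0 : (Euc n →L[ℝ] Euc n) × Euc n)
      (max 1 R)).totallyBounded.subset ?_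
    rintro _ ⟨γ, ⟨-, hγ⟩, rfl⟩
    rw [mem_closedBall_zero_iff, Prod.norm_def]
    exact max_le_max (norm_rot_le γ) hγ
  · rintro _ ⟨γ, ⟨hγ, -⟩, rfl⟩ _ ⟨γ', ⟨hγ', -⟩, rfl⟩ hd
    rw [Prod.dist_eq, max_lt_iff, dist_eq_norm, dist_eq_norm] at hd
    have := hΓ (γ'⁻¹ * γ) (Γ.mul_mem (Γ.inv_mem hγ') hγ) (by rw [rot_inv_mul_sub]; exact hd.1)
      (by rw [norm_inv_mul_zero]; exact hd.2)
    rw [inv_mul_eq_one.1 this]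

theorem LocFin.mono {Γ Γ' : Subgroup (EucGroup n)} (h : LocFin Γ) (hle : Γ' ≤ Γ) : LocFin Γ' :=
  fun R => (h R).subset fun _ hγ => ⟨hle hγ.1, hγ.2⟩

theorem FixedPointFree.mono {Γ Γ' : Subgroup (EucGroup n)} (h : FixedPointFree Γ)
    (hle : Γ' ≤ Γ) : FixedPointFree Γ' := fun γ hγ => h γ (hle hγ)

end FlatForms
namespace FlatForms
variable {n : ℕ}

/-! ### Elements with small rotational part commute -/

/-- The isometry `g` differs from the identity by at most `ε` in operator norm. -/
def Near (ε : ℝ) (g : Euc n ≃ₗᵢ[ℝ] Euc n) : Prop := ∀ v, ‖g v - v‖ ≤ ε * ‖v‖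

/-- At the vector `h (g w)` the commutator minus the identity is `(g h - h g) w`, and `g h - h g` is
the additive commutator of `g - 1` and `h - 1`. -/
theorem Near.commutator {ε δ : ℝ} (hε : 0 ≤ ε) {g h : Euc n ≃ₗᵢ[ℝ] Euc n} (hg : Near ε g)
    (hh : Near δ h) : Near (2 * ε * δ) (g * h * g⁻¹ * h⁻¹) := by
  intro v
  obtain ⟨w, rfl⟩ : ∃ w, v = h (g w) :=
    ⟨g⁻¹ (h⁻¹ v), by rw [lin_apply_inv_self, lin_apply_inv_self]⟩
  have e1 : (g * h * g⁻¹ * h⁻¹) (h (g w)) = g (h w) := by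
    simp only [lin_mul_apply, lin_inv_apply_self]
  have e2 : g (h w) - h (g w) = (g (h w - w) - (h w - w)) - (h (g w - w) - (g w - w)) := by
    simp only [map_sub]; abel
  rw [e1, e2, LinearIsometryEquiv.norm_map, LinearIsometryEquiv.norm_map]
  have h1 := hg (h w - w)
  have h2 := hh (g w - w)
  have h3 := hg w
  have h4 := hh w
  have h5 : ε * ‖h w - w‖ ≤ ε * (δ * ‖w‖) := mul_le_mul_of_nonneg_left h4 hε
  have h6 : ‖h (g w - w) - (g w - w)‖ ≤ ε * δ * ‖w‖ := by
    have : h (g w - w) - (g w - w) = (g (h w - w) - (h w - w)) - (g (h w) - h (g w)) := by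
      simp only [map_sub]; abel
    -- The sign of `δ` is not assumed; a negative `δ` forces `w = 0`.
    by_cases hδ : 0 ≤ δ
    · exact h2.trans (by nlinarith [mul_le_mul_of_nonneg_left h3 hδ])
    · have hw : ‖w‖ = 0 := by
        by_contra hw
        have : 0 < ‖w‖ := lt_of_le_of_ne (norm_nonneg _) (Ne.symm hw)
        nlinarith [norm_nonneg (h w - w)]
      have hw' : w = 0 := norm_eq_zero.1 hw
      simp [hw']
  calc _ ≤ _ := norm_sub_le _ _
    _ ≤ 2 * ε * δ * ‖w‖ := by nlinarith

/-- Conjugation by `x` turns `s` into `z s` and fixes `z`, so each further conjugation contributes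
one more factor `z`. -/
theorem pow_conj_eq {G : Type*} [Group G] {x s z : G} (hz : x * s * x⁻¹ * s⁻¹ = z)
    (hc : x * z = z * x) (j : ℕ) : x ^ j * s * (x ^ j)⁻¹ = z ^ j * s := by
  induction j with
  | zero => simp
  | succ j ih =>
    have h1 : x * s * x⁻¹ = z * s := by rw [← hz]; group
    have hc' : x * z ^ j = z ^ j * x := (Commute.pow_right (show Commute x z from hc) j).eq
    calc x ^ (j + 1) * s * (x ^ (j + 1))⁻¹ = x * (x ^ j * s * (x ^ j)⁻¹) * x⁻¹ := by
          rw [pow_succ' x]; group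
      _ = x * z ^ j * s * x⁻¹ := by rw [ih]; group
      _ = z ^ j * (x * s * x⁻¹) := by rw [hc']; group
      _ = z ^ (j + 1) * s := by rw [h1, pow_succ]; group

/-- If `x` commutes with its commutator with an isometry `s` close to the identity, then it
commutes with `s`. -/
theorem commutator_eq_one_of_near {θ : ℝ} (hθ : θ < 1) {x s : Euc n ≃ₗᵢ[ℝ] Euc n}
    (hs : Near θ s)
    (hc : x * (x * s * x⁻¹ * s⁻¹) = (x * s * x⁻¹ * s⁻¹) * x) : x * s * x⁻¹ * s⁻¹ = 1 := by
  set z := x * s * x⁻¹ * s⁻¹ with hz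
  ext1 v
  change z v = v
  -- The conjugate of `s` by `x ^ j` sends `p` to `z ^ (j + 1) v - z ^ j v`, so the sum over `j < N`
  -- telescopes and stays below `2 ‖v‖`. Each conjugate is as close to the identity as `s`, so the
  -- sum is also at least `N (1 - θ) ‖p‖`. Letting `N` grow gives `p = 0`.
  set p := s⁻¹ (z v - v) with hp
  have hsp : s p = z v - v := lin_apply_inv_self _ _
  have hsum : ∀ N : ℕ, ∑ j ∈ Finset.range N, (x ^ j * s * (x ^ j)⁻¹) p = (z ^ N) v - v := by
    intro N
    induction N with
    | zero => simp
    | succ N ih =>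
      rw [Finset.sum_range_succ, ih, pow_conj_eq hz.symm hc, lin_mul_apply, hsp, map_sub,
        pow_succ, lin_mul_apply]
      abel
  have hterm : ∀ j : ℕ, ‖(x ^ j * s * (x ^ j)⁻¹) p - p‖ ≤ θ * ‖p‖ := by
    intro j
    have e : (x ^ j * s * (x ^ j)⁻¹) p - p = (x ^ j) (s ((x ^ j)⁻¹ p) - (x ^ j)⁻¹ p) := by
      rw [map_sub, lin_apply_inv_self]; rfl
    rw [e, LinearIsometryEquiv.norm_map]
    exact (hs _).trans (by rw [LinearIsometryEquiv.norm_map])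
  have hN : ∀ N : ℕ, N * ((1 - θ) * ‖p‖) ≤ 2 * ‖v‖ := by
    intro N
    have h1 : ‖∑ j ∈ Finset.range N, ((x ^ j * s * (x ^ j)⁻¹) p - p)‖ ≤ N * (θ * ‖p‖) := by
      refine (norm_sum_le _ _).trans ?_
      refine (Finset.sum_le_sum fun j _ => hterm j).trans ?_
      simp
    rw [Finset.sum_sub_distrib, hsum] at h1
    simp only [Finset.sum_const, Finset.card_range] at h1
    have h2 : ‖N • p‖ ≤ ‖(z ^ N) v - v - N • p‖ + ‖(z ^ N) v - v‖ := by
      have := norm_sub_le ((z ^ N) v - v) ((z ^ N) v - v - N • p)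
      rw [sub_sub_cancel] at this
      linarith
    have h3 : ‖(z ^ N) v - v‖ ≤ 2 * ‖v‖ := by
      refine (norm_sub_le _ _).trans ?_
      rw [LinearIsometryEquiv.norm_map]; linarith
    have h4 : ‖N • p‖ = N * ‖p‖ := by rw [← Nat.cast_smul_eq_nsmul ℝ, norm_smul]; simp
    nlinarith
  have hp0 : ‖p‖ = 0 := by
    by_contra hne
    have hpos : 0 < (1 - θ) * ‖p‖ :=
      mul_pos (by linarith) (lt_of_le_of_ne (norm_nonneg _) (Ne.symm hne))
    obtain ⟨N, hN'⟩ := exists_nat_gt (2 * ‖v‖ / ((1 - θ) * ‖p‖))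
    rw [div_lt_iff₀ hpos] at hN'
    exact absurd (hN N) (not_le.2 hN')
  have : z v - v = 0 := by rw [← hsp, norm_eq_zero.1 hp0, map_zero]
  exact sub_eq_zero.1 this

/-- Iterated commutators `[γ, [γ, …, [γ, γ']]]`. -/
def engel {G : Type*} [Group G] (γ γ' : G) : ℕ → G
  | 0 => γ'
  | m + 1 => γ * engel γ γ' m * γ⁻¹ * (engel γ γ' m)⁻¹

theorem map_engel {G H : Type*} [Group G] [Group H] (f : G →* H) (γ γ' : G) (m : ℕ) :
    f (engel γ γ' m) = engel (f γ) (f γ') m := by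
  induction m with
  | zero => rfl
  | succ m ih => simp only [engel, map_mul, map_inv, ih]

theorem engel_mem {G : Type*} [Group G] {Γ : Subgroup G} {γ γ' : G} (h : γ ∈ Γ) (h' : γ' ∈ Γ)
    (m : ℕ) : engel γ γ' m ∈ Γ := by
  induction m with
  | zero => exact h'
  | succ m ih => exact Γ.mul_mem (Γ.mul_mem (Γ.mul_mem h ih) (Γ.inv_mem h)) (Γ.inv_mem ih)

theorem near_engel {g h : Euc n ≃ₗᵢ[ℝ] Euc n} (hg : Near (1 / 4) g) (hh : Near (1 / 4) h)
    (m : ℕ) : Near (1 / 4 * (1 / 2) ^ m) (engel g h m) := by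
  induction m with
  | zero => simpa [engel] using hh
  | succ m ih =>
    rw [show (1 / 4 * (1 / 2) ^ (m + 1) : ℝ) = 2 * (1 / 4) * (1 / 4 * (1 / 2) ^ m) by
      rw [pow_succ]; ring]
    exact Near.commutator (by norm_num) hg ih

/-- The commutator `d` of `γ` and `c` sends `c (γ 0)` to `γ (c 0)`. So `d 0` is made of the
displacements of `c 0`, `γ 0` and `c (γ 0)` under the rotations of `γ`, `c` and `d`. These are
bounded by `1/4`, `q/4` and `q/8` times the norms, where `q = (1/2) ^ m`. The coefficient `3` is
where the induction closes: `(3/8) · 3 + 3/8 = 3/2`. -/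
theorem norm_engel_zero {γ γ' : EucGroup n} (hg : Near (1 / 4) (lin γ))
    (hh : Near (1 / 4) (lin γ')) (m : ℕ) :
    ‖engel γ γ' m 0‖ ≤ (3 * ‖γ 0‖ + ‖γ' 0‖) * (1 / 2) ^ m := by
  induction m with
  | zero => simp [engel]
  | succ m ih =>
    set c := engel γ γ' m with hc
    have hcn : Near (1 / 4 * (1 / 2) ^ m) (lin c) := by
      rw [hc, map_engel]; exact near_engel hg hh m
    set q : ℝ := (1 / 2) ^ m with hq
    have hq0 : 0 ≤ q := by positivity
    have hq1 : q ≤ 1 := pow_le_one₀ (by norm_num) (by norm_num)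
    set d := γ * c * γ⁻¹ * c⁻¹ with hd
    have hdn := Near.commutator (by norm_num) hg hcn
    have e1 : d (c (γ 0)) = γ (c 0) := by
      simp only [hd, mul_apply, inv_apply_self]
    have e2 : γ (c 0) - c (γ 0) =
        (lin γ (c 0) - c 0) - (lin c (γ 0) - γ 0) := by
      rw [apply_eq γ (c 0), apply_eq c (γ 0)]; abel
    have e3 : d 0 = (γ (c 0) - c (γ 0)) - (lin d (c (γ 0)) - c (γ 0)) := by
      have := apply_eq d (c (γ 0))
      rw [e1] at this
      rw [this]; abel
    have hdl : lin d = lin γ * lin c * (lin γ)⁻¹ * (lin c)⁻¹ := by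
      simp only [hd, map_mul, map_inv]
    have h1 := hg (c 0)
    have h2 := hcn (γ 0)
    have h3 := hdn (c (γ 0))
    rw [← hdl] at h3
    have h4 := norm_apply_le c (γ 0)
    have h5 : ‖d 0‖ ≤ ‖lin γ (c 0) - c 0‖ + ‖lin c (γ 0) - γ 0‖ +
        ‖lin d (c (γ 0)) - c (γ 0)‖ := by
      rw [e3, e2]
      exact (norm_sub_le _ _).trans (add_le_add_left (norm_sub_le _ _) _)
    change ‖d 0‖ ≤ _
    rw [pow_succ, ← hq]
    have h6 : q * ‖c (γ 0)‖ ≤ q * (‖γ 0‖ + ‖c 0‖) := mul_le_mul_of_nonneg_left h4 hq0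
    have h7 : q * ‖c 0‖ ≤ ‖c 0‖ := mul_le_of_le_one_left (norm_nonneg _) hq1
    nlinarith [mul_nonneg hq0 (norm_nonneg (γ' 0)), mul_nonneg hq0 (norm_nonneg (γ 0))]

theorem norm_sub_le_of_near {ε : ℝ} (hε : 0 ≤ ε) {γ : EucGroup n} (h : Near ε (lin γ)) :
    ‖rot γ - rot 1‖ ≤ ε :=
  ContinuousLinearMap.opNorm_le_bound _ hε h

theorem exists_engel_eq_one {Γ : Subgroup (EucGroup n)} (hΓ : DiscreteTopology Γ)
    {γ γ' : EucGroup n} (hγ : γ ∈ Γ) (hγ' : γ' ∈ Γ) (hg : Near (1 / 4) (lin γ))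
    (hh : Near (1 / 4) (lin γ')) : ∃ M : ℕ, ∀ m ≥ M, engel γ γ' m = 1 := by
  obtain ⟨δ, hδ, h1⟩ := exists_eq_one_of_near hΓ
  have hlim : ∀ K : ℝ, Tendsto (fun m : ℕ => K * (1 / 2 : ℝ) ^ m) atTop (𝓝 0) := by
    intro K
    simpa using (tendsto_pow_atTop_nhds_zero_of_lt_one (r := (1 / 2 : ℝ)) (by norm_num)
      (by norm_num)).const_mul K
  obtain ⟨M, hM⟩ := eventually_atTop.1 (((hlim (1 / 4)).eventually (gt_mem_nhds hδ)).and
    ((hlim (3 * ‖γ 0‖ + ‖γ' 0‖)).eventually (gt_mem_nhds hδ)))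
  refine ⟨M, fun m hm => h1 _ (engel_mem hγ hγ' m) ?_ ?_⟩
  · refine (norm_sub_le_of_near (by positivity) ?_).trans_lt (hM m hm).1
    rw [map_engel]
    exact near_engel hg hh m
  · exact (norm_engel_zero hg hh m).trans_lt (hM m hm).2

/-- Downward induction: a trivial iterated commutator says that `g` commutes with the previous one,
which is itself the commutator of `g` with an isometry near the identity. Then
`commutator_eq_one_of_near` makes that previous one trivial too. -/
theorem commute_of_engel {g h : Euc n ≃ₗᵢ[ℝ] Euc n} (hg : Near (1 / 4) g) (hh : Near (1 / 4) h)
    (m : ℕ) (hm : engel g h (m + 1) = 1) : engel g h 1 = 1 := by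
  induction m with
  | zero => exact hm
  | succ m ih =>
    refine ih ?_
    have hn : Near (1 / 4) (engel g h m) := by
      intro v
      refine (near_engel hg hh m v).trans ?_
      have : (1 / 2 : ℝ) ^ m ≤ 1 := pow_le_one₀ (by norm_num) (by norm_num)
      nlinarith [norm_nonneg v]
    refine commutator_eq_one_of_near (by norm_num) hn ?_
    change g * engel g h (m + 1) = engel g h (m + 1) * g
    have : g * engel g h (m + 1) * g⁻¹ * (engel g h (m + 1))⁻¹ = 1 := hm
    rw [mul_inv_eq_one, mul_inv_eq_iff_eq_mul] at this
    exact this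

theorem inner_lin_sub_of_fixed (g : Euc n ≃ₗᵢ[ℝ] Euc n) {t : Euc n} (ht : g t = t) (a : Euc n) :
    inner ℝ (g a - a) t = 0 := by
  rw [inner_sub_left]
  have := g.inner_map_map a t
  rw [ht] at this
  rw [this, sub_self]

/-- The vector `g t - t` is fixed by `g` and lies in the range of `g - 1`, which is orthogonal to
all fixed vectors; so it is orthogonal to itself. -/
theorem lin_fixed_of_sq (g : Euc n ≃ₗᵢ[ℝ] Euc n) {t : Euc n}
    (ht : g (g t - t) = g t - t) : g t = t := by
  have := inner_lin_sub_of_fixed g ht t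
  exact sub_eq_zero.1 (inner_self_eq_zero.1 this)

/-- The commutator of `γ` with the translation by `w` is the translation by `(lin γ - 1) w`.
Termination therefore kills a power of `lin γ - 1` on `t`, and an isometry has no nilpotent part. -/
theorem engel_transl {γ γ' : EucGroup n} {t : Euc n} (h : engel γ γ' 1 = transl t) (m : ℕ)
    (hm : engel γ γ' (m + 2) = 1) : lin γ t = t := by
  have key : ∀ j : ℕ, ∃ w : Euc n, engel γ γ' (j + 1) = transl w ∧
      (lin γ w = w → lin γ t = t) := by
    intro j
    induction j with
    | zero => exact ⟨t, h, id⟩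
    | succ j ih =>
      obtain ⟨w, hw, hw'⟩ := ih
      refine ⟨lin γ w - w, ?_, fun h' => hw' (lin_fixed_of_sq _ h')⟩
      change γ * engel γ γ' (j + 1) * γ⁻¹ * (engel γ γ' (j + 1))⁻¹ = _
      rw [hw]
      refine ext_lin (x := transl w (γ 0)) ?_ ?_
      · simp [lin_transl]
      · change γ (transl w (γ⁻¹ ((transl w)⁻¹ (transl w (γ 0))))) = _
        rw [inv_apply_self, inv_apply_self, transl_apply, transl_apply, transl_apply, add_zero,
          apply_eq γ w]
        abel
  obtain ⟨w, hw, hw'⟩ := key m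
  refine hw' ?_
  have h1 : γ * engel γ γ' (m + 1) * γ⁻¹ * (engel γ γ' (m + 1))⁻¹ = 1 := hm
  rw [hw, mul_inv_eq_one, mul_inv_eq_iff_eq_mul] at h1
  have h2 := congrArg (fun φ : EucGroup n => φ 0) h1
  simp only [mul_apply, transl_apply, add_zero] at h2
  rw [apply_eq γ w] at h2
  exact add_right_cancel h2

/-- Elements of a discrete group whose rotational parts are close to the identity commute. -/
theorem commute_of_near {Γ : Subgroup (EucGroup n)} (hΓ : DiscreteTopology Γ)
    {γ γ' : EucGroup n} (hγ : γ ∈ Γ) (hγ' : γ' ∈ Γ) (hg : Near (1 / 4) (lin γ))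
    (hh : Near (1 / 4) (lin γ')) : γ * γ' = γ' * γ := by
  have main : ∀ γ γ' : EucGroup n, γ ∈ Γ → γ' ∈ Γ → Near (1 / 4) (lin γ) →
      Near (1 / 4) (lin γ') → ∃ t, engel γ γ' 1 = transl t ∧ lin γ t = t := by
    intro γ γ' hγ hγ' hg hh
    obtain ⟨M, hM⟩ := exists_engel_eq_one hΓ hγ hγ' hg hh
    have h1 : lin (engel γ γ' 1) = 1 := by
      rw [map_engel]
      refine commute_of_engel hg hh M ?_
      rw [← map_engel, hM _ (by omega), map_one]
    refine ⟨_, eq_transl_of_lin_eq_one h1, ?_⟩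
    exact engel_transl (eq_transl_of_lin_eq_one h1) M (hM _ (by omega))
  obtain ⟨t, ht, ht1⟩ := main γ γ' hγ hγ' hg hh
  obtain ⟨s, hs, hs1⟩ := main γ' γ hγ' hγ hh hg
  have e1 : γ * γ' = transl t * (γ' * γ) := by rw [← ht]; simp [engel]
  have e2 : γ' * γ = transl s * (γ * γ') := by rw [← hs]; simp [engel]
  have hts : s = -t := by
    have h := congrArg (fun φ : EucGroup n => φ 0) e1
    have h' := congrArg (fun φ : EucGroup n => φ 0) e2
    simp only [mul_apply, transl_apply] at h h'
    rw [h] at h'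
    have : s + t = 0 := by
      have h'' : (0 : Euc n) + γ' (γ 0) = (s + t) + γ' (γ 0) := by
        rw [zero_add, add_assoc]; exact h'
      exact (add_right_cancel h'').symm
    exact eq_neg_of_add_eq_zero_left this
  have ht2 : lin γ' t = t := by
    rw [hts, map_neg] at hs1
    exact neg_injective hs1
  -- Both rotations fix `t`, since the commutators in the two orders are inverse to each other. Here
  -- `t` is written as a difference of vectors in the ranges of `lin γ - 1` and `lin γ' - 1`, so it
  -- is orthogonal to itself.
  have hform : t = (lin γ (γ' 0) - γ' 0) - (lin γ' (γ 0) - γ 0) := by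
    have h := congrArg (fun φ : EucGroup n => φ 0) e1
    simp only [mul_apply, transl_apply] at h
    rw [apply_eq γ (γ' 0), apply_eq γ' (γ 0)] at h
    have : t = (lin γ (γ' 0) + γ 0) - (lin γ' (γ 0) + γ' 0) := by rw [h]; abel
    rw [this]; abel
  have h0 : inner ℝ t t = (0 : ℝ) := by
    nth_rewrite 1 [hform]
    rw [inner_sub_left, inner_lin_sub_of_fixed _ ht1, inner_lin_sub_of_fixed _ ht2, sub_zero]
  have ht0 : t = 0 := inner_self_eq_zero.1 h0
  rw [e1, ht0]
  have : transl (0 : Euc n) = 1 := ext_lin (x := 0) (by rw [lin_transl, map_one]) (by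
    rw [transl_apply, add_zero]; rfl)
  rw [this, one_mul]

end FlatForms
namespace FlatForms
variable {n : ℕ}

/-! ### Commuting isometries -/

theorem lin_fixed_of_inner (g : Euc n ≃ₗᵢ[ℝ] Euc n) {k : Euc n}
    (h : inner ℝ (g k - k) k = (0 : ℝ)) : g k = k := by
  have h1 : ‖g k - k‖ ^ 2 = 0 := by
    rw [inner_sub_left, real_inner_self_eq_norm_sq] at h
    rw [norm_sub_sq_real, LinearIsometryEquiv.norm_map]
    linarith
  exact sub_eq_zero.1 (norm_eq_zero.1 (pow_eq_zero_iff two_ne_zero |>.1 h1))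

/-- An isometry of an invariant subspace: every vector is a fixed vector up to the range of
`g - 1`. -/
theorem exists_fixed_translate (g : Euc n ≃ₗᵢ[ℝ] Euc n) {U : Submodule ℝ (Euc n)}
    (hU : ∀ u ∈ U, g u ∈ U) {b : Euc n} (hb : b ∈ U) :
    ∃ u ∈ U, g (b + (g u - u)) = b + (g u - u) := by
  let f : Euc n →ₗ[ℝ] Euc n := g.toLinearEquiv.toLinearMap - LinearMap.id
  let R : Submodule ℝ (Euc n) := U.map f
  obtain ⟨u, hu, hu'⟩ : R.starProjection b ∈ R := R.starProjection_apply_mem b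
  have hk : b - R.starProjection b ∈ Rᗮ := R.sub_starProjection_mem_orthogonal b
  have hfu : f u = g u - u := rfl
  refine ⟨-u, U.neg_mem hu, ?_⟩
  have e : b + (g (-u) - -u) = b - R.starProjection b := by
    rw [← hu', hfu, map_neg]; abel
  rw [e]
  refine lin_fixed_of_inner g ?_
  refine (Submodule.mem_orthogonal _ _).1 hk _ ⟨b - R.starProjection b, ?_, rfl⟩
  refine U.sub_mem hb ?_
  rw [← hu', hfu]
  exact U.sub_mem (hU u hu) hu

/-- Commuting isometries preserve an affine subspace on which they act by translations. -/
theorem exists_invariant_translations (S : Set (EucGroup n))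
    (hS : ∀ γ ∈ S, ∀ γ' ∈ S, γ * γ' = γ' * γ) :
    ∃ (c : Euc n) (U : Submodule ℝ (Euc n)), ∀ γ ∈ S, γ c - c ∈ U ∧ ∀ u ∈ U, lin γ u = u := by
  classical
  -- An invariant affine subspace `c + U` of least dimension works. If some `γ` rotated `U`
  -- nontrivially, the vectors of `U` fixed by `γ`, attached at a suitable point `c + u`, would give
  -- a smaller one.
  let P : ℕ → Prop := fun d => ∃ (c : Euc n) (U : Submodule ℝ (Euc n)),
    Module.finrank ℝ U = d ∧ ∀ γ ∈ S, γ c - c ∈ U ∧ ∀ u ∈ U, lin γ u ∈ U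
  have hP : ∃ d, P d := ⟨_, 0, ⊤, rfl, fun γ _ => ⟨trivial, fun _ _ => trivial⟩⟩
  obtain ⟨c, U, hd, hU⟩ := Nat.find_spec hP
  refine ⟨c, U, fun γ hγ => ⟨(hU γ hγ).1, ?_⟩⟩
  by_contra hne
  push Not at hne
  obtain ⟨v, hv, hv'⟩ := hne
  obtain ⟨u, hu, hfix⟩ := exists_fixed_translate (lin γ) (hU γ hγ).2 (hU γ hγ).1
  let K : Submodule ℝ (Euc n) :=
    U ⊓ LinearMap.ker ((lin γ).toLinearEquiv.toLinearMap - LinearMap.id)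
  have hK : ∀ w, w ∈ K ↔ w ∈ U ∧ lin γ w = w := by
    intro w
    simp only [K, Submodule.mem_inf, LinearMap.mem_ker, LinearMap.sub_apply, sub_eq_zero]
    rfl
  have hlt : Module.finrank ℝ K < Nat.find hP := by
    rw [← hd]
    refine Submodule.finrank_lt_finrank_of_lt (lt_of_le_of_ne inf_le_left ?_)
    intro h
    rw [← h] at hv
    exact hv' ((hK v).1 hv).2
  refine Nat.find_min hP hlt ⟨c + u, K, rfl, fun γ' hγ' => ⟨(hK _).2 ⟨?_, ?_⟩, fun w hw => ?_⟩⟩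
  · rw [apply_add]
    have : γ' c + lin γ' u - (c + u) = (γ' c - c) + (lin γ' u - u) := by abel
    rw [this]
    exact U.add_mem (hU γ' hγ').1 (U.sub_mem ((hU γ' hγ').2 u hu) hu)
  · have hb : γ (c + u) - (c + u) = γ c - c + (lin γ u - u) := by rw [apply_add]; abel
    rw [← hb] at hfix
    set x := c + u with hx
    set w := γ' x - x with hw
    have hcomm := congrArg (fun φ : EucGroup n => φ x) (hS γ hγ γ' hγ')
    simp only [mul_apply] at hcomm
    have h1 : γ (γ' x) = γ x + lin γ w := by rw [← apply_add, hw, add_sub_cancel]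
    have h2 : γ' (γ x) = γ' x + lin γ' (γ x - x) := by rw [← apply_add, add_sub_cancel]
    have h3 : lin γ w - w = lin γ' (γ x - x) - (γ x - x) := by
      have : lin γ w = γ' x + lin γ' (γ x - x) - γ x := by
        rw [← h2, ← hcomm, h1, add_sub_cancel_left]
      rw [this, hw]; abel
    have hlc : ∀ y, lin γ (lin γ' y) = lin γ' (lin γ y) := by
      intro y
      have := congrArg (fun φ => lin φ y) (hS γ hγ γ' hγ')
      simpa only [map_mul, lin_mul_apply] using this
    -- For the displacement `w` of `x` under `γ'`, commutation makes `(lin γ - 1) w` equal to `(lin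
    -- γ' - 1)` applied to a vector fixed by `lin γ`, which is again fixed by `lin γ`.
    refine lin_fixed_of_sq _ ?_
    rw [h3, map_sub, hlc, hfix]
  · obtain ⟨hw1, hw2⟩ := (hK w).1 hw
    refine (hK _).2 ⟨(hU γ' hγ').2 w hw1, ?_⟩
    have := congrArg (fun φ => lin φ w) (hS γ hγ γ' hγ')
    simp only [map_mul, lin_mul_apply] at this
    rw [this, hw2]

/-! ### The identity component of the closure of the rotational parts -/

/-- The closure of the group of rotational parts. -/
def rotClosure (Γ : Subgroup (EucGroup n)) : Set (Euc n →L[ℝ] Euc n) :=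
  closure (rot '' (Γ : Set (EucGroup n)))

/-- The identity component of the closure of the group of rotational parts. -/
def rotComp (Γ : Subgroup (EucGroup n)) : Set (Euc n →L[ℝ] Euc n) :=
  connectedComponentIn (rotClosure Γ) (rot 1)

theorem rot_one_mem_rotClosure (Γ : Subgroup (EucGroup n)) : rot 1 ∈ rotClosure Γ :=
  subset_closure ⟨1, Γ.one_mem, rfl⟩

theorem rot_one_mem_rotComp (Γ : Subgroup (EucGroup n)) : rot 1 ∈ rotComp Γ :=
  mem_connectedComponentIn (rot_one_mem_rotClosure Γ)

theorem rotComp_subset (Γ : Subgroup (EucGroup n)) : rotComp Γ ⊆ rotClosure Γ :=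
  connectedComponentIn_subset _ _

theorem norm_apply_of_mem_rotClosure {Γ : Subgroup (EucGroup n)} {X : Euc n →L[ℝ] Euc n}
    (hX : X ∈ rotClosure Γ) (v : Euc n) : ‖X v‖ = ‖v‖ := by
  have hc : IsClosed {X : Euc n →L[ℝ] Euc n | ‖X v‖ = ‖v‖} :=
    isClosed_eq (ContinuousLinearMap.apply ℝ (Euc n) v).continuous.norm continuous_const
  refine closure_minimal ?_ hc hX
  rintro _ ⟨γ, -, rfl⟩
  exact norm_rot_apply γ v

theorem mul_mem_rotClosure {Γ : Subgroup (EucGroup n)} {X Y : Euc n →L[ℝ] Euc n}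
    (hX : X ∈ rotClosure Γ) (hY : Y ∈ rotClosure Γ) : X * Y ∈ rotClosure Γ := by
  refine map_mem_closure₂ continuous_mul hX hY ?_
  rintro _ ⟨γ, hγ, rfl⟩ _ ⟨γ', hγ', rfl⟩
  exact ⟨γ * γ', Γ.mul_mem hγ hγ', rfl⟩

theorem adjoint_rot (γ : EucGroup n) : ContinuousLinearMap.adjoint (rot γ) = rot γ⁻¹ :=
  LinearIsometryEquiv.adjoint_eq_symm γ.linearIsometryEquiv

theorem adjoint_mem_rotClosure {Γ : Subgroup (EucGroup n)} {X : Euc n →L[ℝ] Euc n}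
    (hX : X ∈ rotClosure Γ) : ContinuousLinearMap.adjoint X ∈ rotClosure Γ := by
  refine map_mem_closure (LinearIsometryEquiv.continuous _) hX ?_
  rintro _ ⟨γ, hγ, rfl⟩
  exact ⟨γ⁻¹, Γ.inv_mem hγ, (adjoint_rot γ).symm⟩

theorem isPreconnected_rotComp (Γ : Subgroup (EucGroup n)) : IsPreconnected (rotComp Γ) :=
  isPreconnected_connectedComponentIn

theorem mul_mem_rotComp {Γ : Subgroup (EucGroup n)} {X Y : Euc n →L[ℝ] Euc n}
    (hX : X ∈ rotComp Γ) (hY : Y ∈ rotComp Γ) : X * Y ∈ rotComp Γ := by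
  have h1 : rotComp Γ = connectedComponentIn (rotClosure Γ) X := connectedComponentIn_eq hX
  have h2 : (fun Z => X * Z) '' rotComp Γ ⊆ connectedComponentIn (rotClosure Γ) X := by
    refine IsPreconnected.subset_connectedComponentIn
      ((isPreconnected_rotComp Γ).image _ (continuous_const_mul X).continuousOn) ?_ ?_
    · exact ⟨rot 1, rot_one_mem_rotComp Γ, mul_one X⟩
    · rintro _ ⟨Z, hZ, rfl⟩
      exact mul_mem_rotClosure (rotComp_subset Γ hX) (rotComp_subset Γ hZ)
  rw [h1]
  exact h2 ⟨Y, hY, rfl⟩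

theorem adjoint_mem_rotComp {Γ : Subgroup (EucGroup n)} {X : Euc n →L[ℝ] Euc n}
    (hX : X ∈ rotComp Γ) : ContinuousLinearMap.adjoint X ∈ rotComp Γ := by
  have h2 : ContinuousLinearMap.adjoint '' rotComp Γ ⊆ rotComp Γ := by
    refine IsPreconnected.subset_connectedComponentIn
      ((isPreconnected_rotComp Γ).image _ (LinearIsometryEquiv.continuous _).continuousOn) ?_ ?_
    · exact ⟨rot 1, rot_one_mem_rotComp Γ, by rw [adjoint_rot, inv_one]⟩
    · rintro _ ⟨Z, hZ, rfl⟩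
      exact adjoint_mem_rotClosure (rotComp_subset Γ hZ)
  exact h2 ⟨X, hX, rfl⟩

theorem isCompact_rotComp (Γ : Subgroup (EucGroup n)) : IsCompact (rotComp Γ) := by
  have hclosed : IsClosed (rotComp Γ) := by
    refine isClosed_of_closure_subset ?_
    refine IsPreconnected.subset_connectedComponentIn (isPreconnected_rotComp Γ).closure
      (subset_closure (rot_one_mem_rotComp Γ)) ?_
    exact closure_minimal (rotComp_subset Γ) isClosed_closure
  refine (isCompact_closedBall (0 : Euc n →L[ℝ] Euc n) 1).of_isClosed_subset hclosed ?_
  intro X hX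
  rw [mem_closedBall_zero_iff]
  refine ContinuousLinearMap.opNorm_le_bound _ zero_le_one fun v => ?_
  rw [norm_apply_of_mem_rotClosure (rotComp_subset Γ hX), one_mul]

/-- The continuous linear map underlying a linear isometry. -/
noncomputable def clm (g : Euc n ≃ₗᵢ[ℝ] Euc n) : Euc n →L[ℝ] Euc n :=
  (g.toContinuousLinearEquiv : Euc n →L[ℝ] Euc n)

theorem exists_clm_eq {X : Euc n →L[ℝ] Euc n} (hX : ∀ v, ‖X v‖ = ‖v‖) :
    ∃ g : Euc n ≃ₗᵢ[ℝ] Euc n, clm g = X := by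
  let f : Euc n →ₗᵢ[ℝ] Euc n := { X.toLinearMap with norm_map' := hX }
  exact ⟨f.toLinearIsometryEquiv rfl, by ext1 v; rfl⟩

theorem exists_rot_eq {X : Euc n →L[ℝ] Euc n} (hX : ∀ v, ‖X v‖ = ‖v‖) (a : Euc n) :
    ∃ γ : EucGroup n, rot γ = X ∧ γ 0 = a := by
  obtain ⟨g, rfl⟩ := exists_clm_eq hX
  refine ⟨transl a * g.toAffineIsometryEquiv, ?_, ?_⟩
  · rw [rot_mul, rot_transl]
    ext1 v
    rfl
  · rw [mul_apply, transl_apply]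
    change a + g 0 = a
    rw [map_zero, add_zero]

/-- The torus of rotational parts. -/
noncomputable def rotTorus (Γ : Subgroup (EucGroup n)) : Subgroup (Euc n ≃ₗᵢ[ℝ] Euc n) where
  carrier := {g | clm g ∈ rotComp Γ}
  one_mem' := rot_one_mem_rotComp Γ
  mul_mem' := fun ha hb => mul_mem_rotComp ha hb
  inv_mem' := by
    intro g hg
    have := adjoint_mem_rotComp hg
    rw [show ContinuousLinearMap.adjoint (clm g) = clm g⁻¹ from
      LinearIsometryEquiv.adjoint_eq_symm g] at this
    exact this

theorem image_rotTorus (Γ : Subgroup (EucGroup n)) :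
    clm '' (rotTorus Γ : Set (Euc n ≃ₗᵢ[ℝ] Euc n)) = rotComp Γ := by
  ext X
  constructor
  · rintro ⟨g, hg, rfl⟩
    exact hg
  · intro hX
    obtain ⟨g, rfl⟩ := exists_clm_eq (norm_apply_of_mem_rotClosure (rotComp_subset Γ hX))
    exact ⟨g, hX, rfl⟩

theorem isInducing_rot_zero :
    IsInducing (fun γ : EucGroup n => ((rot γ, γ 0) : (Euc n →L[ℝ] Euc n) × Euc n)) := ⟨rfl⟩

/-- In the coordinates `(rot γ, γ 0)` the closure of `Γ · ℝⁿ` is `rotClosure Γ` times all of `ℝⁿ`.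
The second factor is connected, so the identity component depends on the rotational part alone. -/
theorem mem_gammaStar_iff {Γ : Subgroup (EucGroup n)} {γ : EucGroup n} :
    γ ∈ gammaStar Γ ↔ γ ∈ Γ ∧ rot γ ∈ rotComp Γ := by
  set Y : Set (EucGroup n) := {g | ∃ γ ∈ Γ, ∃ v : Euc n, g = γ * transl v} with hY
  have hrotY : ∀ g ∈ closure Y, rot g ∈ rotClosure Γ := by
    intro g hg
    refine map_mem_closure continuous_rot hg ?_
    rintro _ ⟨γ, hγ, v, rfl⟩
    exact ⟨γ, hγ, by rw [rot_mul, rot_transl, ContinuousLinearMap.comp_id]⟩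
  have h1Y : (1 : EucGroup n) ∈ closure Y :=
    subset_closure ⟨1, Γ.one_mem, 0, by
      rw [one_mul]
      exact ext_lin (x := 0) (by rw [lin_transl, map_one]) (by rw [transl_apply, add_zero]; rfl)⟩
  refine and_congr_right fun hγ => ⟨fun h => ?_, fun h => ?_⟩
  · have : rot '' connectedComponentIn (closure Y) 1 ⊆ rotComp Γ := by
      refine IsPreconnected.subset_connectedComponentIn
        (isPreconnected_connectedComponentIn.image _ continuous_rot.continuousOn) ?_ ?_
      · exact ⟨1, mem_connectedComponentIn h1Y, rfl⟩
      · rintro _ ⟨g, hg, rfl⟩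
        exact hrotY g (connectedComponentIn_subset _ _ hg)
    exact this ⟨γ, h, rfl⟩
  · have himg : (fun γ : EucGroup n => ((rot γ, γ 0) : (Euc n →L[ℝ] Euc n) × Euc n)) ''
        {g | rot g ∈ rotComp Γ} = rotComp Γ ×ˢ univ := by
      ext ⟨X, a⟩
      constructor
      · rintro ⟨g, hg, heq⟩
        rw [← heq]
        exact ⟨hg, trivial⟩
      · rintro ⟨hX, -⟩
        obtain ⟨g, hg, hg'⟩ := exists_rot_eq
          (norm_apply_of_mem_rotClosure (rotComp_subset Γ hX)) a
        exact ⟨g, by rw [mem_ofPred_eq, hg]; exact hX, Prod.ext hg hg'⟩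
    have hpre : IsPreconnected {g : EucGroup n | rot g ∈ rotComp Γ} := by
      rw [← isInducing_rot_zero.isPreconnected_image, himg]
      exact (isPreconnected_rotComp Γ).prod isPreconnected_univ
    refine hpre.subset_connectedComponentIn (rot_one_mem_rotComp Γ) ?_ h
    intro g hg
    rw [isInducing_rot_zero.closure_eq_preimage_closure_image, mem_preimage]
    have hsub : (rot '' (Γ : Set (EucGroup n))) ×ˢ (univ : Set (Euc n)) ⊆
        (fun γ : EucGroup n => ((rot γ, γ 0) : (Euc n →L[ℝ] Euc n) × Euc n)) '' Y := by
      rintro ⟨_, a⟩ ⟨⟨γ', hγ', rfl⟩, -⟩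
      refine ⟨γ' * transl (γ'⁻¹ a), ⟨γ', hγ', _, rfl⟩, ?_⟩
      refine Prod.ext ?_ ?_
      · change rot (γ' * transl (γ'⁻¹ a)) = rot γ'
        rw [rot_mul, rot_transl, ContinuousLinearMap.comp_id]
      · change γ' (transl (γ'⁻¹ a) 0) = a
        rw [transl_apply, add_zero, apply_inv_self]
    refine closure_mono hsub ?_
    rw [closure_prod_eq, closure_univ]
    exact ⟨rotComp_subset Γ hg, trivial⟩

/-! ### The subgroup generated by the elements with small rotational part -/

/-- The subgroup generated by the elements whose rotational part is close to the identity. -/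
noncomputable def nearGroup (Γ : Subgroup (EucGroup n)) : Subgroup (EucGroup n) :=
  Subgroup.closure {γ | γ ∈ Γ ∧ Near (1 / 4) (lin γ)}

theorem nearGroup_le (Γ : Subgroup (EucGroup n)) : nearGroup Γ ≤ Γ :=
  (Subgroup.closure_le _).2 fun _ h => h.1

theorem nearGroup_commute {Γ : Subgroup (EucGroup n)} (hΓ : DiscreteTopology Γ)
    {γ γ' : EucGroup n} (h : γ ∈ nearGroup Γ) (h' : γ' ∈ nearGroup Γ) : γ * γ' = γ' * γ := by
  set S : Set (EucGroup n) := {γ | γ ∈ Γ ∧ Near (1 / 4) (lin γ)} with hS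
  have h1 : S ⊆ Subgroup.centralizer S := fun a ha =>
    Subgroup.mem_centralizer_iff.2 fun b hb => commute_of_near hΓ hb.1 ha.1 hb.2 ha.2
  have h2 : nearGroup Γ ≤ Subgroup.centralizer S := (Subgroup.closure_le _).2 h1
  have h3 : S ⊆ Subgroup.centralizer (nearGroup Γ : Set (EucGroup n)) := fun a ha =>
    Subgroup.mem_centralizer_iff.2 fun b hb =>
      (Subgroup.mem_centralizer_iff.1 (h2 hb) a ha).symm
  have h4 : nearGroup Γ ≤ Subgroup.centralizer (nearGroup Γ : Set (EucGroup n)) :=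
    (Subgroup.closure_le _).2 h3
  exact (Subgroup.mem_centralizer_iff.1 (h4 h) γ' h').symm

theorem mem_nearGroup_of_norm_le {Γ : Subgroup (EucGroup n)} {α γ : EucGroup n}
    (hα : α ∈ nearGroup Γ) (hγ : γ ∈ Γ) (h : ‖rot γ - rot α‖ ≤ 1 / 4) : γ ∈ nearGroup Γ := by
  have h1 : α⁻¹ * γ ∈ nearGroup Γ := by
    refine Subgroup.subset_closure ⟨Γ.mul_mem (Γ.inv_mem (nearGroup_le Γ hα)) hγ, fun v => ?_⟩
    rw [← rot_inv_mul_sub] at h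
    exact ContinuousLinearMap.le_of_opNorm_le _ h v
  have := (nearGroup Γ).mul_mem hα h1
  rwa [mul_inv_cancel_left] at this

/-- Balls of radius `1/8` around the rotations of `nearGroup Γ`, and around those of the other
elements of `Γ`, are two disjoint open sets covering `rotClosure Γ`: rotations at distance at most
`1/4` belong to the same coset of `nearGroup Γ`. The connected set `rotComp Γ` stays on the side of
the identity. -/
theorem rotComp_near (Γ : Subgroup (EucGroup n)) :
    (∀ γ ∈ Γ, rot γ ∈ rotComp Γ → γ ∈ nearGroup Γ) ∧ rotComp Γ ⊆ rotClosure (nearGroup Γ) := by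
  set u : Set (Euc n →L[ℝ] Euc n) := ⋃ α ∈ nearGroup Γ, Metric.ball (rot α) (1 / 8) with hu
  set v : Set (Euc n →L[ℝ] Euc n) :=
    ⋃ γ ∈ {γ | γ ∈ Γ ∧ γ ∉ nearGroup Γ}, Metric.ball (rot γ) (1 / 8) with hv
  have huo : IsOpen u := isOpen_biUnion fun _ _ => Metric.isOpen_ball
  have hvo : IsOpen v := isOpen_biUnion fun _ _ => Metric.isOpen_ball
  have huv : Disjoint u v := by
    rw [Set.disjoint_left]
    intro X hX hX'
    obtain ⟨α, hα, h1⟩ := mem_iUnion₂.1 hX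
    obtain ⟨γ, hγ, h2⟩ := mem_iUnion₂.1 hX'
    refine hγ.2 (mem_nearGroup_of_norm_le hα hγ.1 ?_)
    rw [← dist_eq_norm]
    rw [Metric.mem_ball] at h1 h2
    linarith [dist_triangle_left (rot γ) (rot α) X]
  have hcover : rotClosure Γ ⊆ u ∪ v := by
    intro X hX
    obtain ⟨_, ⟨γ, hγ, rfl⟩, hd⟩ := Metric.mem_closure_iff.1 hX (1 / 8) (by norm_num)
    by_cases h : γ ∈ nearGroup Γ
    · exact Or.inl (mem_iUnion₂.2 ⟨γ, h, hd⟩)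
    · exact Or.inr (mem_iUnion₂.2 ⟨γ, ⟨hγ, h⟩, hd⟩)
  have hsub : rotComp Γ ⊆ u := by
    refine (isPreconnected_rotComp Γ).subset_left_of_subset_union huo hvo huv
      ((rotComp_subset Γ).trans hcover) ⟨rot 1, rot_one_mem_rotComp Γ, ?_⟩
    exact mem_iUnion₂.2 ⟨1, (nearGroup Γ).one_mem, Metric.mem_ball_self (by norm_num)⟩
  have hmem : ∀ γ ∈ Γ, rot γ ∈ u → γ ∈ nearGroup Γ := by
    intro γ hγ h
    obtain ⟨α, hα, h1⟩ := mem_iUnion₂.1 h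
    refine mem_nearGroup_of_norm_le hα hγ ?_
    rw [← dist_eq_norm]
    exact (Metric.mem_ball.1 h1).le.trans (by norm_num)
  refine ⟨fun γ hγ h => hmem γ hγ (hsub h), fun X hX => ?_⟩
  refine mem_closure_iff_nhds.2 fun t ht => ?_
  obtain ⟨Y, hY, γ, hγ, rfl⟩ := mem_closure_iff_nhds.1 (rotComp_subset Γ hX) (t ∩ u)
    (inter_mem ht (huo.mem_nhds (hsub hX)))
  exact ⟨rot γ, hY.1, γ, hmem γ hγ hY.2, rfl⟩

/-! ### Existence of the lattice subspace -/

/-- Choose a basis of the span inside `s` and round the coordinates down; discreteness plays no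
role. -/
theorem exists_bound_sub_mem (s : Set (Euc n)) :
    ∃ C : ℝ, ∀ v ∈ Submodule.span ℝ s, ∃ l ∈ AddSubgroup.closure s, ‖v - l‖ ≤ C := by
  obtain ⟨b, hbs, hspan, hli⟩ := exists_linearIndependent ℝ s
  have hfin : b.Finite := hli.setFinite
  lift b to Finset (Euc n) using hfin
  refine ⟨∑ a ∈ b, ‖a‖, fun v hv => ?_⟩
  rw [← hspan] at hv
  obtain ⟨f, -, rfl⟩ := Submodule.mem_span_finset.1 hv
  refine ⟨∑ a ∈ b, ⌊f a⌋ • a, AddSubgroup.sum_mem _ fun a ha =>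
    AddSubgroup.zsmul_mem _ (AddSubgroup.subset_closure (hbs ha)) _, ?_⟩
  rw [← Finset.sum_sub_distrib]
  refine (norm_sum_le _ _).trans (Finset.sum_le_sum fun a _ => ?_)
  rw [← Int.cast_smul_eq_zsmul ℝ, ← sub_smul, norm_smul]
  refine mul_le_of_le_one_left (norm_nonneg _) ?_
  rw [Real.norm_eq_abs, Int.self_sub_floor, Int.abs_fract]
  exact (Int.fract_lt_one _).le

theorem discreteTopology_of_finite {L : AddSubgroup (Euc n)}
    (h : {l | l ∈ L ∧ ‖l‖ ≤ 1}.Finite) : DiscreteTopology L := by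
  refine discreteTopology_of_isOpen_singleton_zero ?_
  have h1 : IsOpen (Metric.ball (0 : Euc n) 1 \ ({l | l ∈ L ∧ ‖l‖ ≤ 1} \ {0})) :=
    Metric.isOpen_ball.sdiff (h.subset sdiff_subset).isClosed
  refine isOpen_induced_iff.2 ⟨_, h1, ?_⟩
  ext ⟨l, hl⟩
  simp only [mem_preimage, Set.mem_sdiff, mem_ball_zero_iff, mem_ofPred_eq, mem_singleton_iff]
  constructor
  · rintro ⟨h2, h3⟩
    by_contra h4
    exact h3 ⟨⟨hl, h2.le⟩, fun h5 => h4 (Subtype.ext h5)⟩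
  · intro h2
    have : l = 0 := congrArg Subtype.val h2
    subst this
    simp

/-- The abelian group `nearGroup Γ` contains `Γ*` and translates `c + U`, so `γ ↦ γ c - c` is
additive on `Γ*`; its image is `L`, and `V` is the span of `L`. The torus is `rotTorus Γ`: its
elements are limits of rotations from `nearGroup Γ`, hence commute and fix `U`. Injectivity on `Γ*`
is freeness at `c`. -/
theorem exists_isLatticeSubspace {Γ : Subgroup (EucGroup n)} (hΓ : DiscreteTopology Γ)
    (hfree : FixedPointFree Γ) : ∃ V : Submodule ℝ (Euc n), IsLatticeSubspace Γ V := by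
  obtain ⟨c, U, hU⟩ := exists_invariant_translations (nearGroup Γ : Set (EucGroup n))
    fun γ hγ γ' hγ' => nearGroup_commute hΓ hγ hγ'
  obtain ⟨hnear, hclos⟩ := rotComp_near Γ
  have hstar : ∀ γ ∈ gammaStar Γ, γ ∈ nearGroup Γ := fun γ hγ =>
    hnear γ (mem_gammaStar_iff.1 hγ).1 (mem_gammaStar_iff.1 hγ).2
  have hadd : ∀ γ ∈ gammaStar Γ, ∀ γ' ∈ gammaStar Γ,
      (γ * γ') c - c = (γ c - c) + (γ' c - c) := by
    intro γ hγ γ' hγ'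
    have h1 := apply_add γ c (γ' c - c)
    rw [add_sub_cancel, (hU γ (hstar γ hγ)).2 _ (hU γ' (hstar γ' hγ')).1] at h1
    rw [mul_apply, h1]; abel
  have hmul : ∀ γ ∈ gammaStar Γ, ∀ γ' ∈ gammaStar Γ, γ * γ' ∈ gammaStar Γ := by
    intro γ hγ γ' hγ'
    rw [mem_gammaStar_iff] at *
    exact ⟨Γ.mul_mem hγ.1 hγ'.1, mul_mem_rotComp hγ.2 hγ'.2⟩
  have hone : (1 : EucGroup n) ∈ gammaStar Γ :=
    mem_gammaStar_iff.2 ⟨Γ.one_mem, rot_one_mem_rotComp Γ⟩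
  have hinv : ∀ γ ∈ gammaStar Γ, γ⁻¹ ∈ gammaStar Γ := by
    intro γ hγ
    rw [mem_gammaStar_iff] at *
    exact ⟨Γ.inv_mem hγ.1, by rw [← adjoint_rot]; exact adjoint_mem_rotComp hγ.2⟩
  let L : AddSubgroup (Euc n) :=
    { carrier := (fun γ : EucGroup n => γ c - c) '' gammaStar Γ
      zero_mem' := ⟨1, hone, sub_self c⟩
      add_mem' := by
        rintro _ _ ⟨γ, hγ, rfl⟩ ⟨γ', hγ', rfl⟩
        exact ⟨γ * γ', hmul γ hγ γ' hγ', hadd γ hγ γ' hγ'⟩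
      neg_mem' := by
        rintro _ ⟨γ, hγ, rfl⟩
        refine ⟨γ⁻¹, hinv γ hγ, ?_⟩
        have := hadd γ hγ γ⁻¹ (hinv γ hγ)
        rw [mul_inv_cancel] at this
        have h0 : (1 : EucGroup n) c - c = 0 := sub_self c
        rw [h0] at this
        exact (neg_eq_of_add_eq_zero_right this.symm).symm }
  have hLU : ∀ l ∈ L, l ∈ U := by
    rintro _ ⟨γ, hγ, rfl⟩
    exact (hU γ (hstar γ hγ)).1
  have hVU : Submodule.span ℝ (L : Set (Euc n)) ≤ U := Submodule.span_le.2 hLU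
  have hfixU : ∀ X ∈ rotComp Γ, ∀ v ∈ U, X v = v := by
    intro X hX v hv
    have hc : IsClosed {X : Euc n →L[ℝ] Euc n | X v = v} :=
      isClosed_eq (ContinuousLinearMap.apply ℝ (Euc n) v).continuous continuous_const
    refine closure_minimal ?_ hc (hclos hX)
    rintro _ ⟨γ, hγ, rfl⟩
    exact (hU γ hγ).2 v hv
  have hcomm : ∀ X ∈ rotComp Γ, ∀ Y ∈ rotComp Γ, X * Y = Y * X := by
    intro X hX Y hY
    have hc : IsClosed {p : (Euc n →L[ℝ] Euc n) × (Euc n →L[ℝ] Euc n) |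
        p.1 * p.2 = p.2 * p.1} :=
      isClosed_eq (continuous_fst.mul continuous_snd) (continuous_snd.mul continuous_fst)
    have hXY : (X, Y) ∈ closure ((rot '' (nearGroup Γ : Set (EucGroup n))) ×ˢ
        (rot '' (nearGroup Γ : Set (EucGroup n)))) := by
      rw [closure_prod_eq]
      exact ⟨hclos hX, hclos hY⟩
    refine closure_minimal ?_ hc hXY
    rintro ⟨_, _⟩ ⟨⟨γ, hγ, rfl⟩, ⟨γ', hγ', rfl⟩⟩
    exact congrArg rot (nearGroup_commute hΓ hγ hγ')
  refine ⟨Submodule.span ℝ (L : Set (Euc n)), c, rotTorus Γ, L, ⟨?_, ?_, ?_⟩, ?_, ?_, ?_, ?_,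
    ?_, ?_, ?_, ?_⟩
  · intro g hg h hh
    ext1 v
    exact congrArg (fun X : Euc n →L[ℝ] Euc n => X v) (hcomm _ hg _ hh)
  · change IsCompact (clm '' _)
    rw [image_rotTorus]
    exact isCompact_rotComp Γ
  · change IsConnected (clm '' _)
    rw [image_rotTorus]
    exact ⟨⟨_, rot_one_mem_rotComp Γ⟩, isPreconnected_rotComp Γ⟩
  · intro g hg v hv
    exact hfixU _ hg v (hVU hv)
  · intro γ hγ
    exact ⟨(mem_gammaStar_iff.1 hγ).2, Submodule.subset_span ⟨γ, hγ, rfl⟩⟩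
  · refine discreteTopology_of_finite ?_
    refine ((locFin_of_discrete hΓ (1 + ‖c‖ + ‖c‖)).image
      (fun γ : EucGroup n => γ c - c)).subset ?_
    rintro _ ⟨⟨γ, hγ, rfl⟩, h⟩
    refine ⟨γ, ⟨(mem_gammaStar_iff.1 hγ).1, ?_⟩, rfl⟩
    have h1 := norm_apply_zero_le γ c
    have h2 : ‖γ c‖ ≤ ‖γ c - c‖ + ‖c‖ := norm_le_norm_sub_add _ _
    linarith [show ‖γ c - c‖ ≤ 1 from h]
  · exact fun l hl => Submodule.subset_span hl
  · obtain ⟨C, hC⟩ := exists_bound_sub_mem (L : Set (Euc n))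
    refine ⟨Metric.closedBall 0 C, isCompact_closedBall _ _, fun v hv => ?_⟩
    obtain ⟨l, hl, h⟩ := hC v hv
    rw [AddSubgroup.closure_eq] at hl
    exact ⟨l, hl, mem_closedBall_zero_iff.2 h⟩
  · exact fun γ hγ => ⟨γ, hγ, rfl⟩
  · intro γ hγ γ' hγ' h
    have h1 : γ c = γ' c := sub_left_injective h
    have := hfree (γ'⁻¹ * γ) (Γ.mul_mem (Γ.inv_mem (mem_gammaStar_iff.1 hγ').1)
      (mem_gammaStar_iff.1 hγ).1) ⟨c, by rw [mul_apply, h1, inv_apply_self]⟩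
    rw [inv_mul_eq_one] at this
    exact this.symm
  · rintro _ ⟨γ, hγ, rfl⟩
    exact ⟨γ, hγ, rfl⟩

end FlatForms
namespace FlatForms
variable {n : ℕ}

open scoped Pointwise

/-! ### Fundamental domains -/

/-- The action of the Euclidean group on Euclidean space. -/
noncomputable instance eucAction (n : ℕ) : MulAction (EucGroup n) (Euc n) where
  smul γ x := γ x
  one_smul _ := rfl
  mul_smul _ _ _ := rfl

theorem subgroup_smul_def {Γ : Subgroup (EucGroup n)} (γ : Γ) (x : Euc n) :
    γ • x = (γ : EucGroup n) x := rfl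

theorem measurePreserving_euc (γ : EucGroup n) : MeasurePreserving (γ : Euc n → Euc n) := by
  have h : (γ : Euc n → Euc n) = fun x => lin γ x + γ 0 := by
    ext1 x; exact apply_eq γ x
  rw [h]
  exact (measurePreserving_add_right volume (γ 0)).comp
    (LinearIsometryEquiv.measurePreserving (lin γ))

theorem measurableEmbedding_euc (γ : EucGroup n) : MeasurableEmbedding (γ : Euc n → Euc n) :=
  γ.toHomeomorph.measurableEmbedding

instance measurableConstSMul_euc (Γ : Subgroup (EucGroup n)) : MeasurableConstSMul Γ (Euc n) where
  measurable_const_smul γ := (γ : EucGroup n).continuous.measurable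

instance smulInvariantMeasure_euc (Γ : Subgroup (EucGroup n)) :
    SMulInvariantMeasure Γ (Euc n) volume where
  measure_preimage_smul γ _ hs := (measurePreserving_euc (γ : EucGroup n)).measure_preimage
    hs.nullMeasurableSet

theorem LocFin.countable {Γ : Subgroup (EucGroup n)} (h : LocFin Γ) : Countable Γ := by
  have h1 : (Γ : Set (EucGroup n)) ⊆ ⋃ k : ℕ, {γ | γ ∈ Γ ∧ ‖γ 0‖ ≤ k} := by
    intro γ hγ
    obtain ⟨k, hk⟩ := exists_nat_ge ‖γ 0‖
    exact mem_iUnion.2 ⟨k, hγ, hk⟩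
  exact ((countable_iUnion fun k : ℕ => (h k).countable).mono h1).to_subtype

theorem LocFin.exists_mem_dirichletDomain {Γ : Subgroup (EucGroup n)} (h : LocFin Γ)
    (x : Euc n) : ∃ γ ∈ Γ, γ x ∈ dirichletDomain Γ := by
  have hfin : {γ | γ ∈ Γ ∧ ‖γ x‖ ≤ ‖x‖}.Finite := (h (‖x‖ + ‖x‖)).subset fun γ hγ =>
    ⟨hγ.1, (norm_apply_zero_le γ x).trans (by linarith [hγ.2])⟩
  obtain ⟨γ, hγ, hmin⟩ := hfin.exists_minimalFor (fun γ : EucGroup n => ‖γ x‖) _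
    ⟨1, Γ.one_mem, le_rfl⟩
  refine ⟨γ, hγ.1, fun γ' hγ' => ?_⟩
  rw [← mul_apply]
  by_cases hle : ‖(γ' * γ) x‖ ≤ ‖x‖
  · rcases le_total ‖γ x‖ ‖(γ' * γ) x‖ with h1 | h1
    · exact h1
    · exact hmin ⟨Γ.mul_mem hγ' hγ.1, hle⟩ h1
  · exact hγ.2.trans (not_le.1 hle).le

theorem measure_perpBisector {p : Euc n} (hp : p ≠ 0) :
    volume {x : Euc n | ‖x‖ = ‖x - p‖} = 0 := by
  have h : {x : Euc n | ‖x‖ = ‖x - p‖} = AffineSubspace.perpBisector (0 : Euc n) p := by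
    ext x
    rw [SetLike.mem_coe, AffineSubspace.mem_perpBisector_iff_dist_eq, dist_zero_right,
      dist_eq_norm]
    rfl
  rw [h]
  refine Measure.addHaar_affineSubspace _ _ fun htop => hp ?_
  have : (0 : Euc n) ∈ AffineSubspace.perpBisector (0 : Euc n) p := by rw [htop]; trivial
  rw [AffineSubspace.mem_perpBisector_iff_dist_eq, dist_self, eq_comm, dist_eq_zero] at this
  exact this.symm

/-- The domain meets its translate by `g` only in the bisector of `0` and `g 0`. This is a null set
because `g 0 ≠ 0` by freeness. -/
theorem isFundamentalDomain_dirichletDomain {Γ : Subgroup (EucGroup n)} (h : LocFin Γ)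
    (hfree : FixedPointFree Γ) : IsFundamentalDomain Γ (dirichletDomain Γ) volume := by
  have := h.countable
  refine IsFundamentalDomain.mk'' (isClosed_dirichletDomain Γ).measurableSet.nullMeasurableSet
    (Eventually.of_forall fun x => ?_) (fun g hg => ?_) fun g => ?_
  · obtain ⟨γ, hγ, hx⟩ := h.exists_mem_dirichletDomain x
    exact ⟨⟨γ, hγ⟩, hx⟩
  · have h0 : (g : EucGroup n) 0 ≠ 0 := fun h0 => hg (Subtype.ext (hfree g g.2 ⟨0, h0⟩))
    refine measure_mono_null ?_ (measure_perpBisector h0)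
    rintro x ⟨⟨y, hy, rfl⟩, hx⟩
    have e : (g : EucGroup n) y - (g : EucGroup n) 0 = lin (g : EucGroup n) y := by
      rw [apply_sub_apply, sub_zero]
    change ‖(g : EucGroup n) y‖ = ‖(g : EucGroup n) y - (g : EucGroup n) 0‖
    rw [e, LinearIsometryEquiv.norm_map]
    refine le_antisymm ?_ (hy g g.2)
    have := hx (g : EucGroup n)⁻¹ (Γ.inv_mem g.2)
    have e2 : (g : EucGroup n)⁻¹ ((fun x => g • x) y) = y := inv_apply_self _ _
    rw [e2] at this
    exact this
  · exact (measurePreserving_smul g volume).quasiMeasurePreserving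

/-- Representatives of the cosets `Γ' q`, `q ∈ Γ`. -/
structure IsTransversal (Γ Γ' : Subgroup (EucGroup n)) (Q : Set (EucGroup n)) : Prop where
  subset : ∀ q ∈ Q, q ∈ Γ
  exists_mul : ∀ γ ∈ Γ, ∃ q ∈ Q, ∃ γ' ∈ Γ', γ' * q = γ
  unique : ∀ q ∈ Q, ∀ q' ∈ Q, ∀ γ ∈ Γ', ∀ γ' ∈ Γ', γ * q = γ' * q' → q = q'

theorem exists_isTransversal {Γ Γ' : Subgroup (EucGroup n)} (hle : Γ' ≤ Γ) :
    ∃ Q, IsTransversal Γ Γ' Q := by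
  obtain ⟨S, hS, -⟩ := Γ'.exists_isComplement_right 1
  rw [Subgroup.isComplement_iff_existsUnique_mul_inv_mem] at hS
  refine ⟨{q | q ∈ S ∧ q ∈ Γ}, fun q hq => hq.2, fun γ hγ => ?_,
    fun q hq q' hq' γ hγ γ' hγ' h => ?_⟩
  · obtain ⟨t, ht, -⟩ := hS γ
    refine ⟨t, ⟨t.2, ?_⟩, γ * (t : EucGroup n)⁻¹, ht, by group⟩
    have h1 := Γ.mul_mem (Γ.inv_mem (hle ht)) hγ
    rwa [mul_inv_rev, inv_inv, mul_assoc, inv_mul_cancel, mul_one] at h1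
  · obtain ⟨t, -, hu⟩ := hS q
    have h1 := hu ⟨q, hq.1⟩ (by simp)
    have h2 := hu ⟨q', hq'.1⟩ (by
      change q * q'⁻¹ ∈ Γ'
      have : q * q'⁻¹ = γ⁻¹ * γ' := by
        rw [mul_inv_eq_iff_eq_mul, mul_assoc, ← h]; group
      rw [this]
      exact Γ'.mul_mem (Γ'.inv_mem hγ) hγ')
    exact congrArg Subtype.val (h1.trans h2.symm)

/-- The union of the translates of a fundamental domain by coset representatives is a fundamental
domain of the subgroup. -/
theorem isFundamentalDomain_iUnion {Γ Γ' : Subgroup (EucGroup n)} [Countable Γ] {D : Set (Euc n)}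
    (hD : IsFundamentalDomain Γ D volume) (hmeas : MeasurableSet D) (hle : Γ' ≤ Γ)
    {Q : Set (EucGroup n)} (hQ : IsTransversal Γ Γ' Q) :
    IsFundamentalDomain Γ' (⋃ q : Q, (fun x => (q : EucGroup n) x) '' D) volume := by
  have hQc : Countable Q := (((Set.countable_coe_iff (s := (Γ : Set (EucGroup n)))).1
    ‹Countable Γ›).mono hQ.subset).to_subtype
  have hdisj : ∀ g ∈ Γ, ∀ h ∈ Γ, g ≠ h →
      AEDisjoint volume ((fun x : Euc n => g x) '' D) ((fun x : Euc n => h x) '' D) := by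
    intro g hg h hh hne
    exact hD.aedisjoint (i := ⟨g, hg⟩) (j := ⟨h, hh⟩) fun e => hne (congrArg Subtype.val e)
  have hmeas' : ∀ g : EucGroup n, MeasurableSet ((fun x : Euc n => g x) '' D) := fun g =>
    (measurableEmbedding_euc g).measurableSet_image.2 hmeas
  refine ⟨(MeasurableSet.iUnion fun q : Q => hmeas' q).nullMeasurableSet, ?_, ?_⟩
  · refine hD.ae_covers.mono fun x hx => ?_
    obtain ⟨g, hg⟩ := hx
    obtain ⟨q, hq, γ', hγ', he⟩ := hQ.exists_mul (g : EucGroup n)⁻¹ (Γ.inv_mem g.2)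
    refine ⟨⟨γ'⁻¹, Γ'.inv_mem hγ'⟩, mem_iUnion.2 ⟨⟨q, hq⟩, (g : EucGroup n) x, hg, ?_⟩⟩
    change q ((g : EucGroup n) x) = γ'⁻¹ x
    have : q = γ'⁻¹ * (g : EucGroup n)⁻¹ := by rw [← he]; group
    rw [this, mul_apply, inv_apply_self]
  · intro a b hab
    change AEDisjoint volume (a • _) (b • _)
    rw [smul_set_iUnion, smul_set_iUnion]
    refine AEDisjoint.iUnion_left_iff.2 fun q => AEDisjoint.iUnion_right_iff.2 fun q' => ?_
    have e : ∀ (a : Γ') (q : EucGroup n), a • ((fun x : Euc n => q x) '' D) =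
        (fun x : Euc n => ((a : EucGroup n) * q) x) '' D := by
      intro a q
      rw [← image_smul, image_image]
      rfl
    rw [e, e]
    refine hdisj _ (Γ.mul_mem (hle a.2) (hQ.subset q q.2)) _
      (Γ.mul_mem (hle b.2) (hQ.subset q' q'.2)) fun h => hab ?_
    have hqq := hQ.unique q q.2 q' q'.2 a a.2 b b.2 h
    rw [hqq] at h
    exact Subtype.ext (mul_right_cancel h)

theorem measurableSet_dirichletDomain (Γ : Subgroup (EucGroup n)) :
    MeasurableSet (dirichletDomain Γ) := (isClosed_dirichletDomain Γ).measurableSet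

/-- Integration over the fundamental domain of a subgroup, in terms of that of the group. -/
theorem setIntegral_dirichletDomain_eq_sum {Γ Γ' : Subgroup (EucGroup n)} (hΓ : LocFin Γ)
    (hfree : FixedPointFree Γ) (hle : Γ' ≤ Γ) {Q : Set (EucGroup n)}
    (hQ : IsTransversal Γ Γ' Q) {H : Euc n → ℝ} (hc : Continuous H)
    (hinv : ∀ γ ∈ Γ', ∀ x, H (γ x) = H x) {r : ℝ} (F : Finset (EucGroup n))
    (hFQ : ∀ q ∈ F, q ∈ Q)
    (hr : ∀ q ∈ Q, ∀ x ∈ dirichletDomain Γ, H (q x) ≠ 0 → ‖x‖ ≤ r ∧ q ∈ F) :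
    ∫ x in dirichletDomain Γ', H x =
      ∑ q ∈ F, ∫ x in dirichletDomain Γ ∩ Metric.closedBall 0 r, H (q x) := by
  have := hΓ.countable
  have := (hΓ.mono hle).countable
  have hD := isFundamentalDomain_dirichletDomain hΓ hfree
  have hD' := isFundamentalDomain_dirichletDomain (hΓ.mono hle) (hfree.mono hle)
  have hm := measurableSet_dirichletDomain Γ
  have hD2 := isFundamentalDomain_iUnion hD hm hle hQ
  have hmeas' : ∀ g : EucGroup n, MeasurableSet ((fun x : Euc n => g x) '' dirichletDomain Γ) :=
    fun g => (measurableEmbedding_euc g).measurableSet_image.2 hm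
  have hzero : ∀ q ∈ Q, ∀ x, x ∈ dirichletDomain Γ \ (dirichletDomain Γ ∩ Metric.closedBall 0 r) →
      H (q x) = 0 := by
    intro q hq x hx
    by_contra hne
    exact hx.2 ⟨hx.1, mem_closedBall_zero_iff.2 (hr q hq x hx.1 hne).1⟩
  have hint : ∀ q ∈ Q, IntegrableOn H ((fun x : Euc n => q x) '' dirichletDomain Γ) := by
    intro q hq
    rw [(measurePreserving_euc q).integrableOn_image (measurableEmbedding_euc q)]
    have h1 : IntegrableOn (H ∘ q) (dirichletDomain Γ ∩ Metric.closedBall 0 r) :=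
      (hc.comp q.continuous).continuousOn.integrableOn_compact
        ((isCompact_closedBall (0 : Euc n) r).inter_left (isClosed_dirichletDomain Γ))
    exact h1.of_forall_sdiff_eq_zero hm (hzero q hq)
  -- Invariance of `H` under `Γ'` permits exchanging the Dirichlet domain of `Γ'` for the union of
  -- the translates by `Q`; by `hr` only the finitely many translates in `F` contribute.
  rw [hD'.setIntegral_eq hD2 (fun g x => hinv g g.2 x)]
  have hsub : (⋃ q : F, (fun x : Euc n => (q : EucGroup n) x) '' dirichletDomain Γ) ⊆
      ⋃ q : Q, (fun x : Euc n => (q : EucGroup n) x) '' dirichletDomain Γ := by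
    refine iUnion_subset fun q => ?_
    exact subset_iUnion (fun q : Q => (fun x : Euc n => (q : EucGroup n) x) '' dirichletDomain Γ)
      ⟨q, hFQ q q.2⟩
  rw [setIntegral_eq_of_subset_of_ae_sdiff_eq_zero hD2.nullMeasurableSet hsub,
    integral_iUnion_ae, tsum_fintype]
  · rw [← Finset.sum_coe_sort F
      (fun q => ∫ x in dirichletDomain Γ ∩ Metric.closedBall 0 r, H (q x))]
    refine Finset.sum_congr rfl fun q _ => ?_
    rw [(measurePreserving_euc (q : EucGroup n)).setIntegral_image_emb
      (measurableEmbedding_euc (q : EucGroup n))]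
    exact setIntegral_eq_of_subset_of_ae_sdiff_eq_zero hm.nullMeasurableSet inter_subset_left
      (Eventually.of_forall (hzero q (hFQ q q.2)))
  · exact fun q => (hmeas' q).nullMeasurableSet
  · intro a b hab
    refine hD.aedisjoint (i := ⟨a, hQ.subset _ (hFQ a a.2)⟩) (j := ⟨b, hQ.subset _ (hFQ b b.2)⟩)
      fun e => hab (Subtype.ext (congrArg (fun g : Γ => (g : EucGroup n)) e))
  · exact (integrableOn_finite_iUnion).2 fun q => hint q (hFQ q q.2)
  · refine Eventually.of_forall fun y hy => ?_
    obtain ⟨hy1, hy2⟩ := hy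
    obtain ⟨q, x, hx, rfl⟩ := mem_iUnion.1 hy1
    by_contra hne
    exact hy2 (mem_iUnion.2 ⟨⟨q, (hr q q.2 x hx hne).2⟩, x, hx, rfl⟩)

end FlatForms
namespace FlatForms
variable {n : ℕ}

/-! ### Polynomial growth and averaging -/

theorem exists_norm_ge_of_ne_one {Γ : Subgroup (EucGroup n)} (hΓ : LocFin Γ)
    (hfree : FixedPointFree Γ) : ∃ δ > 0, ∀ γ ∈ Γ, γ ≠ 1 → δ ≤ ‖γ 0‖ := by
  have hfin : ({γ | γ ∈ Γ ∧ ‖γ 0‖ ≤ 1} \ {1}).Finite := (hΓ 1).subset sdiff_subset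
  by_cases hne : ({γ | γ ∈ Γ ∧ ‖γ 0‖ ≤ 1} \ {1} : Set (EucGroup n)).Nonempty
  · obtain ⟨γ₀, h₀, hmin⟩ := hfin.exists_minimalFor (fun γ : EucGroup n => ‖γ 0‖) _ hne
    have hpos : 0 < ‖γ₀ 0‖ := norm_pos_iff.2 fun h => h₀.2 (hfree γ₀ h₀.1.1 ⟨0, h⟩)
    refine ⟨‖γ₀ 0‖, hpos, fun γ hγ h1 => ?_⟩
    rcases le_total ‖γ₀ 0‖ ‖γ 0‖ with h | h
    · exact h
    · exact hmin ⟨⟨hγ, h.trans h₀.1.2⟩, h1⟩ h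
  · refine ⟨1, one_pos, fun γ hγ h1 => ?_⟩
    by_contra h
    exact hne ⟨γ, ⟨hγ, (not_le.1 h).le⟩, h1⟩

/-- Volume packing: the balls of radius `δ / 2` are disjoint and lie in a ball of radius `R (1 + δ /
2)`, where `1 ≤ R` is used. -/
theorem card_le_of_separated {δ R : ℝ} (hδ : 0 < δ) (hR : 1 ≤ R) (s : Finset (Euc n))
    (hs : ∀ x ∈ s, ‖x‖ ≤ R) (hsep : ∀ x ∈ s, ∀ y ∈ s, x ≠ y → δ ≤ ‖x - y‖) :
    (s.card : ℝ) ≤ ((2 + δ) / δ) ^ n * R ^ n := by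
  have hR0 : 0 < R := by linarith
  have hdisj : (s : Set (Euc n)).PairwiseDisjoint fun x => Metric.ball x (δ / 2) := by
    intro x hx y hy hxy
    refine Metric.ball_disjoint_ball ?_
    rw [dist_eq_norm]
    linarith [hsep x hx y hy hxy]
  have hsub : (⋃ x ∈ s, Metric.ball x (δ / 2)) ⊆ Metric.ball (0 : Euc n) (R * (1 + δ / 2)) := by
    refine iUnion₂_subset fun x hx => ?_
    refine Metric.ball_subset_ball' ?_
    rw [dist_zero_right]
    nlinarith [hs x hx]
  have h1 : volume (⋃ x ∈ s, Metric.ball x (δ / 2)) =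
      ∑ x ∈ s, volume (Metric.ball x (δ / 2)) :=
    measure_biUnion_finset hdisj fun _ _ => Metric.isOpen_ball.measurableSet
  have h2 := measure_mono (μ := volume) hsub
  have hb : ∀ x : Euc n, ∀ r : ℝ, 0 < r → volume (Metric.ball x r) =
      ENNReal.ofReal (r ^ n) * volume (Metric.ball (0 : Euc n) 1) := by
    intro x r hr
    rw [Measure.addHaar_ball_of_pos _ _ hr, finrank_euclideanSpace_fin]
  rw [h1, Finset.sum_congr rfl fun x _ => hb x _ (half_pos hδ), Finset.sum_const,
    hb 0 (R * (1 + δ / 2)) (by positivity), nsmul_eq_mul, ← mul_assoc,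
    ENNReal.mul_le_mul_iff_left (Metric.measure_ball_pos _ _ one_pos).ne' measure_ball_lt_top.ne,
    ← ENNReal.ofReal_natCast, ← ENNReal.ofReal_mul (by positivity),
    ENNReal.ofReal_le_ofReal_iff (by positivity)] at h2
  have hpos : (0 : ℝ) < (δ / 2) ^ n := by positivity
  rw [← mul_pow, ← mul_le_mul_iff_left₀ hpos, ← mul_pow]
  refine h2.trans (le_of_eq ?_)
  congr 1
  field_simp

/-- A subgroup `Γ'` and a linear map `P` whose level sets are cocompact for `Γ'`. -/
structure CocompactAlong (Γ' : Subgroup (EucGroup n)) (P : Euc n →L[ℝ] Euc n) : Prop where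
  inv : ∀ γ ∈ Γ', ∀ x, P (γ x) = P x
  norm_le : ∀ x, ‖P x‖ ≤ ‖x‖
  bdd : ∃ C : ℝ, 0 ≤ C ∧ ∀ x, ∃ γ ∈ Γ', ‖γ x‖ ≤ ‖P x‖ + C

/-- This case is the covering `ℝⁿ → ℝⁿ/Γ`; it serves integration by parts. -/
theorem cocompactAlong_bot : CocompactAlong (⊥ : Subgroup (EucGroup n))
    (ContinuousLinearMap.id ℝ (Euc n)) where
  inv γ hγ x := by
    rw [Subgroup.mem_bot] at hγ
    rw [hγ]; rfl
  norm_le _ := le_rfl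
  bdd := ⟨0, le_rfl, fun x => ⟨1, Subgroup.one_mem _, by simp⟩⟩

section Growth

variable {Γ Γ' : Subgroup (EucGroup n)} {P : Euc n →L[ℝ] Euc n} {Q : Set (EucGroup n)}

/-- Each counted coset has a representative moving the origin by at most `R + C`, by cocompactness
along `P`. Distinct cosets give distinct points of the orbit of `0`, which is uniformly separated
because `Γ` is locally finite and free; packing gives degree `n`. -/
theorem exists_card_le (hΓ : LocFin Γ) (hfree : FixedPointFree Γ) (hle : Γ' ≤ Γ)
    (hP : CocompactAlong Γ' P) (hQ : IsTransversal Γ Γ' Q) :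
    ∃ K : ℝ, ∀ R : ℝ, 1 ≤ R → {q | q ∈ Q ∧ ‖P (q 0)‖ ≤ R}.Finite ∧
      ({q | q ∈ Q ∧ ‖P (q 0)‖ ≤ R}.ncard : ℝ) ≤ K * R ^ n := by
  obtain ⟨C, hC0, hC⟩ := hP.bdd
  obtain ⟨δ, hδ, hsep⟩ := exists_norm_ge_of_ne_one hΓ hfree
  choose f hf hfC using fun q : EucGroup n => hC (q 0)
  refine ⟨((2 + δ) / δ) ^ n * (1 + C) ^ n, fun R hR => ?_⟩
  set A : Set (EucGroup n) := {q | q ∈ Q ∧ ‖P (q 0)‖ ≤ R} with hA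
  have hinj0 : ∀ γ ∈ Γ, ∀ γ' ∈ Γ, γ 0 = γ' 0 → γ = γ' := by
    intro γ hγ γ' hγ' h
    have := hfree (γ'⁻¹ * γ) (Γ.mul_mem (Γ.inv_mem hγ') hγ)
      ⟨0, by rw [mul_apply, h, inv_apply_self]⟩
    rw [inv_mul_eq_one] at this
    exact this.symm
  have hmem : ∀ q ∈ A, f q * q ∈ Γ := fun q hq => Γ.mul_mem (hle (hf q)) (hQ.subset q hq.1)
  have hinj : InjOn (fun q : EucGroup n => (f q * q) 0) A := by
    intro q hq q' hq' h
    exact hQ.unique q hq.1 q' hq'.1 _ (hf q) _ (hf q')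
      (hinj0 _ (hmem q hq) _ (hmem q' hq') h)
  have hnorm : ∀ q ∈ A, ‖(f q * q) 0‖ ≤ R + C := fun q hq =>
    (hfC q).trans (by linarith [hq.2])
  have hfinA : A.Finite := by
    refine Set.Finite.of_finite_image (f := fun q : EucGroup n => (f q * q) 0) ?_ hinj
    refine ((hΓ (R + C)).image fun γ : EucGroup n => γ 0).subset ?_
    rintro _ ⟨q, hq, rfl⟩
    exact ⟨f q * q, ⟨hmem q hq, hnorm q hq⟩, rfl⟩
  refine ⟨hfinA, ?_⟩
  classical
  have hRC : 1 ≤ R * (1 + C) := by nlinarith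
  have := card_le_of_separated hδ hRC (hfinA.toFinset.image fun q : EucGroup n => (f q * q) 0)
    (fun x hx => by
      obtain ⟨q, hq, rfl⟩ := Finset.mem_image.1 hx
      refine (hnorm q (hfinA.mem_toFinset.1 hq)).trans ?_
      nlinarith)
    (fun x hx y hy hxy => by
      obtain ⟨q, hq, rfl⟩ := Finset.mem_image.1 hx
      obtain ⟨q', hq', rfl⟩ := Finset.mem_image.1 hy
      rw [← norm_inv_mul_zero]
      refine hsep _ (Γ.mul_mem (Γ.inv_mem (hmem q' (hfinA.mem_toFinset.1 hq')))
        (hmem q (hfinA.mem_toFinset.1 hq))) fun h1 => hxy ?_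
      rw [inv_mul_eq_one] at h1
      rw [h1])
  rw [Finset.card_image_of_injOn (by simpa using hinj), ← Set.ncard_eq_toFinset_card A hfinA]
    at this
  refine this.trans (le_of_eq ?_)
  rw [mul_pow]; ring

/-- A function of polynomial growth is doubling at arbitrarily large scales. -/
theorem exists_doubling {a : ℝ → ℝ} {K R₀ : ℝ} (h1 : ∀ R ≥ R₀, 1 ≤ a R)
    (h2 : ∀ R ≥ R₀, a R ≤ K * R ^ n) (ρ : ℝ) :
    ∃ R ≥ ρ, a (4 * R) ≤ 4 ^ (n + 1) * a R := by
  by_contra hcon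
  push Not at hcon
  set r := max (max ρ R₀) 1 with hr
  have hr1 : 1 ≤ r := le_max_right _ _
  have hrρ : ρ ≤ r := (le_max_left _ _).trans (le_max_left _ _)
  have hrR : R₀ ≤ r := (le_max_right _ _).trans (le_max_left _ _)
  have hge : ∀ j : ℕ, r ≤ 4 ^ j * r := fun j => by
    have : (1 : ℝ) ≤ 4 ^ j := one_le_pow₀ (by norm_num)
    nlinarith
  -- If doubling failed at every scale from `ρ` on, iteration along `4 ^ j * r` would give growth of
  -- degree `n + 1`, against the bound of degree `n`.
  have hlow : ∀ j : ℕ, (4 ^ (n + 1)) ^ j ≤ a (4 ^ j * r) := by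
    intro j
    induction j with
    | zero => simpa using h1 r hrR
    | succ j ih =>
      have := hcon (4 ^ j * r) (hrρ.trans (hge j))
      rw [pow_succ 4 j, pow_succ]
      have e : (4 : ℝ) ^ j * 4 * r = 4 * (4 ^ j * r) := by ring
      rw [e]
      have hp : (0 : ℝ) < 4 ^ (n + 1) := by positivity
      nlinarith
  have hup : ∀ j : ℕ, (4 : ℝ) ^ j ≤ K * r ^ n := by
    intro j
    have h3 := (hlow j).trans (h2 _ (hrR.trans (hge j)))
    have e1 : ((4 : ℝ) ^ (n + 1)) ^ j = 4 ^ j * (4 ^ j) ^ n := by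
      rw [← pow_mul, ← pow_mul, ← pow_add]; congr 1; ring
    rw [e1, mul_pow] at h3
    have hp : (0 : ℝ) < (4 ^ j) ^ n := by positivity
    refine le_of_mul_le_mul_right ?_ hp
    linarith
  obtain ⟨j, hj⟩ := pow_unbounded_of_one_lt (K * r ^ n) (by norm_num : (1 : ℝ) < 4)
  exact absurd (hup j) (not_le.2 hj)

/-- Unfolding: arbitrarily large scales `R` at which integrals over the fundamental domain of
`Γ'` of functions supported in `‖P x‖ ≤ 2 R` are controlled by sums over finite sets of cosets. -/
theorem exists_unfolding (hΓ : LocFin Γ) (hfree : FixedPointFree Γ) (hle : Γ' ≤ Γ)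
    (hP : CocompactAlong Γ' P) (ρ : ℝ) :
    ∃ R ≥ ρ, ∃ F F₀ : Finset (EucGroup n), F₀ ⊆ F ∧ F₀.Nonempty ∧
      (F.card : ℝ) ≤ 4 ^ (n + 1) * F₀.card ∧ (∀ q ∈ F, q ∈ Γ) ∧
      (∀ q ∈ F₀, ‖P (q 0)‖ ≤ R) ∧
      ∀ H : Euc n → ℝ, Continuous H → (∀ γ ∈ Γ', ∀ x, H (γ x) = H x) → ∀ r ≤ R,
        (∀ x, H x ≠ 0 → (∃ γ ∈ Γ, ‖γ x‖ ≤ r) ∧ ‖P x‖ ≤ 2 * R) →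
        ∫ x in dirichletDomain Γ', H x =
          ∑ q ∈ F, ∫ x in dirichletDomain Γ ∩ Metric.closedBall 0 r, H (q x) := by
  obtain ⟨Q, hQ⟩ := exists_isTransversal hle
  obtain ⟨K, hK⟩ := exists_card_le hΓ hfree hle hP hQ
  obtain ⟨q₀, hq₀, -⟩ := hQ.exists_mul 1 Γ.one_mem
  set R₀ := max 1 ‖P (q₀ 0)‖ with hR₀
  obtain ⟨R, hR, hdoub⟩ := exists_doubling (n := n) (R₀ := R₀) (K := K)
    (a := fun R => ({q | q ∈ Q ∧ ‖P (q 0)‖ ≤ R}.ncard : ℝ))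
    (fun R hR => by
      have hne : {q | q ∈ Q ∧ ‖P (q 0)‖ ≤ R}.Nonempty :=
        ⟨q₀, hq₀, (le_max_right _ _).trans hR⟩
      have := (Set.ncard_pos ((hK R ((le_max_left _ _).trans hR)).1)).2 hne
      exact_mod_cast this)
    (fun R hR => (hK R ((le_max_left _ _).trans hR)).2) (max ρ R₀)
  have hRρ : ρ ≤ R := (le_max_left _ _).trans hR
  have hRR : R₀ ≤ R := (le_max_right _ _).trans hR
  have hR1 : 1 ≤ R := (le_max_left _ _).trans hRR
  obtain ⟨hf0, -⟩ := hK R hR1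
  obtain ⟨hf, -⟩ := hK (4 * R) (by linarith)
  -- `F` counts cosets up to radius `4 R` and `F₀` up to `R`. If `q x` lies in the support, then `‖P
  -- (q x)‖ ≤ 2 R` and `‖x‖ ≤ r ≤ R`, so `‖P (q 0)‖ ≤ 3 R` and `q` is in `F`.
  refine ⟨R, hRρ, hf.toFinset, hf0.toFinset, ?_, ?_, ?_, ?_, ?_, ?_⟩
  · intro q hq
    rw [Set.Finite.mem_toFinset] at *
    exact ⟨hq.1, hq.2.trans (by linarith)⟩
  · exact ⟨q₀, hf0.mem_toFinset.2 ⟨hq₀, (le_max_right _ _).trans hRR⟩⟩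
  · rw [← Set.ncard_eq_toFinset_card _ hf, ← Set.ncard_eq_toFinset_card _ hf0]
    exact hdoub
  · exact fun q hq => hQ.subset q (hf.mem_toFinset.1 hq).1
  · exact fun q hq => (hf0.mem_toFinset.1 hq).2
  · intro H hc hinv r hr hsupp
    refine setIntegral_dirichletDomain_eq_sum hΓ hfree hle hQ hc hinv _
      (fun q hq => (hf.mem_toFinset.1 hq).1) fun q hq x hx hne => ?_
    obtain ⟨⟨γ, hγ, hγx⟩, h2⟩ := hsupp _ hne
    have hxr : ‖x‖ ≤ r := by
      refine (hx (γ * q) (Γ.mul_mem hγ (hQ.subset q hq))).trans hγx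
    refine ⟨hxr, hf.mem_toFinset.2 ⟨hq, ?_⟩⟩
    have e : P (q 0) = P (q x) - P (lin q x) := by
      rw [apply_eq q x, map_add]; abel
    have h3 := hP.norm_le (lin q x)
    rw [LinearIsometryEquiv.norm_map] at h3
    calc ‖P (q 0)‖ ≤ ‖P (q x)‖ + ‖P (lin q x)‖ := by rw [e]; exact norm_sub_le _ _
      _ ≤ 4 * R := by linarith

/-- Averages over large balls in a covering converge to integrals over the quotient. -/
theorem exists_averaging (hΓ : LocFin Γ) (hfree : FixedPointFree Γ) (hle : Γ' ≤ Γ)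
    (hP : CocompactAlong Γ' P) {ψ : Euc n → ℝ} {K : ℝ} (hK : 0 ≤ K)
    (hψc : Continuous ψ) (hψ0 : ∀ x, 0 ≤ ψ x) (hψK : ∀ x y, |ψ x - ψ y| ≤ K * ‖x - y‖)
    (hψ1 : ∀ x, ‖x‖ ≤ 1 → ψ x = 1) (hψ2 : ∀ x, ψ x ≠ 0 → ‖x‖ ≤ 2) (ρ : ℝ) :
    ∃ R ≥ ρ, 0 < R ∧ ∃ m > 0, ∀ r B : ℝ, 0 ≤ r → r ≤ R → 0 ≤ B →
      (∀ h : Euc n → ℝ, Continuous h → (∀ γ ∈ Γ, ∀ x, h (γ x) = h x) → (∀ x, |h x| ≤ B) →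
        (∀ x, h x ≠ 0 → ∃ γ ∈ Γ, ‖γ x‖ ≤ r) →
        |(∫ x in dirichletDomain Γ', ψ (R⁻¹ • P x) * h x) - m * ∫ x in dirichletDomain Γ, h x| ≤
          4 ^ (n + 1) * K * r * B * volume.real (Metric.closedBall (0 : Euc n) r) / R * m) ∧
      (∀ e : Euc n → ℝ, Continuous e → (∀ γ ∈ Γ', ∀ x, e (γ x) = e x) → (∀ x, |e x| ≤ B) →
        (∀ x, e x ≠ 0 → (∃ γ ∈ Γ, ‖γ x‖ ≤ r) ∧ ‖P x‖ ≤ 2 * R) →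
        |∫ x in dirichletDomain Γ', e x| ≤
          4 ^ (n + 1) * B * volume.real (Metric.closedBall (0 : Euc n) r) * m) := by
  obtain ⟨R, hR, F, F₀, hFF, hF₀, hcard, hFΓ, hF₀R, hunf⟩ :=
    exists_unfolding hΓ hfree hle hP (max ρ 1)
  have hR0 : 0 < R := lt_of_lt_of_le one_pos ((le_max_right _ _).trans hR)
  -- The multiplicity `m` is the total weight of the cut-off over the cosets. Since `ψ = 1` on `F₀`,
  -- it is at least the size of `F₀`, so by doubling the size of `F` is at most `4 ^ (n + 1) * m`.
  -- Errors summed over `F` are thereby measured relative to `m`.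
  set m : ℝ := ∑ q ∈ F, ψ (R⁻¹ • P (q 0)) with hm
  have hmF₀ : (F₀.card : ℝ) ≤ m := by
    have h1 : ∑ q ∈ F₀, ψ (R⁻¹ • P (q 0)) ≤ m :=
      Finset.sum_le_sum_of_subset_of_nonneg hFF fun _ _ _ => hψ0 _
    have h2 : ∑ q ∈ F₀, ψ (R⁻¹ • P (q 0)) = ∑ q ∈ F₀, (1 : ℝ) := by
      refine Finset.sum_congr rfl fun q hq => hψ1 _ ?_
      rw [norm_smul, norm_inv, Real.norm_of_nonneg hR0.le, inv_mul_le_one₀ hR0]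
      exact hF₀R q hq
    rw [h2] at h1
    simpa using h1
  have hm0 : 0 < m := lt_of_lt_of_le (by exact_mod_cast hF₀.card_pos) hmF₀
  have hcardm : (F.card : ℝ) ≤ 4 ^ (n + 1) * m :=
    hcard.trans (mul_le_mul_of_nonneg_left hmF₀ (by positivity))
  refine ⟨R, (le_max_left _ _).trans hR, hR0, m, hm0, fun r B hr hrR hB => ⟨?_, ?_⟩⟩
  · intro h hc hinv hbd hsupp
    set S : Set (Euc n) := dirichletDomain Γ ∩ Metric.closedBall 0 r with hS
    have hScpt : IsCompact S :=
      (isCompact_closedBall (0 : Euc n) r).inter_left (isClosed_dirichletDomain Γ)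
    have hmon : volume.real S ≤ volume.real (Metric.closedBall (0 : Euc n) r) :=
      measureReal_mono inter_subset_right measure_closedBall_lt_top.ne
    have hψP : Continuous fun x => ψ (R⁻¹ • P x) :=
      hψc.comp ((continuous_const_smul R⁻¹).comp P.continuous)
    have e1 : ∫ x in dirichletDomain Γ', ψ (R⁻¹ • P x) * h x =
        ∑ q ∈ F, ∫ x in S, ψ (R⁻¹ • P (q x)) * h x := by
      rw [hunf (fun x => ψ (R⁻¹ • P x) * h x) (hψP.mul hc) (fun γ hγ x => by
        rw [hP.inv γ hγ, hinv γ (hle hγ)]) r hrR (fun x hx => ?_)]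
      · refine Finset.sum_congr rfl fun q hq => ?_
        simp only [hinv q (hFΓ q hq)]
        rfl
      · refine ⟨hsupp x (right_ne_zero_of_mul hx), ?_⟩
        have := hψ2 _ (left_ne_zero_of_mul hx)
        rw [norm_smul, norm_inv, Real.norm_of_nonneg hR0.le, inv_mul_le_iff₀ hR0] at this
        linarith
    have e2 : ∫ x in dirichletDomain Γ, h x = ∫ x in S, h x := by
      refine setIntegral_eq_of_subset_of_ae_sdiff_eq_zero
        (measurableSet_dirichletDomain Γ).nullMeasurableSet inter_subset_left
        (Eventually.of_forall fun x hx => ?_)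
      by_contra hne
      obtain ⟨γ, hγ, hγx⟩ := hsupp x hne
      exact hx.2 ⟨hx.1, mem_closedBall_zero_iff.2 ((hx.1 γ hγ).trans hγx)⟩
    rw [e1, e2, hm, Finset.sum_mul, ← Finset.sum_sub_distrib]
    -- On one translate of `S` the cut-off varies by at most `K r / R`, so it may be replaced by its
    -- value at `q 0`.
    have hterm : ∀ q ∈ F, ‖(∫ x in S, ψ (R⁻¹ • P (q x)) * h x) -
        ψ (R⁻¹ • P (q 0)) * ∫ x in S, h x‖ ≤
        K * r * B * volume.real (Metric.closedBall (0 : Euc n) r) / R := by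
      intro q hq
      rw [← integral_const_mul, ← integral_sub]
      · have hb : ∀ x ∈ S, ‖ψ (R⁻¹ • P (q x)) * h x - ψ (R⁻¹ • P (q 0)) * h x‖ ≤
            K * r * B / R := by
          intro x hx
          rw [← sub_mul, norm_mul, Real.norm_eq_abs, Real.norm_eq_abs]
          have h1 := hψK (R⁻¹ • P (q x)) (R⁻¹ • P (q 0))
          have h2 : ‖R⁻¹ • P (q x) - R⁻¹ • P (q 0)‖ ≤ r / R := by
            rw [← smul_sub, ← map_sub, apply_sub_apply, norm_smul, norm_inv,
              Real.norm_of_nonneg hR0.le, sub_zero, div_eq_inv_mul]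
            refine mul_le_mul_of_nonneg_left ?_ (inv_nonneg.2 hR0.le)
            refine (hP.norm_le _).trans ?_
            rw [LinearIsometryEquiv.norm_map]
            exact mem_closedBall_zero_iff.1 hx.2
          calc _ ≤ K * (r / R) * B :=
                mul_le_mul (h1.trans (mul_le_mul_of_nonneg_left h2 hK)) (hbd x) (abs_nonneg _)
                  (by positivity)
            _ = K * r * B / R := by ring
        refine (norm_setIntegral_le_of_norm_le_const hScpt.measure_lt_top hb).trans ?_
        calc _ ≤ K * r * B / R * volume.real (Metric.closedBall (0 : Euc n) r) :=
              mul_le_mul_of_nonneg_left hmon (by positivity)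
          _ = _ := by ring
      · exact ((hψP.comp q.continuous).mul hc).continuousOn.integrableOn_compact hScpt
      · exact (continuous_const.mul hc).continuousOn.integrableOn_compact hScpt
    rw [← Real.norm_eq_abs]
    refine (norm_sum_le _ _).trans ((Finset.sum_le_sum hterm).trans ?_)
    rw [Finset.sum_const, nsmul_eq_mul]
    have hpos : 0 ≤ K * r * B * volume.real (Metric.closedBall (0 : Euc n) r) / R := by positivity
    calc _ ≤ 4 ^ (n + 1) * m * (K * r * B * volume.real (Metric.closedBall (0 : Euc n) r) / R) :=
          mul_le_mul_of_nonneg_right hcardm hpos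
      _ = _ := by ring
  · intro e hc hinv hbd hsupp
    rw [hunf e hc hinv r hrR hsupp, ← Real.norm_eq_abs]
    have hScpt : IsCompact (dirichletDomain Γ ∩ Metric.closedBall (0 : Euc n) r) :=
      (isCompact_closedBall (0 : Euc n) r).inter_left (isClosed_dirichletDomain Γ)
    have hterm : ∀ q ∈ F, ‖∫ x in dirichletDomain Γ ∩ Metric.closedBall 0 r, e (q x)‖ ≤
        B * volume.real (Metric.closedBall (0 : Euc n) r) := by
      intro q _
      refine (norm_setIntegral_le_of_norm_le_const hScpt.measure_lt_top
        (fun x _ => hbd (q x))).trans ?_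
      exact mul_le_mul_of_nonneg_left
        (measureReal_mono inter_subset_right measure_closedBall_lt_top.ne) hB
    refine (norm_sum_le _ _).trans ((Finset.sum_le_sum hterm).trans ?_)
    rw [Finset.sum_const, nsmul_eq_mul]
    calc _ ≤ 4 ^ (n + 1) * m * (B * volume.real (Metric.closedBall (0 : Euc n) r)) :=
          mul_le_mul_of_nonneg_right hcardm (by positivity)
      _ = _ := by ring

end Growth

end FlatForms
namespace FlatForms
variable {n k l : ℕ}

/-! ### The inner product of covectors -/

/-- Tuples of standard basis vectors. -/
noncomputable def stdTup (I : Fin k → Fin n) : Fin k → Euc n := fun j => stdVec (I j)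

theorem norm_stdVec (i : Fin n) : ‖stdVec i‖ = 1 := by simp [stdVec]

theorem stdTup_cons (a : Fin n) (J : Fin k → Fin n) :
    stdTup (Fin.cons a J : Fin (k + 1) → Fin n) = Matrix.vecCons (stdVec a) (stdTup J) := by
  funext j
  refine Fin.cases rfl (fun j => ?_) j
  simp [stdTup]

theorem stdTup_insertNth (i : Fin (k + 1)) (a : Fin n) (J : Fin k → Fin n) :
    stdTup (i.insertNth (α := fun _ => Fin n) a J) =
      i.insertNth (α := fun _ => Euc n) (stdVec a) (stdTup J) := by
  rw [Fin.eq_insertNth_iff]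
  refine ⟨by simp [stdTup], ?_⟩
  funext j
  simp [stdTup, Fin.removeNth]

theorem sum_tuple_cons (f : (Fin (k + 1) → Fin n) → ℝ) :
    ∑ I, f I = ∑ a : Fin n, ∑ J : Fin k → Fin n, f (Fin.cons a J) := by
  rw [← (Fin.consEquiv fun _ : Fin (k + 1) => Fin n).sum_comp, Fintype.sum_prod_type]
  rfl

theorem sum_tuple_insertNth (i : Fin (k + 1)) (f : (Fin (k + 1) → Fin n) → ℝ) :
    ∑ I, f I = ∑ a : Fin n, ∑ J : Fin k → Fin n,
      f (i.insertNth (α := fun _ => Fin n) a J) := by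
  rw [← (Fin.insertNthEquiv (fun _ : Fin (k + 1) => Fin n) i).sum_comp, Fintype.sum_prod_type]
  rfl

/-- Induction over the slots: the tail is handled by the induction hypothesis after currying, and
the first slot by the basis independence of the trace, `trace_rot`. -/
theorem sum_rot_eq (γ : EucGroup n) : ∀ {k : ℕ} (α β : Covec n k),
    ∑ I : Fin k → Fin n, α (fun j => rot γ (stdVec (I j))) * β (fun j => rot γ (stdVec (I j))) =
      ∑ I : Fin k → Fin n, α (stdTup I) * β (stdTup I)
  | 0, α, β => by
    refine Finset.sum_congr rfl fun I _ => ?_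
    congr 2 <;> exact Subsingleton.elim _ _
  | k + 1, α, β => by
    rw [sum_tuple_cons, sum_tuple_cons]
    have e1 : ∀ (a : Fin n) (J : Fin k → Fin n),
        (fun j => rot γ (stdVec ((Fin.cons a J : Fin (k + 1) → Fin n) j))) =
          Matrix.vecCons (rot γ (stdVec a)) (fun j => rot γ (stdVec (J j))) := by
      intro a J
      funext j
      refine Fin.cases rfl (fun j => ?_) j
      simp
    simp only [e1, stdTup_cons, ← ContinuousAlternatingMap.curryLeft_apply_apply]
    have e2 : ∀ a : Fin n, ∑ J : Fin k → Fin n,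
        (α.curryLeft (rot γ (stdVec a))) (fun j => rot γ (stdVec (J j))) *
          (β.curryLeft (rot γ (stdVec a))) (fun j => rot γ (stdVec (J j))) =
        ∑ J : Fin k → Fin n, (α.curryLeft (rot γ (stdVec a))) (stdTup J) *
          (β.curryLeft (rot γ (stdVec a))) (stdTup J) := fun a => sum_rot_eq γ _ _
    simp only [e2]
    rw [Finset.sum_comm, Finset.sum_comm (s := Finset.univ (α := Fin n))]
    refine Finset.sum_congr rfl fun J _ => ?_
    have key := trace_rot γ
      { toFun := fun a => (α.curryLeft a (stdTup J)) •
          ((ContinuousAlternatingMap.apply ℝ (Euc n) ℝ (stdTup J)) ∘L β.curryLeft)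
        map_add' := by intro a b; ext; simp [add_mul]
        map_smul' := by intro c a; ext; simp [mul_assoc] }
    exact key

theorem covecInner_rot (γ : EucGroup n) (α β : Covec n k) :
    covecInner (α.compContinuousLinearMap (rot γ)) (β.compContinuousLinearMap (rot γ)) =
      covecInner α β := by
  unfold covecInner
  congr 1
  exact sum_rot_eq γ α β

theorem continuous_covecInner {X : Type*} [TopologicalSpace X] {α β : X → Covec n k}
    (hα : Continuous α) (hβ : Continuous β) : Continuous fun x => covecInner (α x) (β x) := by
  have h1 : ∀ v : Fin k → Euc n, Continuous fun x => α x v := fun v =>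
    (ContinuousAlternatingMap.apply ℝ (Euc n) ℝ v).continuous.comp hα
  have h2 : ∀ v : Fin k → Euc n, Continuous fun x => β x v := fun v =>
    (ContinuousAlternatingMap.apply ℝ (Euc n) ℝ v).continuous.comp hβ
  unfold covecInner
  exact continuous_const.mul (continuous_finsetSum _ fun I _ => (h1 _).mul (h2 _))

theorem abs_apply_stdTup_le (α : Covec n k) (I : Fin k → Fin n) : |α (stdTup I)| ≤ ‖α‖ := by
  have := α.le_opNorm (stdTup I)
  simpa [stdTup, norm_stdVec] using this

/-- A bound for the inner product of covectors. -/
noncomputable def covecConst (n k : ℕ) : ℝ := (k.factorial : ℝ)⁻¹ * (n : ℝ) ^ k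

theorem covecConst_nonneg (n k : ℕ) : 0 ≤ covecConst n k := by unfold covecConst; positivity

theorem abs_covecInner_le (α β : Covec n k) :
    |covecInner α β| ≤ covecConst n k * (‖α‖ * ‖β‖) := by
  unfold covecInner covecConst
  rw [abs_mul, abs_of_nonneg (by positivity : (0 : ℝ) ≤ (k.factorial : ℝ)⁻¹), mul_assoc]
  refine mul_le_mul_of_nonneg_left ?_ (by positivity)
  refine (Finset.abs_sum_le_sum_abs _ _).trans ?_
  refine (Finset.sum_le_sum (g := fun _ => ‖α‖ * ‖β‖) fun I _ => ?_).trans (by simp)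
  rw [abs_mul]
  exact mul_le_mul (abs_apply_stdTup_le α I) (abs_apply_stdTup_le β I) (abs_nonneg _)
    (norm_nonneg _)

theorem covecInner_add_left (α β θ : Covec n k) :
    covecInner (α + β) θ = covecInner α θ + covecInner β θ := by
  simp [covecInner, add_mul, Finset.sum_add_distrib, mul_add]

theorem covecInner_smul_left (c : ℝ) (α θ : Covec n k) :
    covecInner (c • α) θ = c * covecInner α θ := by
  simp only [covecInner, ContinuousAlternatingMap.smul_apply, smul_eq_mul, mul_assoc,
    ← Finset.mul_sum]
  ring

theorem covecInner_comm (α β : Covec n k) : covecInner α β = covecInner β α := by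
  simp only [covecInner, mul_comm]

theorem covecInner_self_nonneg (α : Covec n k) : 0 ≤ covecInner α α :=
  mul_nonneg (by positivity) (Finset.sum_nonneg fun _ _ => mul_self_nonneg _)

theorem covecInner_zero_left (β : Covec n k) : covecInner 0 β = 0 := by simp [covecInner]

theorem eq_zero_of_covecInner_self {α : Covec n k} (h : covecInner α α = 0) : α = 0 := by
  have h1 : ∑ I : Fin k → Fin n, α (stdTup I) * α (stdTup I) = 0 := by
    refine (mul_eq_zero.1 h).resolve_left ?_
    positivity
  rw [Finset.sum_eq_zero_iff_of_nonneg fun _ _ => mul_self_nonneg _] at h1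
  have h2 : α.toMultilinearMap = 0 := by
    refine Module.Basis.ext_multilinear (fun _ => (EuclideanSpace.basisFun (Fin n) ℝ).toBasis)
      fun I => ?_
    have := mul_self_eq_zero.1 (h1 I (Finset.mem_univ _))
    have e : (fun j => (EuclideanSpace.basisFun (Fin n) ℝ).toBasis (I j)) = stdTup I := by
      funext j
      simp [stdTup, stdVec]
    rw [e]
    exact this
  ext v
  exact congrArg (fun f : MultilinearMap ℝ (fun _ : Fin k => Euc n) ℝ => f v) h2

/-! ### Cut-off functions -/

theorem exists_bump (n : ℕ) : ∃ φ : Euc n → ℝ, ∃ K : NNReal, ContDiff ℝ (⊤ : ℕ∞) φ ∧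
    LipschitzWith K φ ∧ (∀ x, 0 ≤ φ x) ∧ (∀ x, φ x ≤ 1) ∧ (∀ x, ‖x‖ ≤ 1 → φ x = 1) ∧
    ∀ x, φ x ≠ 0 → ‖x‖ ≤ 2 := by
  let f : ContDiffBump (0 : Euc n) := ⟨1, 2, one_pos, one_lt_two⟩
  obtain ⟨K, hK⟩ := ContDiff.lipschitzWith_of_hasCompactSupport f.hasCompactSupport
    (f.contDiff (n := 1)) one_ne_zero
  refine ⟨f, K, f.contDiff, hK, fun _ => f.nonneg, fun _ => f.le_one, fun x hx => ?_,
    fun x hx => ?_⟩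
  · exact f.one_of_mem_closedBall (mem_closedBall_zero_iff.2 hx)
  · have : x ∈ Function.support f := hx
    rw [f.support_eq] at this
    exact (mem_ball_zero_iff.1 this).le

section Cutoff

variable {φ : Euc n → ℝ} {K : NNReal} {P : Euc n →L[ℝ] Euc n} {R : ℝ}

theorem contDiff_cutoff (hφ : ContDiff ℝ (⊤ : ℕ∞) φ) (P : Euc n →L[ℝ] Euc n) (R : ℝ) :
    ContDiff ℝ (⊤ : ℕ∞) fun x => φ (R⁻¹ • P x) :=
  hφ.comp (P.contDiff.const_smul R⁻¹)

theorem norm_fderiv_cutoff_le (hφ : LipschitzWith K φ) (hP : ∀ x, ‖P x‖ ≤ ‖x‖) (hR : 0 < R)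
    (x : Euc n) : ‖fderiv ℝ (fun x => φ (R⁻¹ • P x)) x‖ ≤ K / R := by
  have hl : LipschitzWith (K * R.toNNReal⁻¹) fun x => φ (R⁻¹ • P x) := by
    refine LipschitzWith.of_dist_le_mul fun x y => ?_
    refine (hφ.dist_le_mul _ _).trans ?_
    rw [NNReal.coe_mul, mul_assoc]
    refine mul_le_mul_of_nonneg_left ?_ K.coe_nonneg
    rw [dist_eq_norm, ← smul_sub, ← map_sub, norm_smul, norm_inv, Real.norm_of_nonneg hR.le,
      NNReal.coe_inv, Real.coe_toNNReal _ hR.le, dist_eq_norm]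
    exact mul_le_mul_of_nonneg_left (hP _) (inv_nonneg.2 hR.le)
  refine (norm_fderiv_le_of_lipschitz ℝ hl).trans (le_of_eq ?_)
  rw [NNReal.coe_mul, NNReal.coe_inv, Real.coe_toNNReal _ hR.le, div_eq_mul_inv]

theorem cutoff_ne_zero (hφ : ∀ x, φ x ≠ 0 → ‖x‖ ≤ 2) (hR : 0 < R) {x : Euc n}
    (hx : φ (R⁻¹ • P x) ≠ 0) : ‖P x‖ ≤ 2 * R := by
  have := hφ _ hx
  rw [norm_smul, norm_inv, Real.norm_of_nonneg hR.le, inv_mul_le_iff₀ hR] at this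
  linarith

theorem fderiv_cutoff_ne_zero (hφ : ∀ x, φ x ≠ 0 → ‖x‖ ≤ 2) (hR : 0 < R) {x : Euc n}
    (hx : fderiv ℝ (fun x => φ (R⁻¹ • P x)) x ≠ 0) : ‖P x‖ ≤ 2 * R := by
  by_contra hcon
  refine hx ?_
  have hev : (fun x => φ (R⁻¹ • P x)) =ᶠ[𝓝 x] fun _ => 0 := by
    filter_upwards [(isOpen_lt continuous_const P.continuous.norm).mem_nhds (not_le.1 hcon)]
      with y hy
    by_contra hne
    exact absurd (cutoff_ne_zero hφ hR hne) (not_le.2 hy)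
  rw [hev.fderiv_eq, fderiv_fun_const]
  rfl

end Cutoff

/-! ### Compactly supported forms -/

section Forms

variable {Γ : Subgroup (EucGroup n)}

theorem CcForm.contDiff (ω : CcForm Γ k) : ContDiff ℝ (⊤ : ℕ∞) ω.lift := ω.lift_mem.1

theorem CcForm.lift_rot (ω : CcForm Γ k) {γ : EucGroup n} (hγ : γ ∈ Γ) (x : Euc n) :
    (ω.lift (γ x)).compContinuousLinearMap (rot γ) = ω.lift x := ω.lift_mem.2.1 γ hγ x

theorem CcForm.ext_lift {ω η : CcForm Γ k} (h : ω.lift = η.lift) : ω = η := Subtype.ext h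

theorem CcForm.norm_lift_le (ω : CcForm Γ k) {γ : EucGroup n} (hγ : γ ∈ Γ) (x : Euc n) :
    ‖ω.lift x‖ ≤ ‖ω.lift (γ x)‖ := by
  rw [← ω.lift_rot hγ]
  refine (ContinuousAlternatingMap.norm_compContinuousLinearMap_le _ _).trans ?_
  refine mul_le_of_le_one_right (norm_nonneg _) ?_
  exact pow_le_one₀ (norm_nonneg _) (norm_rot_le γ)

theorem CcForm.exists_bound (ω : CcForm Γ k) : ∃ r B : ℝ, 0 ≤ r ∧ 0 ≤ B ∧
    (∀ x, ω.lift x ≠ 0 → ∃ γ ∈ Γ, ‖γ x‖ ≤ r) ∧ ∀ x, ‖ω.lift x‖ ≤ B := by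
  obtain ⟨hω, -, K, hK, hωK⟩ := ω.lift_mem
  obtain ⟨r, hr⟩ := hK.isBounded.exists_norm_le
  obtain ⟨B, hB⟩ := hK.exists_bound_of_continuousOn hω.continuous.continuousOn
  refine ⟨max r 0, max B 0, le_max_right _ _, le_max_right _ _, fun x hx => ?_, fun x => ?_⟩
  · obtain ⟨γ, hγ, h⟩ := hωK x hx
    exact ⟨γ, hγ, (hr _ h).trans (le_max_left _ _)⟩
  · by_cases hx : ω.lift x = 0
    · rw [hx, norm_zero]; exact le_max_right _ _
    · obtain ⟨γ, hγ, h⟩ := hωK x hx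
      exact (ω.norm_lift_le hγ x).trans ((hB _ h).trans (le_max_left _ _))

theorem CcForm.covecInner_invariant (ω η : CcForm Γ k) {γ : EucGroup n} (hγ : γ ∈ Γ)
    (x : Euc n) : covecInner (ω.lift (γ x)) (η.lift (γ x)) =
      covecInner (ω.lift x) (η.lift x) := by
  rw [← ω.lift_rot hγ x, ← η.lift_rot hγ x, covecInner_rot]

theorem CcForm.covecInner_bound {ω η : CcForm Γ k} {B B' : ℝ} (hB : ∀ x, ‖ω.lift x‖ ≤ B)
    (hB' : ∀ x, ‖η.lift x‖ ≤ B') (x : Euc n) :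
    |covecInner (ω.lift x) (η.lift x)| ≤ covecConst n k * (B * B') :=
  (abs_covecInner_le _ _).trans (mul_le_mul_of_nonneg_left
    (mul_le_mul (hB x) (hB' x) (norm_nonneg _) ((norm_nonneg _).trans (hB x)))
    (covecConst_nonneg n k))

end Forms

end FlatForms
namespace FlatForms
variable {n k l : ℕ} {Γ Γ' : Subgroup (EucGroup n)}

/-! ### Integration by parts -/

/-- By antisymmetry of `β` the `k + 1` terms of the alternation contribute equally, the signs
cancelling; the factor `k + 1` turns `1 / (k + 1)!` into `1 / k!`. -/
theorem covecInner_alternatizeUncurryFin (D : Euc n →L[ℝ] Covec n k) (β : Covec n (k + 1)) :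
    covecInner (ContinuousAlternatingMap.alternatizeUncurryFin D) β =
      (k.factorial : ℝ)⁻¹ * ∑ a : Fin n, ∑ J : Fin k → Fin n,
        D (stdVec a) (stdTup J) * β (Matrix.vecCons (stdVec a) (stdTup J)) := by
  have h1 : ∀ I : Fin (k + 1) → Fin n,
      ContinuousAlternatingMap.alternatizeUncurryFin D (stdTup I) * β (stdTup I) =
        ∑ i : Fin (k + 1), (-1) ^ (i : ℕ) * D (stdVec (I i)) (i.removeNth (stdTup I)) *
          β (stdTup I) := by
    intro I
    rw [ContinuousAlternatingMap.alternatizeUncurryFin_apply, Finset.sum_mul]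
    refine Finset.sum_congr rfl fun i _ => ?_
    rw [zsmul_eq_mul]
    push_cast
    rfl
  have h2 : ∑ I : Fin (k + 1) → Fin n,
      ContinuousAlternatingMap.alternatizeUncurryFin D (stdTup I) * β (stdTup I) =
        (k + 1) * ∑ a : Fin n, ∑ J : Fin k → Fin n,
        D (stdVec a) (stdTup J) * β (Matrix.vecCons (stdVec a) (stdTup J)) := by
    rw [Finset.sum_congr rfl fun I _ => h1 I, Finset.sum_comm]
    have h3 : ∀ i : Fin (k + 1), ∑ I : Fin (k + 1) → Fin n,
        (-1) ^ (i : ℕ) * D (stdVec (I i)) (i.removeNth (stdTup I)) * β (stdTup I) =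
        ∑ a : Fin n, ∑ J : Fin k → Fin n,
        D (stdVec a) (stdTup J) * β (Matrix.vecCons (stdVec a) (stdTup J)) := by
      intro i
      rw [sum_tuple_insertNth i]
      refine Finset.sum_congr rfl fun a _ => Finset.sum_congr rfl fun J _ => ?_
      rw [stdTup_insertNth, Fin.removeNth_insertNth, Fin.insertNth_apply_same,
        ← ContinuousAlternatingMap.neg_one_pow_smul_map_insertNth β i, zsmul_eq_mul]
      push_cast
      ring
    rw [Finset.sum_congr rfl fun i _ => h3 i]
    simp
  change ((k + 1).factorial : ℝ)⁻¹ * ∑ I : Fin (k + 1) → Fin n,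
      ContinuousAlternatingMap.alternatizeUncurryFin D (stdTup I) * β (stdTup I) = _
  rw [h2, Nat.factorial_succ]
  push_cast
  have h4 : (k : ℝ) + 1 ≠ 0 := by positivity
  have h5 : (k.factorial : ℝ) ≠ 0 := by positivity
  field_simp

/-- The vector field whose divergence is `⟨dω, η⟩ - ⟨ω, δη⟩`. -/
noncomputable def pairingField (ω : Euc n → Covec n k) (η : Euc n → Covec n (k + 1)) (i : Fin n)
    (x : Euc n) : ℝ :=
  (k.factorial : ℝ)⁻¹ * ∑ J : Fin k → Fin n,
    ω x (stdTup J) * η x (Matrix.vecCons (stdVec i) (stdTup J))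

theorem hasFDerivAt_apply {ω : Euc n → Covec n k} {x : Euc n} (h : DifferentiableAt ℝ ω x)
    (v : Fin k → Euc n) : HasFDerivAt (fun y => ω y v)
      ((ContinuousAlternatingMap.apply ℝ (Euc n) ℝ v) ∘L fderiv ℝ ω x) x :=
  (ContinuousAlternatingMap.apply ℝ (Euc n) ℝ v).hasFDerivAt.comp x h.hasFDerivAt

theorem fderiv_pairingField {ω : Euc n → Covec n k} {η : Euc n → Covec n (k + 1)} {x : Euc n}
    (hω : DifferentiableAt ℝ ω x) (hη : DifferentiableAt ℝ η x) (i : Fin n) (v : Euc n) :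
    fderiv ℝ (pairingField ω η i) x v = (k.factorial : ℝ)⁻¹ * ∑ J : Fin k → Fin n,
      (fderiv ℝ ω x v (stdTup J) * η x (Matrix.vecCons (stdVec i) (stdTup J)) +
        ω x (stdTup J) * fderiv ℝ η x v (Matrix.vecCons (stdVec i) (stdTup J))) := by
  have h := (HasFDerivAt.fun_sum (u := Finset.univ) fun (J : Fin k → Fin n) _ =>
    (hasFDerivAt_apply hω (stdTup J)).mul
      (hasFDerivAt_apply hη (Matrix.vecCons (stdVec i) (stdTup J)))).const_mul
        ((k.factorial : ℝ)⁻¹)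
  have h' : HasFDerivAt (pairingField ω η i) _ x := h
  rw [h'.fderiv]
  simp only [smul_apply, sum_apply, add_apply, smul_eq_mul]
  congr 1
  refine Finset.sum_congr rfl fun J _ => ?_
  simp only [ContinuousLinearMap.comp_apply, ContinuousAlternatingMap.apply_apply]
  ring

theorem contDiff_pairingField {ω : Euc n → Covec n k} {η : Euc n → Covec n (k + 1)}
    (hω : ContDiff ℝ (⊤ : ℕ∞) ω) (hη : ContDiff ℝ (⊤ : ℕ∞) η) (i : Fin n) :
    ContDiff ℝ (⊤ : ℕ∞) (pairingField ω η i) := by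
  refine contDiff_const.mul (ContDiff.sum fun J _ => ContDiff.mul ?_ ?_)
  · exact (ContinuousAlternatingMap.apply ℝ (Euc n) ℝ (stdTup J)).contDiff.comp hω
  · exact (ContinuousAlternatingMap.apply ℝ (Euc n) ℝ
      (Matrix.vecCons (stdVec i) (stdTup J))).contDiff.comp hη

theorem sub_eq_divergence {ω : Euc n → Covec n k} {η : Euc n → Covec n (k + 1)} {x : Euc n}
    (hω : DifferentiableAt ℝ ω x) (hη : DifferentiableAt ℝ η x) :
    covecInner (extDeriv ω x) (η x) - covecInner (ω x) (codiff η x) =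
      ∑ i : Fin n, fderiv ℝ (pairingField ω η i) x (stdVec i) := by
  have h1 : covecInner (ω x) (codiff η x) = -((k.factorial : ℝ)⁻¹ * ∑ i : Fin n,
      ∑ J : Fin k → Fin n, ω x (stdTup J) *
        fderiv ℝ η x (stdVec i) (Matrix.vecCons (stdVec i) (stdTup J))) := by
    rw [Finset.sum_comm, ← mul_neg, ← Finset.sum_neg_distrib]
    unfold covecInner
    congr 1
    refine Finset.sum_congr rfl fun J _ => ?_
    rw [← Finset.mul_sum, ← mul_neg]
    congr 1
    simp only [codiff, ContinuousAlternatingMap.neg_apply, ContinuousAlternatingMap.sum_apply,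
      ContinuousAlternatingMap.curryLeft_apply_apply]
    rfl
  rw [h1, extDeriv, covecInner_alternatizeUncurryFin, sub_neg_eq_add, ← mul_add,
    ← Finset.sum_add_distrib]
  simp only [fderiv_pairingField hω hη, ← Finset.mul_sum, Finset.sum_add_distrib]

theorem abs_pairingField_le {ω : Euc n → Covec n k} {η : Euc n → Covec n (k + 1)} {B B' : ℝ}
    (hω : ∀ x, ‖ω x‖ ≤ B) (hη : ∀ x, ‖η x‖ ≤ B') (i : Fin n) (x : Euc n) :
    |pairingField ω η i x| ≤ covecConst n k * (B * B') := by
  have hB : 0 ≤ B := (norm_nonneg _).trans (hω x)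
  unfold pairingField covecConst
  rw [abs_mul, abs_of_nonneg (by positivity : (0 : ℝ) ≤ (k.factorial : ℝ)⁻¹), mul_assoc]
  refine mul_le_mul_of_nonneg_left ?_ (by positivity)
  refine (Finset.abs_sum_le_sum_abs _ _).trans ?_
  refine (Finset.sum_le_sum (g := fun _ => B * B') fun J _ => ?_).trans (by simp)
  rw [abs_mul]
  refine mul_le_mul ((abs_apply_stdTup_le _ J).trans (hω x)) ?_ (abs_nonneg _) hB
  rw [← stdTup_cons]
  exact (abs_apply_stdTup_le _ _).trans (hη x)

theorem pairingField_ne_zero {ω : Euc n → Covec n k} {η : Euc n → Covec n (k + 1)} {i : Fin n}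
    {x : Euc n} (h : pairingField ω η i x ≠ 0) : ω x ≠ 0 := by
  intro h0
  refine h ?_
  simp [pairingField, h0]

theorem eq_zero_of_forall_le_div {I c : ℝ} (h : ∀ ρ : ℝ, ∃ R ≥ ρ, 0 < R ∧ |I| ≤ c / R) :
    I = 0 := by
  by_contra hne
  have hI : 0 < |I| := abs_pos.2 hne
  obtain ⟨R, hR, hR0, hle⟩ := h (c / |I| + 1)
  rw [le_div_iff₀ hR0] at hle
  have : c / |I| < R := by linarith
  rw [div_lt_iff₀ hI] at this
  linarith

theorem dirichletDomain_bot : dirichletDomain (⊥ : Subgroup (EucGroup n)) = univ := by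
  refine eq_univ_of_forall fun x γ hγ => ?_
  rw [Subgroup.mem_bot.1 hγ]
  exact le_rfl

/-- The difference of the two integrands is an invariant function `h`, the divergence of
`pairingField`. Averaging over `ℝⁿ` with a cut-off `χ` at scale `R` replaces `m ∫ h` over the
fundamental domain by `∫ χ h`. Integration by parts on `ℝⁿ` turns this into an integral against the
derivative of `χ`, which is `O(m / R)`. Dividing by `m` and letting `R` grow gives zero. -/
theorem l2Inner_dForm (hΓ : LocFin Γ) (hfree : FixedPointFree Γ) (ω : CcForm Γ k)
    (η : CcForm Γ (k + 1)) : l2Inner (dForm Γ k ω) η = l2Inner ω (deltaForm Γ k η) := by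
  obtain ⟨φ, K, hφ, hφK, hφ0, hφ1, hφone, hφsupp⟩ := exists_bump n
  obtain ⟨r, B, hr, hB, hsupp, hbd⟩ := ω.exists_bound
  obtain ⟨r', B', hr', hB', hsupp', hbd'⟩ := η.exists_bound
  obtain ⟨r₁, B₁, hr₁, hB₁, hsupp₁, hbd₁⟩ := (dForm Γ k ω).exists_bound
  obtain ⟨r₂, B₂, hr₂, hB₂, hsupp₂, hbd₂⟩ := (deltaForm Γ k η).exists_bound
  set h : Euc n → ℝ := fun x => covecInner ((dForm Γ k ω).lift x) (η.lift x) -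
    covecInner (ω.lift x) ((deltaForm Γ k η).lift x) with hh
  have hI : l2Inner (dForm Γ k ω) η - l2Inner ω (deltaForm Γ k η) =
      ∫ x in dirichletDomain Γ, h x := by
    rw [hh, integral_sub (integrable_covecInner _ _) (integrable_covecInner _ _)]
    rfl
  rw [← sub_eq_zero, hI]
  have hc : Continuous h :=
    (continuous_covecInner (dForm Γ k ω).contDiff.continuous η.contDiff.continuous).sub
      (continuous_covecInner ω.contDiff.continuous (deltaForm Γ k η).contDiff.continuous)
  have hinv : ∀ γ ∈ Γ, ∀ x, h (γ x) = h x := fun γ hγ x => by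
    simp only [hh, CcForm.covecInner_invariant _ _ hγ]
  set B₃ : ℝ := covecConst n (k + 1) * (B₁ * B') + covecConst n k * (B * B₂) with hB₃
  have hBn := covecConst_nonneg n (k + 1)
  have hBn' := covecConst_nonneg n k
  have hB₃0 : 0 ≤ B₃ := by positivity
  have hhbd : ∀ x, |h x| ≤ B₃ := fun x => (abs_sub _ _).trans
    (add_le_add (CcForm.covecInner_bound hbd₁ hbd' x) (CcForm.covecInner_bound hbd hbd₂ x))
  set s := max r r' with hs
  have hhsupp : ∀ x, h x ≠ 0 → ∃ γ ∈ Γ, ‖γ x‖ ≤ s := by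
    intro x hx
    by_cases hω : ω.lift x = 0
    · by_cases hη : η.lift x = 0
      · exfalso
        refine hx ?_
        simp only [hh, hω, hη, covecInner_zero_left, covecInner_comm _ (0 : Covec n (k + 1)),
          sub_zero]
      · obtain ⟨γ, hγ, hle⟩ := hsupp' x hη
        exact ⟨γ, hγ, hle.trans (le_max_right _ _)⟩
    · obtain ⟨γ, hγ, hle⟩ := hsupp x hω
      exact ⟨γ, hγ, hle.trans (le_max_left _ _)⟩
  have hs0 : 0 ≤ s := hr.trans (le_max_left _ _)
  set X := pairingField ω.lift η.lift with hX
  have hXbd := abs_pairingField_le hbd hbd'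
  set B₄ : ℝ := n * (K * (covecConst n k * (B * B'))) with hB₄
  have hB₄0 : 0 ≤ B₄ := by positivity
  set vol := volume.real (Metric.closedBall (0 : Euc n) s) with hvol
  refine eq_zero_of_forall_le_div
    (c := 4 ^ (n + 1) * K * s * B₃ * vol + 4 ^ (n + 1) * B₄ * vol) fun ρ => ?_
  obtain ⟨R, hR, hR0, m, hm, hav⟩ := exists_averaging hΓ hfree bot_le cocompactAlong_bot
    K.coe_nonneg hφ.continuous hφ0 (fun x y => by
      simpa [dist_eq_norm] using hφK.dist_le_mul x y) hφone hφsupp (max ρ s)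
  have hsR : s ≤ R := (le_max_right _ _).trans hR
  refine ⟨R, (le_max_left _ _).trans hR, hR0, ?_⟩
  have hP : ∀ x : Euc n, ‖ContinuousLinearMap.id ℝ (Euc n) x‖ ≤ ‖x‖ := fun _ => le_rfl
  set χ : Euc n → ℝ := fun x => φ (R⁻¹ • ContinuousLinearMap.id ℝ (Euc n) x) with hχ
  have hχc : ContDiff ℝ (⊤ : ℕ∞) χ := contDiff_cutoff hφ _ R
  have h1 := (hav s B₃ hs0 hsR hB₃0).1 h hc hinv hhbd hhsupp
  set e : Euc n → ℝ := fun x => ∑ i : Fin n, fderiv ℝ χ x (stdVec i) * X i x with he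
  have hcX : ∀ i, ContDiff ℝ (⊤ : ℕ∞) (X i) := contDiff_pairingField ω.contDiff η.contDiff
  have hcd : ∀ i : Fin n, Continuous fun x => fderiv ℝ χ x (stdVec i) := fun i =>
    (hχc.continuous_fderiv (by simp)).clm_apply continuous_const
  have hcdX : ∀ i : Fin n, Continuous fun x => fderiv ℝ (X i) x (stdVec i) := fun i =>
    ((hcX i).continuous_fderiv (by simp)).clm_apply continuous_const
  have hχcs : HasCompactSupport χ := by
    refine HasCompactSupport.intro (isCompact_closedBall (0 : Euc n) (2 * R)) fun x hx => ?_
    by_contra hne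
    exact hx (mem_closedBall_zero_iff.2
      (cutoff_ne_zero (P := ContinuousLinearMap.id ℝ (Euc n)) hφsupp hR0 hne))
  have hdcs : ∀ i : Fin n, HasCompactSupport fun x => fderiv ℝ χ x (stdVec i) := fun i =>
    (hχcs.fderiv ℝ).comp_left (g := fun T : Euc n →L[ℝ] ℝ => T (stdVec i)) rfl
  -- Boundary terms are absent since `χ` has compact support in `ℝⁿ`.
  have hparts : ∫ x, χ x * h x = -∫ x, e x := by
    have e1 : ∀ x, χ x * h x = ∑ i : Fin n, χ x * fderiv ℝ (X i) x (stdVec i) := fun x => by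
      rw [← Finset.mul_sum]
      congr 1
      exact sub_eq_divergence (ω.contDiff.differentiable (by simp) x)
        (η.contDiff.differentiable (by simp) x)
    have i1 : ∀ i : Fin n, Integrable fun x => χ x * fderiv ℝ (X i) x (stdVec i) := fun i =>
      (hχc.continuous.mul (hcdX i)).integrable_of_hasCompactSupport hχcs.mul_right
    have i2 : ∀ i : Fin n, Integrable fun x => fderiv ℝ χ x (stdVec i) * X i x := fun i =>
      ((hcd i).mul (hcX i).continuous).integrable_of_hasCompactSupport (hdcs i).mul_right
    have i3 : ∀ i : Fin n, Integrable fun x => χ x * X i x := fun i =>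
      (hχc.continuous.mul (hcX i).continuous).integrable_of_hasCompactSupport hχcs.mul_right
    simp only [e1, he]
    rw [integral_finsetSum _ fun i _ => i1 i, integral_finsetSum _ fun i _ => i2 i,
      ← Finset.sum_neg_distrib]
    refine Finset.sum_congr rfl fun i _ => ?_
    exact integral_mul_fderiv_eq_neg_fderiv_mul_of_integrable (i2 i) (i1 i) (i3 i)
      (fun x _ => hχc.differentiable (by simp) x) (fun x _ => (hcX i).differentiable (by simp) x)
  have h2 := (hav s (B₄ / R) hs0 hsR (by positivity)).2 e
    (continuous_finsetSum _ fun i _ => (hcd i).mul (hcX i).continuous)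
    (fun γ hγ x => by rw [Subgroup.mem_bot.1 hγ]; rfl)
    (fun x => by
      refine (Finset.abs_sum_le_sum_abs _ _).trans ?_
      refine (Finset.sum_le_sum (g := fun _ => K / R * (covecConst n k * (B * B')))
        fun i _ => ?_).trans (le_of_eq ?_)
      · rw [abs_mul]
        refine mul_le_mul ?_ (hXbd i x) (abs_nonneg _) (by positivity)
        have := (fderiv ℝ χ x).le_opNorm (stdVec i)
        rw [norm_stdVec, mul_one] at this
        exact this.trans (norm_fderiv_cutoff_le hφK hP hR0 x)
      · simp only [Finset.sum_const, Finset.card_univ, Fintype.card_fin, nsmul_eq_mul]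
        rw [hB₄]; ring)
    (fun x hx => by
      obtain ⟨i, -, hi⟩ := Finset.exists_ne_zero_of_sum_ne_zero hx
      obtain ⟨γ, hγ, hle⟩ := hsupp x (pairingField_ne_zero (right_ne_zero_of_mul hi))
      refine ⟨⟨γ, hγ, hle.trans (le_max_left _ _)⟩, ?_⟩
      refine fderiv_cutoff_ne_zero hφsupp hR0 (x := x) fun h0 => left_ne_zero_of_mul hi ?_
      change (fderiv ℝ χ x) (stdVec i) = 0
      rw [hχ, h0]; rfl)
  rw [dirichletDomain_bot, Measure.restrict_univ] at h1 h2
  change |(∫ x, χ x * h x) - _| ≤ _ at h1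
  rw [hparts] at h1
  set I := ∫ x in dirichletDomain Γ, h x with hIdef
  have h3 : |m * I| ≤ (4 ^ (n + 1) * K * s * B₃ * vol + 4 ^ (n + 1) * B₄ * vol) / R * m := by
    have h4 : |m * I| ≤ |(-∫ x, e x) - m * I| + |∫ x, e x| := by
      have h5 := abs_sub (-∫ x, e x) ((-∫ x, e x) - m * I)
      rw [sub_sub_cancel, abs_neg] at h5
      linarith
    refine h4.trans ((add_le_add h1 h2).trans (le_of_eq ?_))
    rw [← hvol]
    ring
  rw [abs_mul, abs_of_pos hm, mul_comm] at h3
  exact le_of_mul_le_mul_right h3 hm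

/-- The Dirichlet energy of a form. -/
theorem l2Inner_hodgeLaplacian_zero (hΓ : LocFin Γ) (hfree : FixedPointFree Γ)
    (ω η : CcForm Γ 0) :
    l2Inner (hodgeLaplacian Γ 0 ω) η = l2Inner (dForm Γ 0 ω) (dForm Γ 0 η) := by
  have h : ∀ a b : CcForm Γ 0, l2Inner a b = l2Inner b a := fun a b => real_inner_comm b a
  have h' : ∀ a b : CcForm Γ 1, l2Inner a b = l2Inner b a := fun a b => real_inner_comm b a
  change l2Inner (deltaForm Γ 0 (dForm Γ 0 ω)) η = _
  rw [h, ← l2Inner_dForm hΓ hfree, h']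

theorem l2Inner_hodgeLaplacian_succ (hΓ : LocFin Γ) (hfree : FixedPointFree Γ)
    (ω η : CcForm Γ (k + 1)) :
    l2Inner (hodgeLaplacian Γ (k + 1) ω) η =
      l2Inner (deltaForm Γ k ω) (deltaForm Γ k η) +
        l2Inner (dForm Γ (k + 1) ω) (dForm Γ (k + 1) η) := by
  have hadd : ∀ a b c : CcForm Γ (k + 1), l2Inner (a + b) c = l2Inner a c + l2Inner b c :=
    fun a b c => inner_add_left a b c
  change l2Inner (dForm Γ k (deltaForm Γ k ω) + deltaForm Γ (k + 1) (dForm Γ (k + 1) ω)) η = _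
  have h : ∀ a b : CcForm Γ (k + 1), l2Inner a b = l2Inner b a := fun a b => real_inner_comm b a
  have h' : ∀ a b : CcForm Γ (k + 2), l2Inner a b = l2Inner b a := fun a b => real_inner_comm b a
  rw [hadd, l2Inner_dForm hΓ hfree]
  congr 1
  rw [h, ← l2Inner_dForm hΓ hfree, h']

theorem l2Inner_self_nonneg (ω : CcForm Γ k) : 0 ≤ l2Inner ω ω :=
  integral_nonneg fun _ => covecInner_self_nonneg _

theorem l2Inner_hodgeLaplacian_comm (hΓ : LocFin Γ) (hfree : FixedPointFree Γ) :
    ∀ {k : ℕ} (ω η : CcForm Γ k),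
      l2Inner (hodgeLaplacian Γ k ω) η = l2Inner ω (hodgeLaplacian Γ k η)
  | 0, ω, η => by
    have h : ∀ {k} (a b : CcForm Γ k), l2Inner a b = l2Inner b a := fun a b => real_inner_comm b a
    rw [h ω, l2Inner_hodgeLaplacian_zero hΓ hfree, l2Inner_hodgeLaplacian_zero hΓ hfree, h]
  | k + 1, ω, η => by
    have h : ∀ {k} (a b : CcForm Γ k), l2Inner a b = l2Inner b a := fun a b => real_inner_comm b a
    rw [h ω, l2Inner_hodgeLaplacian_succ hΓ hfree, l2Inner_hodgeLaplacian_succ hΓ hfree, h,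
      h (dForm Γ (k + 1) ω)]

theorem l2Inner_hodgeLaplacian_self_nonneg (hΓ : LocFin Γ) (hfree : FixedPointFree Γ) :
    ∀ {k : ℕ} (ω : CcForm Γ k), 0 ≤ l2Inner (hodgeLaplacian Γ k ω) ω
  | 0, ω => by
    rw [l2Inner_hodgeLaplacian_zero hΓ hfree]
    exact l2Inner_self_nonneg _
  | k + 1, ω => by
    rw [l2Inner_hodgeLaplacian_succ hΓ hfree]
    exact add_nonneg (l2Inner_self_nonneg _) (l2Inner_self_nonneg _)

end FlatForms

/-! ### The Friedrichs extension through its energy space -/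

namespace FlatForms

universe u

/-- Packaged as an existence statement so that a second inner product on a space that already
carries one causes no conflict of instances. -/
theorem exists_form_completion {C : Type u} [AddCommGroup C] [Module ℝ C]
    (q : PreInnerProductSpace.Core ℝ C) :
    ∃ (K : Type u) (_ : NormedAddCommGroup K) (_ : InnerProductSpace ℝ K) (_ : CompleteSpace K)
      (ι : C →ₗ[ℝ] K), DenseRange ι ∧ ∀ x y, inner ℝ (ι x) (ι y) = q.inner x y := by
  let : SeminormedAddCommGroup C :=
    @InnerProductSpace.Core.toSeminormedAddCommGroup ℝ C _ _ _ q
  let : InnerProductSpace ℝ C := InnerProductSpace.ofCore q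
  exact ⟨UniformSpace.Completion C, inferInstance, inferInstance, inferInstance,
    (UniformSpace.Completion.toComplₗᵢ (𝕜 := ℝ) (E := C)).toLinearMap,
    UniformSpace.Completion.denseRange_coe,
    fun x y => UniformSpace.Completion.inner_coe x y⟩

variable {C : Type u} [SeminormedAddCommGroup C] [InnerProductSpace ℝ C]

/-- The inner product `⟨A x, y⟩ - μ ⟨x, y⟩` of a symmetric operator bounded below by `μ`. -/
noncomputable abbrev shiftedCore (A : C →ₗ[ℝ] C) (hA : ∀ x y, inner ℝ (A x) y = inner ℝ x (A y))
    (μ : ℝ) (hμ : ∀ x, μ * ‖x‖ ^ 2 ≤ inner ℝ (A x) x) : PreInnerProductSpace.Core ℝ C where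
  inner x y := inner ℝ (A x) y - μ * inner ℝ x y
  conj_inner_symm x y := by
    simp only [conj_trivial]
    rw [hA, real_inner_comm, real_inner_comm x y]
  re_inner_nonneg x := by
    have := hμ x
    simp only [real_inner_self_eq_norm_sq, RCLike.re_to_real]
    linarith
  add_left x y z := by
    simp only [map_add, inner_add_left]
    ring
  smul_left x y r := by
    simp only [map_smul, real_inner_smul_left, conj_trivial]
    ring

/-- `K` is the completion for the shifted form. As `μ < lam`, the energy norm dominates a positive
multiple of the `L²` norm, so the identity of `C` extends to `J`. Injectivity of `J` is not needed
below. -/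
theorem exists_energy_space (A : C →ₗ[ℝ] C) (hA : ∀ x y, inner ℝ (A x) y = inner ℝ x (A y))
    {lam μ : ℝ} (hμ : μ < lam) (hlam : ∀ x, lam * ‖x‖ ^ 2 ≤ inner ℝ (A x) x) :
    ∃ (K : Type u) (_ : NormedAddCommGroup K) (_ : InnerProductSpace ℝ K) (_ : CompleteSpace K)
      (ι : C →ₗ[ℝ] K) (J : K →L[ℝ] UniformSpace.Completion C), DenseRange ι ∧
      (∀ x y, inner ℝ (ι x) (ι y) = inner ℝ (A x) y - μ * inner ℝ x y) ∧
      (∀ x, J (ι x) = x) ∧ ∀ z, (lam - μ) * ‖J z‖ ^ 2 ≤ ‖z‖ ^ 2 := by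
  have hμ' : ∀ x, μ * ‖x‖ ^ 2 ≤ inner ℝ (A x) x := fun x =>
    (mul_le_mul_of_nonneg_right hμ.le (sq_nonneg _)).trans (hlam x)
  obtain ⟨K, _, _, _, ι, hι, hq⟩ := exists_form_completion (shiftedCore A hA μ hμ')
  have hq' : ∀ x y, inner ℝ (ι x) (ι y) = inner ℝ (A x) y - μ * inner ℝ x y := hq
  have hκ : 0 < lam - μ := sub_pos.2 hμ
  have hb : ∀ x, (lam - μ) * ‖x‖ ^ 2 ≤ ‖ι x‖ ^ 2 := fun x => by
    rw [← real_inner_self_eq_norm_sq (ι x), hq', real_inner_self_eq_norm_sq]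
    linarith [hlam x]
  have hex : ∃ D, ∀ x, ‖(UniformSpace.Completion.toComplₗᵢ (𝕜 := ℝ) (E := C)).toLinearMap x‖ ≤
      D * ‖ι x‖ := by
    refine ⟨(Real.sqrt (lam - μ))⁻¹, fun x => ?_⟩
    rw [inv_mul_eq_div, le_div_iff₀ (Real.sqrt_pos.2 hκ)]
    have h1 : ‖(UniformSpace.Completion.toComplₗᵢ (𝕜 := ℝ) (E := C)).toLinearMap x‖ = ‖x‖ :=
      UniformSpace.Completion.norm_coe x
    rw [h1]
    refine abs_le_of_sq_le_sq' ?_ (norm_nonneg _) |>.2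
    rw [mul_pow, Real.sq_sqrt hκ.le, mul_comm]
    exact hb x
  let J := LinearMap.extendOfNorm
    (UniformSpace.Completion.toComplₗᵢ (𝕜 := ℝ) (E := C)).toLinearMap ι
  have hJ : ∀ x, J (ι x) = x := LinearMap.extendOfNorm_eq hι hex
  refine ⟨K, inferInstance, inferInstance, inferInstance, ι, J, hι, hq', hJ, fun z => ?_⟩
  refine hι.induction_on z (isClosed_le (by fun_prop) (by fun_prop)) fun x => ?_
  rw [hJ, UniformSpace.Completion.norm_coe]
  exact hb x

/-- The form domain is the range of `J`: for an `L²`-convergent sequence, being Cauchy for `A` and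
being Cauchy in the energy norm agree, since the two quadratic forms differ by a multiple of the
`L²` norm. -/
theorem tendsto_form_iff {A : C →ₗ[ℝ] C} {μ : ℝ} {K : Type u} [NormedAddCommGroup K]
    [InnerProductSpace ℝ K] [CompleteSpace K] {ι : C →ₗ[ℝ] K}
    {J : K →L[ℝ] UniformSpace.Completion C} (hι : DenseRange ι)
    (hq : ∀ x y, inner ℝ (ι x) (ι y) = inner ℝ (A x) y - μ * inner ℝ x y)
    (hJ : ∀ x, J (ι x) = x) (u : UniformSpace.Completion C) :
    (∃ w : ℕ → C, Tendsto (fun j => (w j : UniformSpace.Completion C)) atTop (𝓝 u) ∧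
      Tendsto (fun ij : ℕ × ℕ => inner ℝ (A (w ij.1 - w ij.2)) (w ij.1 - w ij.2))
        atTop (𝓝 0)) ↔ ∃ z, u = J z := by
  have hen : ∀ x, inner ℝ (A x) x = ‖ι x‖ ^ 2 + μ * ‖x‖ ^ 2 := fun x => by
    rw [← real_inner_self_eq_norm_sq (ι x), hq, real_inner_self_eq_norm_sq]
    ring
  have hcau : ∀ {E : Type u} [NormedAddCommGroup E] {s : ℕ → E} {z : E},
      Tendsto s atTop (𝓝 z) →
        Tendsto (fun ij : ℕ × ℕ => ‖s ij.1 - s ij.2‖ ^ 2) atTop (𝓝 0) := by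
    intro E _ s z hs
    rw [← prod_atTop_atTop_eq]
    have h := ((hs.comp tendsto_fst).sub (hs.comp tendsto_snd) :
      Tendsto _ (atTop ×ˢ atTop) _).norm.pow 2
    simpa using h
  have hnorm : ∀ (w : ℕ → C) (ij : ℕ × ℕ),
      ‖(w ij.1 : UniformSpace.Completion C) - w ij.2‖ = ‖w ij.1 - w ij.2‖ := fun w ij => by
    rw [← UniformSpace.Completion.coe_sub, UniformSpace.Completion.norm_coe]
  constructor
  · rintro ⟨w, hw, hw'⟩
    have h1 := hw'.sub ((hcau hw).const_mul μ)
    have h2 : Tendsto (fun ij : ℕ × ℕ => dist (ι (w ij.1)) (ι (w ij.2))) atTop (𝓝 0) := by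
      have h3 := h1.sqrt
      simp only [mul_zero, sub_zero, Real.sqrt_zero] at h3
      refine h3.congr fun ij => ?_
      rw [hnorm, hen, add_sub_cancel_right, Real.sqrt_sq (norm_nonneg _), dist_eq_norm, map_sub]
    have h3 : CauchySeq fun j => ι (w j) := by
      rw [cauchySeq_iff_tendsto_dist_atTop_0]
      exact h2
    obtain ⟨z, hz⟩ := cauchySeq_tendsto_of_complete h3
    refine ⟨z, tendsto_nhds_unique hw ?_⟩
    simpa only [hJ, Function.comp_def] using (J.continuous.tendsto z).comp hz
  · rintro ⟨z, rfl⟩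
    obtain ⟨s, hs, hsz⟩ := mem_closure_iff_seq_limit.1 (hι z)
    choose w hw using hs
    have hz : Tendsto (fun j => ι (w j)) atTop (𝓝 z) := by simpa only [hw] using hsz
    have hw' : Tendsto (fun j => (w j : UniformSpace.Completion C)) atTop (𝓝 (J z)) := by
      simpa only [hJ, Function.comp_def] using (J.continuous.tendsto z).comp hz
    refine ⟨w, hw', ?_⟩
    have h1 := (hcau hz).add ((hcau hw').const_mul μ)
    simp only [mul_zero, add_zero] at h1
    refine h1.congr fun ij => ?_
    rw [hnorm, hen, map_sub]

/-- The resolvent is `J J*`. For `u = J z` the weak equation reads `⟨z, ι φ⟩ = ⟨f, φ⟩` for all `φ`,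
which by density means `z = J* f`. The last bound is Cauchy–Schwarz for `‖w‖² = ⟨J* w, ι w⟩`; it
turns low energy of `w` into a large value of `⟨R w, w⟩`. -/
theorem exists_resolvent (A : C →ₗ[ℝ] C) (hA : ∀ x y, inner ℝ (A x) y = inner ℝ x (A y))
    {lam μ : ℝ} (hμ : μ < lam) (hlam : ∀ x, lam * ‖x‖ ^ 2 ≤ inner ℝ (A x) x) :
    ∃ R : UniformSpace.Completion C →L[ℝ] UniformSpace.Completion C,
      (∀ u f, (u, f + μ • u) ∈ friedrichsGraph A ↔ u = R f) ∧
      (∀ f g, inner ℝ (R f) g = inner ℝ f (R g)) ∧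
      (∀ f, 0 ≤ inner ℝ (R f) f) ∧ (∀ f, (lam - μ) * inner ℝ (R f) f ≤ ‖f‖ ^ 2) ∧
      ∀ w : C, ‖w‖ ^ 4 ≤ inner ℝ (R w) (w : UniformSpace.Completion C) *
        (inner ℝ (A w) w - μ * ‖w‖ ^ 2) := by
  obtain ⟨K, _, _, _, ι, J, hι, hq, hJ, hb⟩ := exists_energy_space A hA hμ hlam
  have hκ : 0 < lam - μ := sub_pos.2 hμ
  set J' := ContinuousLinearMap.adjoint J with hJ'
  have hadj : ∀ z f, inner ℝ (J' f) z = inner ℝ f (J z) :=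
    fun z f => ContinuousLinearMap.adjoint_inner_left J z f
  have hRf : ∀ f, inner ℝ (J (J' f)) f = ‖J' f‖ ^ 2 := fun f => by
    rw [real_inner_comm, ← hadj, real_inner_self_eq_norm_sq]
  have hweak : ∀ z φ, inner ℝ z (ι φ) =
      inner ℝ (J z) (A φ : UniformSpace.Completion C) -
        μ * inner ℝ (J z) (φ : UniformSpace.Completion C) := by
    intro z φ
    refine hι.induction_on z (isClosed_eq (by fun_prop) (by fun_prop)) fun x => ?_
    rw [hq, hJ, UniformSpace.Completion.inner_coe, UniformSpace.Completion.inner_coe, hA]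
  refine ⟨J ∘L J', fun u f => ?_, fun f g => ?_, fun f => ?_, fun f => ?_, fun w => ?_⟩
  · change ((∃ w : ℕ → C, _) ∧ _) ↔ _
    rw [tendsto_form_iff hι hq hJ]
    constructor
    · rintro ⟨⟨z, rfl⟩, h⟩
      have hz : z = J' f := by
        refine hι.eq_of_inner_left ℝ ?_
        intro φ
        have h1 : inner ℝ (J z) (A φ : UniformSpace.Completion C) =
          inner ℝ (f + μ • J z) (φ : UniformSpace.Completion C) := h φ
        rw [hadj, hJ, hweak, h1, inner_add_left, real_inner_smul_left]
        ring
      rw [hz]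
      rfl
    · rintro rfl
      refine ⟨⟨J' f, rfl⟩, fun φ => ?_⟩
      have h1 := hweak (J' f) φ
      rw [hadj, hJ] at h1
      change inner ℝ (J (J' f)) _ = inner ℝ (f + μ • J (J' f)) _
      rw [inner_add_left, real_inner_smul_left]
      linarith
  · change inner ℝ (J (J' f)) g = inner ℝ f (J (J' g))
    rw [real_inner_comm, ← hadj, ← hadj, real_inner_comm]
  · change 0 ≤ inner ℝ (J (J' f)) f
    rw [hRf]
    positivity
  · change (lam - μ) * inner ℝ (J (J' f)) f ≤ _
    have h1 := real_inner_le_norm (J (J' f)) f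
    have h2 := hb (J' f)
    rw [← hRf] at h2
    have hb0 := norm_nonneg (J (J' f))
    have hc0 := norm_nonneg f
    rcases hb0.eq_or_lt with h0 | h0
    · rw [norm_eq_zero.1 h0.symm, inner_zero_left, mul_zero]
      positivity
    · have h3 : (lam - μ) * ‖J (J' f)‖ ≤ ‖f‖ := by
        refine le_of_mul_le_mul_right ?_ h0
        nlinarith
      calc _ ≤ (lam - μ) * (‖J (J' f)‖ * ‖f‖) := mul_le_mul_of_nonneg_left h1 hκ.le
        _ = (lam - μ) * ‖J (J' f)‖ * ‖f‖ := by ring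
        _ ≤ _ := by rw [sq]; exact mul_le_mul_of_nonneg_right h3 hc0
  · change _ ≤ inner ℝ (J (J' (w : UniformSpace.Completion C))) (w : UniformSpace.Completion C) * _
    have h1 : ‖w‖ ^ 2 = inner ℝ (J' (w : UniformSpace.Completion C)) (ι w) := by
      rw [hadj, hJ, UniformSpace.Completion.inner_coe, real_inner_self_eq_norm_sq]
    have h2 : inner ℝ (A w) w - μ * ‖w‖ ^ 2 = ‖ι w‖ ^ 2 := by
      rw [← real_inner_self_eq_norm_sq (ι w), hq, real_inner_self_eq_norm_sq]
    rw [hRf, h2]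
    calc ‖w‖ ^ 4 = (‖w‖ ^ 2) ^ 2 := by ring
      _ ≤ (‖J' (w : UniformSpace.Completion C)‖ * ‖ι w‖) ^ 2 :=
        pow_le_pow_left₀ (by positivity) (h1.trans_le (real_inner_le_norm _ _)) 2
      _ = _ := by ring

theorem notMem_graphSpectrum_of_lt (A : C →ₗ[ℝ] C)
    (hA : ∀ x y, inner ℝ (A x) y = inner ℝ x (A y)) {lam μ : ℝ} (hμ : μ < lam)
    (hlam : ∀ x, lam * ‖x‖ ^ 2 ≤ inner ℝ (A x) x) : μ ∉ graphSpectrum (friedrichsGraph A) := by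
  obtain ⟨R, hR, -⟩ := exists_resolvent A hA hμ hlam
  exact fun h => h ⟨R, hR⟩

end FlatForms

/-! ### Spectral gaps of bounded symmetric operators and the bottom of the essential spectrum -/

namespace FlatForms

universe u

section Bounded

variable {H : Type*} [NormedAddCommGroup H] [InnerProductSpace ℝ H]

theorem inner_sq_le_of_symm {T : H →L[ℝ] H} (hT : ∀ x y, inner ℝ (T x) y = inner ℝ x (T y))
    (h0 : ∀ x, 0 ≤ inner ℝ (T x) x) (x y : H) :
    inner ℝ (T x) y ^ 2 ≤ inner ℝ (T x) x * inner ℝ (T y) y := by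
  let q : PreInnerProductSpace.Core ℝ H :=
    shiftedCore T.toLinearMap hT 0 fun x => by simpa using h0 x
  have h := @InnerProductSpace.Core.inner_mul_inner_self_le ℝ H _ _ _ q x y
  have h1 : ∀ x y, q.inner x y = inner ℝ (T x) y := fun x y => by
    change inner ℝ (T x) y - 0 * inner ℝ x y = _
    ring
  have h2 : inner ℝ (T y) x = inner ℝ (T x) y := by rw [hT, real_inner_comm]
  have h' : ‖q.inner x y‖ * ‖q.inner y x‖ ≤ q.inner x x * q.inner y y := h
  rwa [h1, h1, h1, h1, h2, Real.norm_eq_abs, ← sq, sq_abs] at h'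

/-- Cauchy–Schwarz for the semi-inner product `⟨T x, y⟩`, taken at `y = T x`. -/
theorem norm_sq_le_of_symm {T : H →L[ℝ] H} (hT : ∀ x y, inner ℝ (T x) y = inner ℝ x (T y))
    (h0 : ∀ x, 0 ≤ inner ℝ (T x) x) (x : H) : ‖T x‖ ^ 2 ≤ ‖T‖ * inner ℝ (T x) x := by
  have h := inner_sq_le_of_symm hT h0 x (T x)
  rw [real_inner_self_eq_norm_sq] at h
  rcases (norm_nonneg (T x)).eq_or_lt with h1 | h1
  · rw [← h1]
    have := mul_nonneg (norm_nonneg T) (h0 x)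
    simpa using this
  · have h2 : inner ℝ (T (T x)) (T x) ≤ ‖T‖ * ‖T x‖ ^ 2 := by
      refine (real_inner_le_norm _ _).trans ?_
      rw [sq, ← mul_assoc]
      exact mul_le_mul_of_nonneg_right (T.le_opNorm _) (norm_nonneg _)
    have h3 := h.trans (mul_le_mul_of_nonneg_left h2 (h0 x))
    have h4 : 0 < ‖T x‖ ^ 2 := by positivity
    refine le_of_mul_le_mul_right ?_ h4
    nlinarith

/-- This is `δ T ≤ T²`, the operator form of the polynomial `s (s - δ)` being negative only in the
gap. In place of the spectral theorem, suppose the best lower bound `b` of `T² - δ T` is negative.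
Then `T² - δ T - b` factors with both roots in the gap, hence is bounded away from zero, and `b` can
be improved. -/
theorem mul_inner_le_of_gap {T : H →L[ℝ] H} (hT : ∀ x y, inner ℝ (T x) y = inner ℝ x (T y))
    {δ : ℝ} (hδ : 0 < δ)
    (hgap : ∀ s, 0 < s → s < δ → ∃ c, ∀ x, ‖x‖ ≤ c * ‖T x - s • x‖) (x : H) :
    δ * inner ℝ (T x) x ≤ ‖T x‖ ^ 2 := by
  by_contra! hx
  let f : H → ℝ := fun y => ‖T y‖ ^ 2 - δ * inner ℝ (T y) y
  let S : Set ℝ := {β | ∀ y, β * ‖y‖ ^ 2 ≤ f y}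
  have hfx : f x < 0 := by simp only [f]; linarith
  have hxn : 0 < ‖x‖ ^ 2 := by
    have : x ≠ 0 := by
      rintro rfl
      simp [f] at hfx
    positivity
  -- Completing the square; this bound also makes the discriminant `δ ^ 2 + 4 * b` nonnegative.
  have hS0 : -(δ ^ 2 / 4) ∈ S := by
    intro y
    have h1 := mul_le_mul_of_nonneg_left (real_inner_le_norm (T y) y) hδ.le
    simp only [f]
    nlinarith [sq_nonneg (‖T y‖ - δ / 2 * ‖y‖)]
  have hle : ∀ β ∈ S, ∀ y, 0 < ‖y‖ ^ 2 → β ≤ f y / ‖y‖ ^ 2 := fun β hβ y hy => by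
    rw [le_div_iff₀ hy]
    exact hβ y
  have hbdd : BddAbove S := ⟨_, fun β hβ => hle β hβ x hxn⟩
  let b := sSup S
  have hb0 : b < 0 :=
    (csSup_le ⟨_, hS0⟩ fun β hβ => hle β hβ x hxn).trans_lt (div_neg_of_neg_of_pos hfx hxn)
  have hb1 : -(δ ^ 2 / 4) ≤ b := le_csSup hbdd hS0
  have hbS : b ∈ S := by
    intro y
    rcases (sq_nonneg ‖y‖).eq_or_lt with h0 | h0
    · have := hS0 y
      rw [← h0, mul_zero] at this ⊢
      exact this
    · rw [← le_div_iff₀ h0]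
      exact csSup_le ⟨_, hS0⟩ fun β hβ => hle β hβ y h0
  have hD0 : 0 ≤ δ ^ 2 + 4 * b := by linarith
  -- The roots of `s ^ 2 - δ * s - b` are `(δ ± e) / 2`; they lie strictly between `0` and `δ`
  -- because `b < 0`.
  set e := Real.sqrt (δ ^ 2 + 4 * b) with he
  have he2 : e ^ 2 = δ ^ 2 + 4 * b := Real.sq_sqrt hD0
  have he0 : 0 ≤ e := Real.sqrt_nonneg _
  have heδ : e < δ := by nlinarith
  obtain ⟨c, hc⟩ := hgap ((δ - e) / 2) (by linarith) (by linarith)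
  obtain ⟨c', hc'⟩ := hgap ((δ + e) / 2) (by linarith) (by linarith)
  let P : H →L[ℝ] H := T ∘L T - δ • T - b • ContinuousLinearMap.id ℝ H
  have hPa : ∀ y, P y = T (T y) - δ • T y - b • y := fun y => rfl
  have hPf : ∀ y, inner ℝ (P y) y = f y - b * ‖y‖ ^ 2 := fun y => by
    rw [hPa, inner_sub_left, inner_sub_left, hT, real_inner_smul_left, real_inner_smul_left,
      real_inner_self_eq_norm_sq, real_inner_self_eq_norm_sq]
  have hPs : ∀ y z, inner ℝ (P y) z = inner ℝ y (P z) := fun y z => by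
    simp only [hPa, inner_sub_left, inner_sub_right, real_inner_smul_left, real_inner_smul_right,
      hT]
  have hP0 : ∀ y, 0 ≤ inner ℝ (P y) y := fun y => by
    rw [hPf]
    exact sub_nonneg.2 (hbS y)
  have hPfac : ∀ y, P y = T (T y - ((δ + e) / 2) • y) -
      ((δ - e) / 2) • (T y - ((δ + e) / 2) • y) := fun y => by
    rw [hPa, map_sub, map_smul, smul_sub, smul_smul]
    have h1 : (δ - e) / 2 * ((δ + e) / 2) = -b := by nlinarith
    rw [h1]
    module
  have hc0 : ∀ y, ‖y‖ ≤ |c'| * |c| * ‖P y‖ := fun y => by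
    have h1 := hc (T y - ((δ + e) / 2) • y)
    rw [← hPfac] at h1
    calc ‖y‖ ≤ c' * ‖T y - ((δ + e) / 2) • y‖ := hc' y
      _ ≤ |c'| * ‖T y - ((δ + e) / 2) • y‖ :=
        mul_le_mul_of_nonneg_right (le_abs_self _) (norm_nonneg _)
      _ ≤ |c'| * (|c| * ‖P y‖) := mul_le_mul_of_nonneg_left
        (h1.trans (mul_le_mul_of_nonneg_right (le_abs_self _) (norm_nonneg _))) (abs_nonneg _)
      _ = _ := by ring
  let d := (|c'| * |c|) ^ 2 * ‖P‖ + 1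
  have hd : 0 < d := by positivity
  -- A nonnegative symmetric `P` with `‖y‖ ≤ const * ‖P y‖` satisfies `‖y‖ ^ 2 ≤ d * ⟨P y, y⟩`,
  -- which raises the lower bound by `d⁻¹`.
  have hbig : b + d⁻¹ ∈ S := by
    intro y
    have h1 : ‖y‖ ^ 2 ≤ d * inner ℝ (P y) y := by
      calc ‖y‖ ^ 2 ≤ (|c'| * |c| * ‖P y‖) ^ 2 := pow_le_pow_left₀ (norm_nonneg _) (hc0 y) 2
        _ = (|c'| * |c|) ^ 2 * ‖P y‖ ^ 2 := by ring
        _ ≤ (|c'| * |c|) ^ 2 * (‖P‖ * inner ℝ (P y) y) :=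
          mul_le_mul_of_nonneg_left (norm_sq_le_of_symm hPs hP0 y) (sq_nonneg _)
        _ ≤ d * inner ℝ (P y) y := by
          simp only [d]
          nlinarith [hP0 y]
    rw [hPf, ← inv_mul_le_iff₀ hd] at h1
    linarith
  have := le_csSup hbdd hbig
  have hd' : 0 < d⁻¹ := inv_pos.2 hd
  linarith

/-- The orthogonal complement of the kernel is the closure of the range. At `T x`, Cauchy–Schwarz
gives `‖T x‖⁴ ≤ ⟨T x, x⟩ ⟨T T x, T x⟩`, and `mul_inner_le_of_gap` bounds `δ ⟨T x, x⟩` by `‖T x‖²`.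
-/
theorem mul_norm_sq_le_of_gap [CompleteSpace H] {T : H →L[ℝ] H}
    (hT : ∀ x y, inner ℝ (T x) y = inner ℝ x (T y)) (h0 : ∀ x, 0 ≤ inner ℝ (T x) x)
    {δ : ℝ} (hδ : 0 < δ) (hgap : ∀ s, 0 < s → s < δ → ∃ c, ∀ x, ‖x‖ ≤ c * ‖T x - s • x‖)
    {u : H} (hu : u ∈ (LinearMap.ker T.toLinearMap)ᗮ) : δ * ‖u‖ ^ 2 ≤ inner ℝ (T u) u := by
  have hrange : ∀ x, δ * ‖T x‖ ^ 2 ≤ inner ℝ (T (T x)) (T x) := fun x => by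
    have h1 := mul_inner_le_of_gap hT hδ hgap x
    have h2 := inner_sq_le_of_symm hT h0 x (T x)
    rw [real_inner_self_eq_norm_sq] at h2
    rcases (sq_nonneg ‖T x‖).eq_or_lt with h3 | h3
    · rw [← h3, mul_zero]
      exact h0 _
    · refine le_of_mul_le_mul_right ?_ h3
      calc δ * ‖T x‖ ^ 2 * ‖T x‖ ^ 2 = δ * (‖T x‖ ^ 2) ^ 2 := by ring
        _ ≤ δ * (inner ℝ (T x) x * inner ℝ (T (T x)) (T x)) := mul_le_mul_of_nonneg_left h2 hδ.le
        _ = δ * inner ℝ (T x) x * inner ℝ (T (T x)) (T x) := by ring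
        _ ≤ ‖T x‖ ^ 2 * inner ℝ (T (T x)) (T x) := mul_le_mul_of_nonneg_right h1 (h0 _)
        _ = _ := by ring
  have hsym : T.toLinearMap.IsSymmetric := hT
  rw [← hsym.orthogonal_range, Submodule.orthogonal_orthogonal_eq_closure] at hu
  have hu' : u ∈ closure (range T) := hu
  refine closure_minimal (t := {u | δ * ‖u‖ ^ 2 ≤ inner ℝ (T u) u}) ?_
    (isClosed_le (by fun_prop) (by fun_prop)) hu'
  rintro _ ⟨x, rfl⟩
  exact hrange x

/-- A unit vector with `⟨T w, w⟩ ≤ δ / 2` has at least half of its squared norm in the kernel. By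
Bessel's inequality these halves add up to at most the dimension of the kernel, so one more than
twice that number of vectors is too many. -/
theorem not_orthonormal_of_gap [CompleteSpace H] {T : H →L[ℝ] H}
    (hT : ∀ x y, inner ℝ (T x) y = inner ℝ x (T y)) (h0 : ∀ x, 0 ≤ inner ℝ (T x) x)
    {δ : ℝ} (hδ : 0 < δ) (hgap : ∀ s, 0 < s → s < δ → ∃ c, ∀ x, ‖x‖ ≤ c * ‖T x - s • x‖)
    [FiniteDimensional ℝ (LinearMap.ker T.toLinearMap)]
    (w : Fin (2 * Module.finrank ℝ (LinearMap.ker T.toLinearMap) + 1) → H)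
    (hw : Orthonormal ℝ w) : ∃ i, δ / 2 < inner ℝ (T (w i)) (w i) := by
  by_contra! hcon
  let N := LinearMap.ker T.toLinearMap
  have h1 : ∀ i, 1 / 2 ≤ ‖N.starProjection (w i)‖ ^ 2 := fun i => by
    have hk : T (N.starProjection (w i)) = 0 := by
      have : N.starProjection (w i) ∈ N := N.starProjection_apply_mem (w i)
      exact this
    have hperp : w i - N.starProjection (w i) ∈ Nᗮ := N.sub_starProjection_mem_orthogonal (w i)
    have h2 := mul_norm_sq_le_of_gap hT h0 hδ hgap hperp
    have h3 : inner ℝ (T (w i - N.starProjection (w i))) (w i - N.starProjection (w i)) =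
        inner ℝ (T (w i)) (w i) := by
      rw [map_sub, hk, sub_zero, inner_sub_right, hT (w i) (N.starProjection (w i)), hk,
        inner_zero_right, sub_zero]
    have h4 : ‖w i‖ ^ 2 = ‖N.starProjection (w i)‖ ^ 2 +
        ‖w i - N.starProjection (w i)‖ ^ 2 := by
      have h5 : inner ℝ (N.starProjection (w i)) (w i - N.starProjection (w i)) = 0 :=
        N.inner_right_of_mem_orthogonal (N.starProjection_apply_mem (w i)) hperp
      have h6 := norm_add_sq_eq_norm_sq_add_norm_sq_of_inner_eq_zero _ _ h5
      rw [add_sub_cancel] at h6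
      rw [sq, sq, sq, h6]
    rw [hw.1 i] at h4
    rw [h3] at h2
    have h5 : δ * ‖w i - N.starProjection (w i)‖ ^ 2 ≤ δ * (1 / 2) := by
      linarith [hcon i]
    have := le_of_mul_le_mul_left h5 hδ
    linarith
  let b := stdOrthonormalBasis ℝ N
  have h2 : ∀ i, ‖N.starProjection (w i)‖ ^ 2 = ∑ j, ‖inner ℝ (w i) (b j : H)‖ ^ 2 := fun i => by
    have h3 := b.sum_sq_norm_inner_left (N.orthogonalProjectionOnto (w i))
    have h4 : ‖N.orthogonalProjectionOnto (w i)‖ = ‖N.starProjection (w i)‖ := rfl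
    rw [← h4, ← h3]
    refine Finset.sum_congr rfl fun j _ => ?_
    rw [Submodule.inner_orthogonalProjectionOnto_eq_of_mem_right]
  have h3 : ∀ j, ∑ i, ‖inner ℝ (w i) (b j : H)‖ ^ 2 ≤ 1 := fun j => by
    have h4 := hw.sum_inner_products_le (s := Finset.univ) (b j : H)
    have h5 : ‖(b j : H)‖ = 1 := b.orthonormal.1 j
    rwa [h5, one_pow] at h4
  have h4 : ∑ i, ‖N.starProjection (w i)‖ ^ 2 ≤ Module.finrank ℝ N := by
    simp only [h2]
    rw [Finset.sum_comm]
    refine (Finset.sum_le_sum fun j _ => h3 j).trans ?_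
    simp
  have h5 := (Finset.sum_le_sum fun i (_ : i ∈ Finset.univ) => h1 i).trans h4
  simp only [Finset.sum_const, Finset.card_univ, Fintype.card_fin, nsmul_eq_mul] at h5
  push_cast at h5
  linarith

end Bounded

variable {C : Type u} [SeminormedAddCommGroup C] [InnerProductSpace ℝ C]

/-- With `R` the inverse of `D + 1`, the value `t⁻¹ - 1` for `D` corresponds to `t` for `R`. Indeed
`R x` solves `(D - (t⁻¹ - 1)) R x = t⁻¹ (t x - R x)`, so a bounded inverse controls `R x`, and then
`x`, by `t x - R x`. -/
theorem exists_bound_of_notMem_graphSpectrum {H : Type*} [NormedAddCommGroup H]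
    [InnerProductSpace ℝ H] {G : Set (H × H)} {R : H →L[ℝ] H}
    (hR : ∀ u f : H, (u, f + (-1 : ℝ) • u) ∈ G ↔ u = R f) {t : ℝ} (ht : 0 < t)
    (hμ : t⁻¹ - 1 ∉ graphSpectrum G) : ∃ c, ∀ x, ‖x‖ ≤ c * ‖t • x - R x‖ := by
  obtain ⟨R', hR'⟩ := not_not.1 hμ
  refine ⟨t⁻¹ * (‖R'‖ * t⁻¹ + 1), fun x => ?_⟩
  have h1 : (R x, (t⁻¹ • (t • x - R x)) + (t⁻¹ - 1) • R x) ∈ G := by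
    have h2 : (t⁻¹ • (t • x - R x)) + (t⁻¹ - 1) • R x = x + (-1 : ℝ) • R x := by
      rw [smul_sub, smul_smul, inv_mul_cancel₀ ht.ne']
      module
    rw [h2, hR]
  rw [hR'] at h1
  have h3 : x = t⁻¹ • (R x + (t • x - R x)) := by
    rw [add_sub_cancel, smul_smul, inv_mul_cancel₀ ht.ne', one_smul]
  calc ‖x‖ = t⁻¹ * ‖R x + (t • x - R x)‖ := by
        conv_lhs => rw [h3]
        rw [norm_smul, Real.norm_of_nonneg (inv_nonneg.2 ht.le)]
    _ ≤ t⁻¹ * (‖R'‖ * (t⁻¹ * ‖t • x - R x‖) + ‖t • x - R x‖) := by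
        refine mul_le_mul_of_nonneg_left ((norm_add_le _ _).trans ?_) (inv_nonneg.2 ht.le)
        refine add_le_add ?_ le_rfl
        have h4 := R'.le_opNorm (t⁻¹ • (t • x - R x))
        rwa [← h1, norm_smul, Real.norm_of_nonneg (inv_nonneg.2 ht.le)] at h4
    _ = _ := by ring

/-- The question is moved to the bounded nonnegative operator `T = (1 + lam)⁻¹ - R`, where `R` is
the resolvent at `-1`. Its kernel is the eigenspace of `lam`, and vectors of energy near `lam` make
`⟨T w, w⟩` small. If `lam` is isolated with finite multiplicity, `T` has a gap above `0` and
`not_orthonormal_of_gap` is contradicted. -/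
theorem mem_graphEssSpectrum (A : C →ₗ[ℝ] C) (hA : ∀ x y, inner ℝ (A x) y = inner ℝ x (A y))
    {lam : ℝ} (hlam0 : 0 ≤ lam) (hlam : ∀ x, lam * ‖x‖ ^ 2 ≤ inner ℝ (A x) x)
    (happrox : ∀ ε > 0, ∀ N : ℕ, ∃ w : Fin N → C, Orthonormal ℝ w ∧
      ∀ i, inner ℝ (A (w i)) (w i) ≤ lam + ε) :
    lam ∈ graphEssSpectrum (friedrichsGraph A) := by
  obtain ⟨R, hR, hRs, -, hRle, hRw⟩ := exists_resolvent A hA (μ := -1) (by linarith) hlam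
  have h1l : 0 < 1 + lam := by linarith
  set M := (1 + lam)⁻¹ with hM
  have hM0 : 0 < M := inv_pos.2 h1l
  let T : UniformSpace.Completion C →L[ℝ] UniformSpace.Completion C :=
    M • ContinuousLinearMap.id ℝ _ - R
  have hTa : ∀ x, T x = M • x - R x := fun x => rfl
  have hT : ∀ x y, inner ℝ (T x) y = inner ℝ x (T y) := fun x y => by
    simp only [hTa, inner_sub_left, inner_sub_right, real_inner_smul_left, real_inner_smul_right,
      hRs]
  have hTx : ∀ x, inner ℝ (T x) x = M * ‖x‖ ^ 2 - inner ℝ (R x) x := fun x => by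
    rw [hTa, inner_sub_left, real_inner_smul_left, real_inner_self_eq_norm_sq]
  have hT0 : ∀ x, 0 ≤ inner ℝ (T x) x := fun x => by
    have h1 := hRle x
    rw [hTx, sub_nonneg, hM, ← div_eq_inv_mul, le_div_iff₀ h1l]
    linarith
  -- The last bound of `exists_resolvent` gives `⟨R w, w⟩ ≥ 1 / (1 + lam + ε)`, and `M ≤ 1` because
  -- `lam ≥ 0`.
  have hTw : ∀ ε > 0, ∀ w : C, ‖w‖ = 1 → inner ℝ (A w) w ≤ lam + ε →
      inner ℝ (T (w : UniformSpace.Completion C)) (w : UniformSpace.Completion C) ≤ ε := by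
    intro ε hε w hw hle
    have h1 := hRw w
    have h2 : 0 < 1 + lam + ε := by linarith
    have h2' : 0 < lam + ε + 1 := by linarith
    have h3 : inner ℝ (A w) w - -1 * ‖w‖ ^ 2 ≤ lam + ε + 1 := by
      rw [hw]
      linarith
    set r := inner ℝ (R (w : UniformSpace.Completion C)) (w : UniformSpace.Completion C) with hr
    have hA0 : 0 < inner ℝ (A w) w - -1 * ‖w‖ ^ 2 := by
      have := hlam w
      rw [hw] at this ⊢
      linarith
    have hr0 : 0 < r := by
      have h1' : 1 ≤ r * (inner ℝ (A w) w - -1 * ‖w‖ ^ 2) := by simpa [hw] using h1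
      exact pos_of_mul_pos_left (one_pos.trans_le h1') hA0.le
    have h4 : 1 ≤ r * (lam + ε + 1) := by
      have h1' : 1 ≤ r * (inner ℝ (A w) w - -1 * ‖w‖ ^ 2) := by simpa [hw] using h1
      exact h1'.trans (mul_le_mul_of_nonneg_left h3 hr0.le)
    rw [hTx, UniformSpace.Completion.norm_coe, hw, ← hr]
    have hM1 : M ≤ 1 := inv_le_one_of_one_le₀ (by linarith)
    have hMl : M * (1 + lam) = 1 := inv_mul_cancel₀ h1l.ne'
    have h5 : (M - r) * (lam + ε + 1) ≤ ε * (lam + ε + 1) := by nlinarith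
    have := le_of_mul_le_mul_right h5 h2'
    linarith
  have hspec : lam ∈ graphSpectrum (friedrichsGraph A) := by
    by_contra hcon
    have hcon' : M⁻¹ - 1 ∉ graphSpectrum (friedrichsGraph A) := by
      rwa [hM, inv_inv, add_sub_cancel_left]
    obtain ⟨c, hc⟩ := exists_bound_of_notMem_graphSpectrum hR hM0 hcon'
    let d := c ^ 2 * ‖T‖ + 1
    have hd : 0 < d := by positivity
    obtain ⟨w, hw, hwe⟩ := happrox (2 * d)⁻¹ (by positivity) 1
    have h1 := hTw (2 * d)⁻¹ (by positivity) (w 0) (hw.1 0) (hwe 0)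
    have h2 := norm_sq_le_of_symm hT hT0 (w 0 : UniformSpace.Completion C)
    have h3 := hc (w 0 : UniformSpace.Completion C)
    rw [← hTa, UniformSpace.Completion.norm_coe, hw.1 0] at h3
    have h4 : 1 ≤ c ^ 2 * ‖T (w 0 : UniformSpace.Completion C)‖ ^ 2 := by
      rw [← mul_pow]
      exact one_le_pow₀ h3
    have h5 : 1 ≤ d * (2 * d)⁻¹ := by
      calc (1 : ℝ) ≤ c ^ 2 * (‖T‖ * (2 * d)⁻¹) := h4.trans (mul_le_mul_of_nonneg_left
            (h2.trans (mul_le_mul_of_nonneg_left h1 (norm_nonneg _))) (sq_nonneg _))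
        _ = (c ^ 2 * ‖T‖) * (2 * d)⁻¹ := by ring
        _ ≤ _ := mul_le_mul_of_nonneg_right (by simp [d]) (by positivity)
    rw [mul_inv, mul_left_comm, mul_inv_cancel₀ hd.ne'] at h5
    norm_num at h5
  refine ⟨hspec, ?_⟩
  by_contra! hcon
  obtain ⟨hacc, hfin⟩ := hcon
  have hker : {u | (u, lam • u) ∈ friedrichsGraph A} = (LinearMap.ker T.toLinearMap : Set _) := by
    ext u
    have h1 : lam • u = (1 + lam) • u + (-1 : ℝ) • u := by module
    have h2 : T u = 0 ↔ u = R ((1 + lam) • u) := by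
      rw [hTa, sub_eq_zero, map_smul]
      constructor
      · intro h
        rw [← h, smul_smul, hM, mul_inv_cancel₀ h1l.ne', one_smul]
      · intro h
        conv_lhs => rw [h]
        rw [smul_smul, hM, inv_mul_cancel₀ h1l.ne', one_smul]
    change (u, lam • u) ∈ friedrichsGraph A ↔ T u = 0
    rw [h1, hR, h2]
  rw [hker, Submodule.span_eq] at hfin
  obtain ⟨U, hU, hUs⟩ : ∃ U ∈ 𝓝 lam, ∀ y ∈ U ∩ graphSpectrum (friedrichsGraph A), y = lam := by
    rw [accPt_iff_nhds] at hacc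
    push Not at hacc
    exact hacc
  obtain ⟨ε, hε, hball⟩ := Metric.mem_nhds_iff.1 hU
  have h1le : 0 < 1 + lam + ε := by linarith
  -- The map `s ↦ (M - s)⁻¹ - 1` carries the interval from `0` to `δ` onto the interval from `lam`
  -- to `lam + ε`, where there is no spectrum.
  set δ := M - (1 + lam + ε)⁻¹ with hδdef
  have hδ : 0 < δ := sub_pos.2 (inv_strictAnti₀ h1l (by linarith))
  have hgap : ∀ s, 0 < s → s < δ → ∃ c, ∀ x, ‖x‖ ≤ c * ‖T x - s • x‖ := by
    intro s hs hsδ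
    have ht1 : (1 + lam + ε)⁻¹ < M - s := by linarith
    have ht : 0 < M - s := (inv_pos.2 h1le).trans ht1
    have h2 : (M - s)⁻¹ < 1 + lam + ε := inv_lt_of_inv_lt₀ h1le ht1
    have h3 : 1 + lam < (M - s)⁻¹ := by
      rw [lt_inv_comm₀ h1l ht]
      linarith
    have h4 : (M - s)⁻¹ - 1 ∉ graphSpectrum (friedrichsGraph A) := by
      intro hmem
      have := hUs _ ⟨hball ?_, hmem⟩
      · linarith
      · rw [Metric.mem_ball, Real.dist_eq, abs_lt]
        constructor <;> linarith
    obtain ⟨c, hc⟩ := exists_bound_of_notMem_graphSpectrum hR ht h4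
    refine ⟨c, fun x => ?_⟩
    have h5 : T x - s • x = (M - s) • x - R x := by
      rw [hTa]
      module
    rw [h5]
    exact hc x
  obtain ⟨w, hw, hwe⟩ := happrox (δ / 2) (by positivity)
    (2 * Module.finrank ℝ (LinearMap.ker T.toLinearMap) + 1)
  obtain ⟨i, hi⟩ := not_orthonormal_of_gap hT hT0 hδ hgap
    (fun i => (w i : UniformSpace.Completion C))
    (hw.comp_linearIsometry (UniformSpace.Completion.toComplₗᵢ (𝕜 := ℝ) (E := C)))
  exact absurd (hTw (δ / 2) (by positivity) (w i) (hw.1 i) (hwe i)) (not_le.2 hi)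

end FlatForms

/-! ### Cut-off lifts of test forms and their Rayleigh quotients -/

namespace FlatForms

variable {n k l : ℕ} {Γ Γ' : Subgroup (EucGroup n)} {P : Euc n →L[ℝ] Euc n}

/-- A vanishing integral gives `ω = 0` almost everywhere on the fundamental domain, by invariance
almost everywhere on `ℝⁿ`, and by continuity everywhere. -/
theorem l2Inner_self_pos (hΓ : LocFin Γ) (hfree : FixedPointFree Γ) {ω : CcForm Γ k}
    (hω : ω ≠ 0) : 0 < l2Inner ω ω := by
  refine (l2Inner_self_nonneg ω).lt_of_ne fun h0 => hω ?_
  have hcount : Countable Γ := hΓ.countable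
  set h : Euc n → ℝ := fun x => covecInner (ω.lift x) (ω.lift x) with hh
  have hc : Continuous h :=
    continuous_covecInner ω.contDiff.continuous ω.contDiff.continuous
  have h1 : h =ᵐ[volume.restrict (dirichletDomain Γ)] 0 :=
    (integral_eq_zero_iff_of_nonneg (fun _ => covecInner_self_nonneg _)
      (integrable_covecInner ω ω)).1 h0.symm
  have h2 : volume {x | h x ≠ 0} = 0 := by
    refine (isFundamentalDomain_dirichletDomain hΓ hfree).measure_zero_of_invariant _
      (fun γ => ?_) ?_
    · ext x
      rw [mem_smul_set_iff_inv_smul_mem]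
      simp only [mem_ofPred_eq, subgroup_smul_def, hh, ω.covecInner_invariant ω (γ⁻¹).2]
    · have h3 : volume.restrict (dirichletDomain Γ) {x | h x ≠ 0} = 0 := ae_iff.1 h1
      rwa [Measure.restrict_apply (isOpen_ne_fun hc continuous_const).measurableSet] at h3
  have h3 : h = 0 := (hc.ae_eq_iff_eq volume continuous_zero).1 (ae_iff.2 h2)
  refine CcForm.ext_lift (funext fun x => ?_)
  exact eq_zero_of_covecInner_self (congrFun h3 x)

/-- The averages over `Γ'` of cut-off functions that are invariant under `Γ` approximate `m` times
their averages over `Γ`. -/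
def Averages (Γ Γ' : Subgroup (EucGroup n)) (P : Euc n →L[ℝ] Euc n) (ψ : Euc n → ℝ)
    (K R m : ℝ) : Prop :=
  ∀ r B : ℝ, 0 ≤ r → r ≤ R → 0 ≤ B →
    (∀ h : Euc n → ℝ, Continuous h → (∀ γ ∈ Γ, ∀ x, h (γ x) = h x) → (∀ x, |h x| ≤ B) →
      (∀ x, h x ≠ 0 → ∃ γ ∈ Γ, ‖γ x‖ ≤ r) →
      |(∫ x in dirichletDomain Γ', ψ (R⁻¹ • P x) * h x) - m * ∫ x in dirichletDomain Γ, h x| ≤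
        4 ^ (n + 1) * K * r * B * volume.real (Metric.closedBall (0 : Euc n) r) / R * m) ∧
    (∀ e : Euc n → ℝ, Continuous e → (∀ γ ∈ Γ', ∀ x, e (γ x) = e x) → (∀ x, |e x| ≤ B) →
      (∀ x, e x ≠ 0 → (∃ γ ∈ Γ, ‖γ x‖ ≤ r) ∧ ‖P x‖ ≤ 2 * R) →
      |∫ x in dirichletDomain Γ', e x| ≤
        4 ^ (n + 1) * B * volume.real (Metric.closedBall (0 : Euc n) r) * m)

/-- The constant in the comparison of `L²` norms of a form and of its cut-off. -/
noncomputable def cutoffConst (n l : ℕ) (K r B b : ℝ) : ℝ :=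
  4 ^ (n + 1) * volume.real (Metric.closedBall (0 : Euc n) r) *
    (K * r * (covecConst n l * (B * B)) + covecConst n l * (2 * (B * b) + b * b))

/-- The main term of `|θ'|²` is `φ²` times the invariant function `|θ|²`, to which the first
averaging estimate applies. The cross and square terms in the error `ε` are `O(1/R)`, and the second
estimate applies. -/
theorem Averages.abs_l2Inner_sub_le {φ : Euc n → ℝ} {K R m r B b : ℝ}
    (hav : Averages Γ Γ' P (fun x => φ x ^ 2) K R m) (hle : Γ' ≤ Γ)
    (hPinv : ∀ γ ∈ Γ', ∀ x, P (γ x) = P x) (hφc : Continuous φ) (hφ0 : ∀ x, 0 ≤ φ x)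
    (hφ1 : ∀ x, φ x ≤ 1) (hr : 0 ≤ r) (hrR : r ≤ R) (hR1 : 1 ≤ R) (hb : 0 ≤ b)
    {θ : CcForm Γ l} {θ' σ : CcForm Γ' l} {ε : Euc n → Covec n l}
    (hσ : ∀ x, σ.lift x = φ (R⁻¹ • P x) • θ.lift x)
    (hθ' : ∀ x, θ'.lift x = φ (R⁻¹ • P x) • θ.lift x + ε x)
    (hB0 : 0 ≤ B) (hB : ∀ x, ‖θ.lift x‖ ≤ B) (hθr : ∀ x, θ.lift x ≠ 0 → ∃ γ ∈ Γ, ‖γ x‖ ≤ r)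
    (hε : ∀ x, ‖ε x‖ ≤ b / R) (hεr : ∀ x, ε x ≠ 0 → (∃ γ ∈ Γ, ‖γ x‖ ≤ r) ∧ ‖P x‖ ≤ 2 * R) :
    |l2Inner θ' θ' - m * l2Inner θ θ| ≤ cutoffConst n l K r B b / R * m := by
  have hR0 : 0 < R := one_pos.trans_le hR1
  have hcc := covecConst_nonneg n l
  set χ : Euc n → ℝ := fun x => φ (R⁻¹ • P x) with hχ
  have hχc : Continuous χ := hφc.comp (P.continuous.const_smul R⁻¹)
  set h : Euc n → ℝ := fun x => covecInner (θ.lift x) (θ.lift x) with hh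
  have hhc : Continuous h := continuous_covecInner θ.contDiff.continuous θ.contDiff.continuous
  set e : Euc n → ℝ := fun x => covecInner (θ'.lift x) (θ'.lift x) - χ x ^ 2 * h x with he
  have hec : Continuous e :=
    (continuous_covecInner θ'.contDiff.continuous θ'.contDiff.continuous).sub
      ((hχc.pow 2).mul hhc)
  have hee : ∀ x, e x = 2 * (χ x * covecInner (θ.lift x) (ε x)) + covecInner (ε x) (ε x) := by
    intro x
    have h0 : ∀ α, covecInner α (χ x • θ.lift x + ε x) =
        χ x * covecInner α (θ.lift x) + covecInner α (ε x) := fun α => by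
      rw [covecInner_comm, covecInner_add_left, covecInner_smul_left, covecInner_comm,
        covecInner_comm (ε x)]
    change covecInner (θ'.lift x) (θ'.lift x) - χ x ^ 2 * covecInner (θ.lift x) (θ.lift x) = _
    rw [hθ' x]
    change covecInner (χ x • θ.lift x + ε x) (χ x • θ.lift x + ε x) - _ = _
    rw [h0, covecInner_add_left, covecInner_add_left, covecInner_smul_left, covecInner_smul_left,
      covecInner_comm (ε x) (θ.lift x)]
    ring
  have h1 := (hav r (covecConst n l * (B * B)) hr hrR (by positivity)).1 h hhc
    (fun γ hγ x => θ.covecInner_invariant θ hγ x) (CcForm.covecInner_bound hB hB)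
    (fun x hx => hθr x fun h0 => hx (by simp only [hh, h0, covecInner_zero_left]))
  have h2 := (hav r (covecConst n l * (2 * (B * b) + b * b) / R) hr hrR (by positivity)).2 e hec
    (fun γ hγ x => by
      simp only [he, hh, hχ, θ'.covecInner_invariant θ' hγ, θ.covecInner_invariant θ (hle hγ),
        hPinv γ hγ])
    (fun x => by
      rw [hee]
      have hχ1 : |χ x| ≤ 1 := by
        rw [abs_of_nonneg (hφ0 _)]
        exact hφ1 _
      have h3 : |covecInner (θ.lift x) (ε x)| ≤ covecConst n l * (B * (b / R)) :=
        (abs_covecInner_le _ _).trans (mul_le_mul_of_nonneg_left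
          (mul_le_mul (hB x) (hε x) (norm_nonneg _) hB0) hcc)
      have h4 : |covecInner (ε x) (ε x)| ≤ covecConst n l * (b * b / R) := by
        refine (abs_covecInner_le _ _).trans (mul_le_mul_of_nonneg_left ?_ hcc)
        refine (mul_le_mul (hε x) (hε x) (norm_nonneg _) (by positivity)).trans ?_
        rw [div_mul_div_comm]
        exact div_le_div_of_nonneg_left (by positivity) hR0 (le_mul_of_one_le_left hR0.le hR1)
      refine (abs_add_le _ _).trans ?_
      rw [abs_mul, abs_mul, abs_two]
      have h5 : |χ x| * |covecInner (θ.lift x) (ε x)| ≤ 1 * (covecConst n l * (B * (b / R))) :=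
        mul_le_mul hχ1 h3 (abs_nonneg _) zero_le_one
      refine (add_le_add (mul_le_mul_of_nonneg_left h5 zero_le_two) h4).trans (le_of_eq ?_)
      ring)
    (fun x hx => hεr x fun h0 => hx (by
      rw [hee, h0, covecInner_comm, covecInner_zero_left, covecInner_zero_left]
      ring))
  -- The form `σ` only serves here: its squared norm is this integrand.
  have hint : IntegrableOn (fun x => χ x ^ 2 * h x) (dirichletDomain Γ') := by
    refine (integrable_covecInner σ σ).congr_fun (fun x _ => ?_)
      (isClosed_dirichletDomain Γ').measurableSet
    simp only [hσ, covecInner_smul_left, covecInner_comm _ (φ (R⁻¹ • P x) • θ.lift x)]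
    ring
  have h3 : l2Inner θ' θ' = (∫ x in dirichletDomain Γ', χ x ^ 2 * h x) +
      ∫ x in dirichletDomain Γ', e x := by
    rw [he, integral_sub (integrable_covecInner _ _) hint]
    simp only [l2Inner]
    ring
  have h4 : l2Inner θ' θ' - m * l2Inner θ θ =
      ((∫ x in dirichletDomain Γ', χ x ^ 2 * h x) - m * ∫ x in dirichletDomain Γ, h x) +
        ∫ x in dirichletDomain Γ', e x := by
    rw [h3]
    simp only [l2Inner, hh]
    ring
  rw [h4]
  refine (abs_add_le _ _).trans ((add_le_add h1 h2).trans (le_of_eq ?_))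
  unfold cutoffConst
  ring

theorem exists_cutoffForm (hle : Γ' ≤ Γ) (hP : CocompactAlong Γ' P) {φ : Euc n → ℝ}
    (hφ : ContDiff ℝ (⊤ : ℕ∞) φ) (hφs : ∀ x, φ x ≠ 0 → ‖x‖ ≤ 2) {R : ℝ} (hR : 0 < R)
    (ω : CcForm Γ k) : ∃ η : CcForm Γ' k, ∀ x, η.lift x = φ (R⁻¹ • P x) • ω.lift x := by
  obtain ⟨C, -, hC⟩ := hP.bdd
  refine ⟨⟨fun x => φ (R⁻¹ • P x) • ω.lift x, (contDiff_cutoff hφ P R).smul ω.contDiff,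
    fun γ hγ x => ?_, Metric.closedBall 0 (2 * R + C), isCompact_closedBall _ _, fun x hx => ?_⟩,
    fun x => rfl⟩
  · have h := ω.lift_rot (hle hγ) x
    simp only [hP.inv γ hγ]
    rw [← h]
    rfl
  · obtain ⟨γ, hγ, h⟩ := hC x
    have h1 := cutoff_ne_zero hφs hR (left_ne_zero_of_smul hx)
    exact ⟨γ, hγ, mem_closedBall_zero_iff.2 (h.trans (by linarith))⟩

/-- The cut-off estimate uses of `d`, and likewise of `δ`, only that it is a fixed bounded linear
function of the first derivative. -/
theorem exists_extDeriv_eq (n k : ℕ) :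
    ∃ (L : (Euc n →L[ℝ] Covec n k) →ₗ[ℝ] Covec n (k + 1)) (N : ℝ), 0 ≤ N ∧
      (∀ D, ‖L D‖ ≤ N * ‖D‖) ∧
      ∀ (ω : Euc n → Covec n k) (x : Euc n), extDeriv ω x = L (fderiv ℝ ω x) :=
  ⟨{  toFun := ContinuousAlternatingMap.alternatizeUncurryFin
      map_add' := ContinuousAlternatingMap.alternatizeUncurryFin_add
      map_smul' := ContinuousAlternatingMap.alternatizeUncurryFin_smul },
    (k + 1 : ℕ), by positivity,
    fun D => by simpa using ContinuousAlternatingMap.norm_alternatizeUncurryFin_le D,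
    fun _ _ => rfl⟩

theorem exists_codiff_eq (n k : ℕ) :
    ∃ (L : (Euc n →L[ℝ] Covec n (k + 1)) →ₗ[ℝ] Covec n k) (N : ℝ), 0 ≤ N ∧
      (∀ D, ‖L D‖ ≤ N * ‖D‖) ∧
      ∀ (ω : Euc n → Covec n (k + 1)) (x : Euc n), codiff ω x = L (fderiv ℝ ω x) := by
  refine ⟨{ toFun := fun D => -∑ i : Fin n, (D (stdVec i)).curryLeft (stdVec i)
            map_add' := fun D D' => ?_
            map_smul' := fun c D => ?_ }, n, by positivity, fun D => ?_, fun _ _ => rfl⟩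
  · rw [← neg_add, ← Finset.sum_add_distrib]
    rfl
  · rw [RingHom.id_apply, smul_neg, Finset.smul_sum]
    rfl
  · change ‖-∑ i : Fin n, (D (stdVec i)).curryLeft (stdVec i)‖ ≤ _
    rw [norm_neg]
    refine (norm_sum_le _ _).trans ((Finset.sum_le_sum (g := fun _ => ‖D‖) fun i _ => ?_).trans
      (by simp))
    have h1 := (D (stdVec i)).curryLeft.le_opNorm (stdVec i)
    have h2 := D.le_opNorm (stdVec i)
    rw [norm_stdVec, mul_one] at h1 h2
    refine h1.trans (le_trans ?_ h2)
    exact (ContinuousAlternatingMap.norm_curryLeft _).le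

/-- By the Leibniz rule `L` of the derivative of the cut-off form is the cut-off of `θ` plus a term
with the derivative of the cut-off, of size at most `N K B' / R`. -/
theorem abs_l2Inner_deriv_cutoff_sub_le {L : (Euc n →L[ℝ] Covec n k) →ₗ[ℝ] Covec n l}
    {N : ℝ} (hN : 0 ≤ N) (hL : ∀ D, ‖L D‖ ≤ N * ‖D‖)
    {φ : Euc n → ℝ} {K : NNReal} {K' R m r B b B' : ℝ}
    (hav : Averages Γ Γ' P (fun x => φ x ^ 2) K' R m) (hle : Γ' ≤ Γ)
    (hP : CocompactAlong Γ' P) (hφ : ContDiff ℝ (⊤ : ℕ∞) φ) (hφK : LipschitzWith K φ)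
    (hφ0 : ∀ x, 0 ≤ φ x) (hφ1 : ∀ x, φ x ≤ 1) (hφs : ∀ x, φ x ≠ 0 → ‖x‖ ≤ 2)
    (hr : 0 ≤ r) (hrR : r ≤ R) (hR1 : 1 ≤ R) {ω : CcForm Γ k} {η : CcForm Γ' k}
    (hη : ∀ x, η.lift x = φ (R⁻¹ • P x) • ω.lift x)
    {θ : CcForm Γ l} {θ' : CcForm Γ' l} (hθ : ∀ x, θ.lift x = L (fderiv ℝ ω.lift x))
    (hθ' : ∀ x, θ'.lift x = L (fderiv ℝ η.lift x))
    (hB' : ∀ x, ‖ω.lift x‖ ≤ B') (hωr : ∀ x, ω.lift x ≠ 0 → ∃ γ ∈ Γ, ‖γ x‖ ≤ r)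
    (hB0 : 0 ≤ B) (hB : ∀ x, ‖θ.lift x‖ ≤ B) (hθr : ∀ x, θ.lift x ≠ 0 → ∃ γ ∈ Γ, ‖γ x‖ ≤ r)
    (hb : b = N * (K * B')) :
    |l2Inner θ' θ' - m * l2Inner θ θ| ≤ cutoffConst n l K' r B b / R * m := by
  have hR0 : 0 < R := one_pos.trans_le hR1
  have hB'0 : 0 ≤ B' := (norm_nonneg _).trans (hB' 0)
  obtain ⟨σ, hσ⟩ := exists_cutoffForm hle hP hφ hφs hR0 θ
  have hχ : ContDiff ℝ (⊤ : ℕ∞) fun x => φ (R⁻¹ • P x) := contDiff_cutoff hφ P R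
  let E : Euc n → Euc n →L[ℝ] Covec n k := fun x =>
    (fderiv ℝ (fun x => φ (R⁻¹ • P x)) x).smulRight (ω.lift x)
  refine hav.abs_l2Inner_sub_le hle hP.inv hφ.continuous hφ0 hφ1 hr hrR hR1 (b := b)
    (by rw [hb]; positivity) hσ (ε := fun x => L (E x)) (fun x => ?_) hB0 hB hθr (fun x => ?_)
    fun x hx => ?_
  · have h1 : η.lift = fun x => φ (R⁻¹ • P x) • ω.lift x := funext hη
    have h2 : fderiv ℝ η.lift x = φ (R⁻¹ • P x) • fderiv ℝ ω.lift x + E x := by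
      rw [h1]
      exact fderiv_fun_smul (hχ.differentiable (by simp) x)
        (ω.contDiff.differentiable (by simp) x)
    rw [hθ', hθ, h2, map_add, map_smul]
  · refine (hL _).trans ?_
    rw [hb, mul_div_assoc]
    refine mul_le_mul_of_nonneg_left ?_ hN
    rw [ContinuousLinearMap.norm_smulRight_apply, mul_div_right_comm]
    exact mul_le_mul (norm_fderiv_cutoff_le hφK hP.norm_le hR0 x) (hB' x) (norm_nonneg _)
      (by positivity)
  · constructor
    · refine hωr x fun h0 => hx ?_
      have : E x = 0 := by
        ext
        simp [E, h0]
      rw [this, map_zero]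
    · refine fderiv_cutoff_ne_zero hφs hR0 fun h0 => hx ?_
      have : E x = 0 := by
        simp only [E]
        rw [h0]
        ext
        simp
      rw [this, map_zero]

/-- The energy is `‖dω‖² + ‖δω‖²`, so only first derivatives meet the cut-off, and the norm and both
energy terms are covered by the preceding estimates. One scale `R` must serve all of them, hence the
common support radius `s`. -/
theorem exists_cutoff_approx (hΓ : LocFin Γ) (hfree : FixedPointFree Γ) (hle : Γ' ≤ Γ)
    (hP : CocompactAlong Γ' P) (ω : CcForm Γ k) :
    ∃ c, 0 ≤ c ∧ ∀ ρ, ∃ R ≥ ρ, 0 < R ∧ ∃ m > 0, ∃ η : CcForm Γ' k,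
      |l2Inner η η - m * l2Inner ω ω| ≤ c / R * m ∧
      |l2Inner (hodgeLaplacian Γ' k η) η - m * l2Inner (hodgeLaplacian Γ k ω) ω| ≤ c / R * m := by
  obtain ⟨φ, K, hφ, hφK, hφ0, hφ1, hφone, hφs⟩ := exists_bump n
  have hΓ' : LocFin Γ' := hΓ.mono hle
  have hfree' : FixedPointFree Γ' := hfree.mono hle
  have hsqK : ∀ x y, |φ x ^ 2 - φ y ^ 2| ≤ 2 * K * ‖x - y‖ := fun x y => by
    have h1 : |φ x - φ y| ≤ K * ‖x - y‖ := by
      simpa [dist_eq_norm] using hφK.dist_le_mul x y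
    have h2 : |φ x + φ y| ≤ 2 := by
      rw [abs_of_nonneg (add_nonneg (hφ0 x) (hφ0 y))]
      linarith [hφ1 x, hφ1 y]
    rw [sq_sub_sq, abs_mul, mul_assoc]
    exact mul_le_mul h2 h1 (abs_nonneg _) zero_le_two
  have havg : ∀ ρ, ∃ R ≥ ρ, 0 < R ∧ ∃ m > 0, Averages Γ Γ' P (fun x => φ x ^ 2) (2 * K) R m :=
    fun ρ => exists_averaging hΓ hfree hle hP (by positivity) (hφ.continuous.pow 2)
      (fun x => sq_nonneg _) hsqK (fun x hx => by
        change φ x ^ 2 = 1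
        rw [hφone x hx, one_pow])
      (fun x hx => hφs x (pow_ne_zero_iff two_ne_zero |>.1 hx)) ρ
  obtain ⟨r, B, hr, hB, hωr, hωB⟩ := ω.exists_bound
  obtain ⟨r₁, B₁, hr₁, hB₁, hdr, hdB⟩ := (dForm Γ k ω).exists_bound
  have hconst : ∀ {l : ℕ} {r B b : ℝ}, 0 ≤ r → 0 ≤ B → 0 ≤ b →
      0 ≤ cutoffConst n l (2 * K) r B b := by
    intro l r B b hr hB hb
    have := covecConst_nonneg n l
    unfold cutoffConst
    positivity
  obtain ⟨Ld, Nd, hNd, hLdN, hLd⟩ := exists_extDeriv_eq n k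
  have hb₁ : 0 ≤ Nd * (K * B) := by positivity
  obtain _ | k := k
  · let s := max r r₁
    have hs : 0 ≤ s := hr.trans (le_max_left _ _)
    refine ⟨cutoffConst n 0 (2 * K) s B 0 + cutoffConst n 1 (2 * K) s B₁ (Nd * (K * B)),
      add_nonneg (hconst hs hB le_rfl) (hconst hs hB₁ hb₁), fun ρ => ?_⟩
    obtain ⟨R, hR, hR0, m, hm, hav⟩ := havg (max ρ (max s 1))
    have hsR : s ≤ R := ((le_max_left _ _).trans (le_max_right _ _)).trans hR
    have h1R : 1 ≤ R := ((le_max_right _ _).trans (le_max_right _ _)).trans hR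
    obtain ⟨η, hη⟩ := exists_cutoffForm hle hP hφ hφs hR0 ω
    have hn : |l2Inner η η - m * l2Inner ω ω| ≤ cutoffConst n 0 (2 * K) s B 0 / R * m :=
      hav.abs_l2Inner_sub_le hle hP.inv hφ.continuous hφ0 hφ1 hs hsR h1R le_rfl hη
        (ε := fun _ => 0) (by simpa using hη) hB hωB
        (fun x hx => (hωr x hx).imp fun γ h => ⟨h.1, h.2.trans (le_max_left _ _)⟩) (by simp)
        (by simp)
    have hd := abs_l2Inner_deriv_cutoff_sub_le hNd hLdN hav hle hP hφ hφK hφ0 hφ1 hφs hs hsR h1R hη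
      (θ := dForm Γ 0 ω) (θ' := dForm Γ' 0 η) (hLd _) (hLd _) hωB
      (fun x hx => (hωr x hx).imp fun γ h => ⟨h.1, h.2.trans (le_max_left _ _)⟩) hB₁ hdB
      (fun x hx => (hdr x hx).imp fun γ h => ⟨h.1, h.2.trans (le_max_right _ _)⟩) rfl
    refine ⟨R, (le_max_left _ _).trans hR, hR0, m, hm, η, hn.trans ?_, ?_⟩
    · gcongr
      exact le_add_of_nonneg_right (hconst hs hB₁ hb₁)
    · rw [l2Inner_hodgeLaplacian_zero hΓ' hfree', l2Inner_hodgeLaplacian_zero hΓ hfree]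
      refine hd.trans ?_
      gcongr
      exact le_add_of_nonneg_left (hconst hs hB le_rfl)
  · obtain ⟨r₂, B₂, hr₂, hB₂, hδr, hδB⟩ := (deltaForm Γ k ω).exists_bound
    obtain ⟨Lδ, Nδ, hNδ, hLδN, hLδ⟩ := exists_codiff_eq n k
    have hb₂ : 0 ≤ Nδ * (K * B) := by positivity
    let s := max r (max r₁ r₂)
    have hs : 0 ≤ s := hr.trans (le_max_left _ _)
    refine ⟨cutoffConst n (k + 1) (2 * K) s B 0 +
      (cutoffConst n k (2 * K) s B₂ (Nδ * (K * B)) +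
        cutoffConst n (k + 1 + 1) (2 * K) s B₁ (Nd * (K * B))),
      add_nonneg (hconst hs hB le_rfl) (add_nonneg (hconst hs hB₂ hb₂) (hconst hs hB₁ hb₁)),
      fun ρ => ?_⟩
    obtain ⟨R, hR, hR0, m, hm, hav⟩ := havg (max ρ (max s 1))
    have hsR : s ≤ R := ((le_max_left _ _).trans (le_max_right _ _)).trans hR
    have h1R : 1 ≤ R := ((le_max_right _ _).trans (le_max_right _ _)).trans hR
    obtain ⟨η, hη⟩ := exists_cutoffForm hle hP hφ hφs hR0 ω
    have hωs : ∀ x, ω.lift x ≠ 0 → ∃ γ ∈ Γ, ‖γ x‖ ≤ s :=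
      fun x hx => (hωr x hx).imp fun γ h => ⟨h.1, h.2.trans (le_max_left _ _)⟩
    have hn : |l2Inner η η - m * l2Inner ω ω| ≤ cutoffConst n (k + 1) (2 * K) s B 0 / R * m :=
      hav.abs_l2Inner_sub_le hle hP.inv hφ.continuous hφ0 hφ1 hs hsR h1R le_rfl hη
        (ε := fun _ => 0) (by simpa using hη) hB hωB hωs (by simp) (by simp)
    have hd := abs_l2Inner_deriv_cutoff_sub_le hNd hLdN hav hle hP hφ hφK hφ0 hφ1 hφs hs hsR h1R hη
      (θ := dForm Γ (k + 1) ω) (θ' := dForm Γ' (k + 1) η) (hLd _) (hLd _) hωB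
      hωs hB₁ hdB (fun x hx => (hdr x hx).imp fun γ h =>
        ⟨h.1, h.2.trans ((le_max_left _ _).trans (le_max_right _ _))⟩) rfl
    have hδ := abs_l2Inner_deriv_cutoff_sub_le hNδ hLδN hav hle hP hφ hφK hφ0 hφ1 hφs hs hsR h1R hη
      (θ := deltaForm Γ k ω) (θ' := deltaForm Γ' k η) (hLδ _) (hLδ _) hωB
      hωs hB₂ hδB (fun x hx => (hδr x hx).imp fun γ h =>
        ⟨h.1, h.2.trans ((le_max_right _ _).trans (le_max_right _ _))⟩) rfl
    refine ⟨R, (le_max_left _ _).trans hR, hR0, m, hm, η, hn.trans ?_, ?_⟩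
    · gcongr
      exact le_add_of_nonneg_right (add_nonneg (hconst hs hB₂ hb₂) (hconst hs hB₁ hb₁))
    · rw [l2Inner_hodgeLaplacian_succ hΓ' hfree', l2Inner_hodgeLaplacian_succ hΓ hfree, mul_add,
        add_sub_add_comm]
      refine (abs_add_le _ _).trans ((add_le_add hδ hd).trans ?_)
      rw [← add_mul, ← add_div]
      exact mul_le_mul_of_nonneg_right (div_le_div_of_nonneg_right
        (le_add_of_nonneg_left (hconst hs hB le_rfl)) hR0.le) hm.le

theorem bottomRayleigh_le_of_le (hΓ : LocFin Γ) (hfree : FixedPointFree Γ) (hle : Γ' ≤ Γ)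
    (hP : CocompactAlong Γ' P) (k : ℕ) : bottomRayleigh Γ' k ≤ bottomRayleigh Γ k := by
  refine le_iInf₂ fun ω hω => ?_
  have ha := l2Inner_self_pos hΓ hfree hω
  have hE := l2Inner_hodgeLaplacian_self_nonneg hΓ hfree ω
  set a := l2Inner ω ω with hadef
  set E := l2Inner (hodgeLaplacian Γ k ω) ω with hEdef
  refine EReal.le_of_forall_lt_iff_le.1 fun t ht => ?_
  rw [EReal.coe_lt_coe_iff] at ht
  have ht0 : 0 < t := (div_nonneg hE ha.le).trans_lt ht
  rw [div_lt_iff₀ ha] at ht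
  obtain ⟨c, hc, hcut⟩ := exists_cutoff_approx hΓ hfree hle hP ω
  -- The first summand makes the errors in energy and norm fit into the slack `t a - E`; the second
  -- makes `c / R < a`, so that `η` is nonzero.
  obtain ⟨R, hR, hR0, m, hm, η, hη1, hη2⟩ := hcut ((1 + t) * c / (t * a - E) + c / a + 1)
  have hd : 0 < t * a - E := by linarith
  have h0 : 0 ≤ (1 + t) * c / (t * a - E) := by positivity
  have h0' : 0 ≤ c / a := by positivity
  have h1 : (1 + t) * (c / R) ≤ t * a - E := by
    rw [← mul_div_assoc, div_le_iff₀ hR0, mul_comm (t * a - E), ← div_le_iff₀ hd]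
    linarith
  have h2 : c / R < a := by
    rw [div_lt_comm₀ hR0 ha]
    linarith
  have h3 := (abs_le.1 hη1).1
  have h4 := (abs_le.1 hη2).2
  have h5 : 0 < l2Inner η η := by
    have : 0 < m * (a - c / R) := mul_pos hm (sub_pos.2 h2)
    linarith
  have h6 : η ≠ 0 := by
    rintro rfl
    have : l2Inner (0 : CcForm Γ' k) 0 = 0 := inner_zero_left (𝕜 := ℝ) (0 : CcForm Γ' k)
    linarith
  refine (iInf₂_le η h6).trans ?_
  rw [EReal.coe_le_coe_iff, div_le_iff₀ h5]
  have h7 : m * ((1 + t) * (c / R)) ≤ m * (t * a - E) := mul_le_mul_of_nonneg_left h1 hm.le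
  have h8 : t * (m * a - c / R * m) ≤ t * l2Inner η η :=
    mul_le_mul_of_nonneg_left (by linarith) ht0.le
  linarith

end FlatForms

namespace FlatForms

/-! ### The group `Γ₂` -/

variable {n : ℕ} {Γ : Subgroup (EucGroup n)} {V : Submodule ℝ (Euc n)}

/-- A translation has trivial rotational part, which lies in the identity component and fixes
everything, so the further conditions are void. -/
theorem transl_mem_gammaStarStar_iff {v : Euc n} :
    transl v ∈ gammaStarStar Γ V ↔ transl v ∈ Γ := by
  refine ⟨fun h => h.1.1, fun h => ⟨mem_gammaStar_iff.2 ⟨h, ?_⟩, h, fun w _ => ?_⟩⟩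
  · rw [rot_transl, ← rot_one]
    exact rot_one_mem_rotComp Γ
  · rw [← lin_apply, lin_transl]
    rfl

theorem vTwo_eq : vTwo Γ V = Submodule.span ℝ {v | transl v ∈ Γ} := by
  unfold vTwo
  simp only [transl_mem_gammaStarStar_iff]

theorem mem_vTwo_of_transl_mem {v : Euc n} (h : transl v ∈ Γ) : v ∈ vTwo Γ V := by
  rw [vTwo_eq]
  exact Submodule.subset_span h

theorem vTwo_le (hV : IsLatticeSubspace Γ V) : vTwo Γ V ≤ V := by
  obtain ⟨c, T, L, -, -, h, -⟩ := hV
  refine Submodule.span_le.2 fun v hv => ?_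
  have := (h _ hv.1).2
  rwa [transl_apply, add_sub_cancel_right] at this

theorem gammaTwo_le : gammaTwo Γ V ≤ Γ := fun _ h => h.1.1

theorem transl_mem_gammaTwo {v : Euc n} (h : transl v ∈ Γ) : transl v ∈ gammaTwo Γ V := by
  have h1 : ∀ w : Euc n, (transl v).linearIsometryEquiv w = w := fun w => by
    rw [← lin_apply, lin_transl]
    rfl
  exact ⟨⟨h, fun w _ => h1 w⟩, fun w _ => h1 w⟩

/-- Since `V₂ ⊆ V`, the space `V₂ᗮ` is the sum of `V₁` and `Vᗮ`, and the two conditions defining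
`Γ₂` treat one summand each. -/
theorem lin_eq_of_mem_gammaTwo (hV : IsLatticeSubspace Γ V) {γ : EucGroup n}
    (hγ : γ ∈ gammaTwo Γ V) {w : Euc n} (hw : w ∈ (vTwo Γ V)ᗮ) : lin γ w = w := by
  obtain ⟨y, hy, z, hz, rfl⟩ := V.exists_add_mem_mem_orthogonal w
  have hz' : z ∈ (vTwo Γ V)ᗮ := Submodule.orthogonal_le (vTwo_le hV) hz
  have hy' : y ∈ (vTwo Γ V)ᗮ := by
    have := (vTwo Γ V)ᗮ.sub_mem hw hz'
    rwa [add_sub_cancel_right] at this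
  rw [map_add]
  have h1 : lin γ y = y := hγ.2 y ⟨hy, hy'⟩
  have h2 : lin γ z = z := hγ.1.2 z hz
  rw [h1, h2]

theorem transl_lin_mem {γ : EucGroup n} (hγ : γ ∈ Γ) {v : Euc n} (hv : transl v ∈ Γ) :
    transl (lin γ v) ∈ Γ := by
  have h : transl (lin γ v) = γ * transl v * γ⁻¹ := by
    refine ext_lin (x := γ 0) ?_ ?_
    · rw [map_mul, map_mul, map_inv, lin_transl, lin_transl, mul_one, mul_inv_cancel]
    · rw [mul_apply, mul_apply, inv_apply_self, transl_apply, transl_apply, add_zero, apply_eq γ v]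
  rw [h]
  exact Γ.mul_mem (Γ.mul_mem hγ hv) (Γ.inv_mem hγ)

theorem LocFin.finite_transl (hΓ : LocFin Γ) (R : ℝ) :
    {v : Euc n | transl v ∈ Γ ∧ ‖v‖ ≤ R}.Finite := by
  refine ((hΓ R).image fun γ => γ 0).subset fun v hv => ⟨transl v, ⟨hv.1, ?_⟩, ?_⟩
  · rw [transl_apply, add_zero]
    exact hv.2
  · simp only [transl_apply, add_zero]

/-- Conjugation by `γ` acts on the translation vectors of bounded length, a finite set containing a
basis of the span. Two powers of `γ` act on it alike by the pigeonhole principle. -/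
theorem exists_pow_lin_eq (hΓ : LocFin Γ) {γ : EucGroup n} (hγ : γ ∈ Γ) :
    ∃ m : ℕ, 0 < m ∧ ∀ v ∈ Submodule.span ℝ {v | transl v ∈ Γ}, lin (γ ^ m) v = v := by
  obtain ⟨b, hbs, hspan, hli⟩ := exists_linearIndependent ℝ {v : Euc n | transl v ∈ Γ}
  have hbfin : b.Finite := hli.setFinite
  obtain ⟨R, hR⟩ := hbfin.isBounded.exists_norm_le
  have hfin := hΓ.finite_transl R
  have : Finite {v : Euc n | transl v ∈ Γ ∧ ‖v‖ ≤ R} := hfin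
  let f : ℕ → {v : Euc n | transl v ∈ Γ ∧ ‖v‖ ≤ R} → {v : Euc n | transl v ∈ Γ ∧ ‖v‖ ≤ R} :=
    fun j v => ⟨lin (γ ^ j) v, transl_lin_mem (Γ.pow_mem hγ j) v.2.1, by
      rw [LinearIsometryEquiv.norm_map]
      exact v.2.2⟩
  obtain ⟨i, j, hij, hf⟩ : ∃ i j, i < j ∧ f i = f j := by
    obtain ⟨i, j, hne, h⟩ := Finite.exists_ne_map_eq_of_infinite f
    rcases lt_or_gt_of_ne hne with h' | h'
    · exact ⟨i, j, h', h⟩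
    · exact ⟨j, i, h', h.symm⟩
  refine ⟨j - i, Nat.sub_pos_of_lt hij, ?_⟩
  have hb : ∀ v ∈ b, lin (γ ^ (j - i)) v = v := by
    intro v hv
    have h1 : lin (γ ^ i) v = lin (γ ^ j) v :=
      congrArg Subtype.val (congrFun hf ⟨v, hbs hv, hR v hv⟩)
    have h2 : γ ^ j = γ ^ i * γ ^ (j - i) := by rw [← pow_add, Nat.add_sub_cancel' hij.le]
    rw [h2, map_mul] at h1
    exact ((lin (γ ^ i)).injective h1).symm
  intro v hv
  rw [← hspan] at hv
  induction hv using Submodule.span_induction with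
  | mem v hv => exact hb v hv
  | zero => exact map_zero _
  | add x y _ _ hx hy => rw [map_add, hx, hy]
  | smul c x _ hx => rw [map_smul, hx]

/-- The rotation of `γ` is trivial on `V₂ᗮ`, so the projection of `γ ^ j 0` is `j` times that of `γ
0`. Some positive power rotates `V₂` trivially as well, hence is a translation along `V₂`; so the
projection of `γ 0` vanishes. -/
theorem starProjection_apply_of_mem_gammaTwo (hΓ : LocFin Γ) (hV : IsLatticeSubspace Γ V)
    {γ : EucGroup n} (hγ : γ ∈ gammaTwo Γ V) (x : Euc n) :
    (vTwo Γ V)ᗮ.starProjection (γ x) = (vTwo Γ V)ᗮ.starProjection x := by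
  set S := vTwo Γ V with hS
  have hlin : ∀ γ ∈ gammaTwo Γ V, ∀ x, Sᗮ.starProjection (lin γ x) = Sᗮ.starProjection x := by
    intro γ hγ x
    rw [← sub_eq_zero, ← map_sub, Submodule.starProjection_apply_eq_zero_iff]
    intro w hw
    rw [real_inner_comm]
    exact inner_lin_sub_of_fixed (lin γ) (lin_eq_of_mem_gammaTwo hV hγ hw) x
  have hstep : ∀ x, Sᗮ.starProjection (γ x) = Sᗮ.starProjection x + Sᗮ.starProjection (γ 0) :=
    fun x => by rw [apply_eq γ x, map_add, hlin γ hγ]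
  obtain ⟨m, hm, hpow⟩ := exists_pow_lin_eq hΓ (gammaTwo_le hγ)
  rw [← vTwo_eq (V := V)] at hpow
  have hγm : γ ^ m ∈ gammaTwo Γ V := (gammaTwo Γ V).pow_mem hγ m
  have h1 : lin (γ ^ m) = 1 := by
    ext1 y
    obtain ⟨a, ha, b, hb, rfl⟩ := S.exists_add_mem_mem_orthogonal y
    rw [map_add, hpow a ha, lin_eq_of_mem_gammaTwo hV hγm hb]
    rfl
  have h2 : (γ ^ m) 0 ∈ S := by
    refine mem_vTwo_of_transl_mem ?_
    rw [← eq_transl_of_lin_eq_one h1]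
    exact gammaTwo_le hγm
  have h3 : ∀ j : ℕ, Sᗮ.starProjection ((γ ^ j) 0) = j • Sᗮ.starProjection (γ 0) := by
    intro j
    induction j with
    | zero => rw [pow_zero, zero_smul]; exact map_zero _
    | succ j ih => rw [pow_succ', mul_apply, hstep, ih, succ_nsmul]
  have h4 : m • Sᗮ.starProjection (γ 0) = 0 := by
    rw [← h3, Submodule.starProjection_apply_eq_zero_iff, Submodule.orthogonal_orthogonal]
    exact h2
  have h5 : Sᗮ.starProjection (γ 0) = 0 := by
    rw [← Nat.cast_smul_eq_nsmul ℝ] at h4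
    exact (smul_eq_zero.1 h4).resolve_left (Nat.cast_ne_zero.2 hm.ne')
  rw [hstep, h5, add_zero]

theorem transl_mem_of_mem_closure {v : Euc n}
    (hv : v ∈ AddSubgroup.closure {v | transl v ∈ Γ}) : transl v ∈ Γ := by
  induction hv using AddSubgroup.closure_induction with
  | mem v hv => exact hv
  | zero =>
    have : transl (0 : Euc n) = 1 := by
      ext1 x
      rw [transl_apply, zero_add]
      rfl
    rw [this]
    exact Γ.one_mem
  | add x y _ _ hx hy =>
    have : transl (x + y) = transl x * transl y := by
      ext1 z
      rw [mul_apply, transl_apply, transl_apply, transl_apply, add_assoc]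
    rw [this]
    exact Γ.mul_mem hx hy
  | neg x _ hx =>
    have : transl (-x) = (transl x)⁻¹ := by
      rw [eq_inv_iff_mul_eq_one]
      ext1 z
      rw [mul_apply, transl_apply, transl_apply, neg_add_cancel_left]
      rfl
    rw [this]
    exact Γ.inv_mem hx

/-- The translations of `Γ` lie in `Γ₂` and their vectors span `V₂`, so they bring the
`V₂`-component of any point within a bounded distance of `0`. -/
theorem cocompactAlong_gammaTwo (hΓ : LocFin Γ) (hV : IsLatticeSubspace Γ V) :
    CocompactAlong (gammaTwo Γ V) (vTwo Γ V)ᗮ.starProjection where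
  inv _ hγ x := starProjection_apply_of_mem_gammaTwo hΓ hV hγ x
  norm_le x := Submodule.norm_starProjection_apply_le _ x
  bdd := by
    obtain ⟨C, hC⟩ := exists_bound_sub_mem {v : Euc n | transl v ∈ Γ}
    rw [← vTwo_eq (V := V)] at hC
    refine ⟨max C 0, le_max_right _ _, fun x => ?_⟩
    obtain ⟨l, hl, hle⟩ := hC _ ((vTwo Γ V).starProjection_apply_mem x)
    refine ⟨transl (-l), transl_mem_gammaTwo (transl_mem_of_mem_closure (neg_mem hl)), ?_⟩
    have h1 : transl (-l) x = (vTwo Γ V)ᗮ.starProjection x +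
        ((vTwo Γ V).starProjection x - l) := by
      rw [transl_apply, Submodule.starProjection_orthogonal_val]
      abel
    rw [h1]
    exact (norm_add_le _ _).trans (add_le_add le_rfl (hle.trans (le_max_left _ _)))

/-- Were `V₂ᗮ` zero, `Γ₂` would move every point into one fixed ball, whose image would be the whole
quotient. -/
theorem exists_mem_orthogonal_vTwo_ne_zero (hΓ : LocFin Γ) (hV : IsLatticeSubspace Γ V)
    (hnc : ¬ CompactSpace (FlatQuotient Γ)) : ∃ v ∈ (vTwo Γ V)ᗮ, v ≠ 0 := by
  by_contra! hcon
  refine hnc ?_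
  obtain ⟨C, -, hC⟩ := (cocompactAlong_gammaTwo hΓ hV).bdd
  have hcpt : IsCompact ((Quotient.mk (orbitSetoid Γ)) '' Metric.closedBall (0 : Euc n) C) :=
    (isCompact_closedBall (0 : Euc n) C).image continuous_quotient_mk'
  refine ⟨?_⟩
  convert hcpt
  refine (eq_univ_of_forall fun q => ?_).symm
  induction q using Quotient.inductionOn with
  | h x =>
    obtain ⟨γ, hγ, h⟩ := hC x
    rw [hcon _ ((vTwo Γ V)ᗮ.starProjection_apply_mem x), norm_zero, zero_add] at h
    refine ⟨γ x, mem_closedBall_zero_iff.2 h, Quotient.sound ?_⟩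
    exact (orbitSetoid Γ).symm ⟨γ, gammaTwo_le hγ, rfl⟩

end FlatForms

namespace FlatForms

variable {n k : ℕ} {Γ : Subgroup (EucGroup n)} {v : Euc n}

/-! ### Translates of forms -/

theorem apply_add_of_lin_eq (hv : ∀ γ ∈ Γ, lin γ v = v) {γ : EucGroup n} (hγ : γ ∈ Γ)
    (x : Euc n) : γ (x + v) = γ x + v := by rw [apply_add, hv γ hγ]

/-- The translate of a form by a vector that is fixed by the rotational parts of `Γ`. -/
def CcForm.translate (hv : ∀ γ ∈ Γ, lin γ v = v) (ω : CcForm Γ k) : CcForm Γ k :=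
  (⟨fun x => ω.lift (x + v), by
    obtain ⟨hω, hinv, K, hK, hωK⟩ := ω.lift_mem
    refine ⟨hω.comp (contDiff_id.add contDiff_const), fun γ hγ x => ?_, (fun y => y - v) '' K,
      hK.image (continuous_id.sub continuous_const), fun x hx => ?_⟩
    · change (ω.lift (γ x + v)).compContinuousLinearMap (rot γ) = ω.lift (x + v)
      rw [← apply_add_of_lin_eq hv hγ]
      exact hinv γ hγ _
    · obtain ⟨γ, hγ, h⟩ := hωK _ hx
      refine ⟨γ, hγ, γ (x + v), h, ?_⟩
      simp only [apply_add_of_lin_eq hv hγ, add_sub_cancel_right]⟩ : ↥(ccSubmodule Γ k))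

theorem dForm_translate (hv : ∀ γ ∈ Γ, lin γ v = v) (ω : CcForm Γ k) :
    dForm Γ k (ω.translate hv) = (dForm Γ k ω).translate hv := by
  refine CcForm.ext_lift (funext fun x => ?_)
  change ContinuousAlternatingMap.alternatizeUncurryFin (fderiv ℝ (fun x => ω.lift (x + v)) x) = _
  rw [fderiv_comp_add_right]
  rfl

theorem deltaForm_translate (hv : ∀ γ ∈ Γ, lin γ v = v) (ω : CcForm Γ (k + 1)) :
    deltaForm Γ k (ω.translate hv) = (deltaForm Γ k ω).translate hv := by
  refine CcForm.ext_lift (funext fun x => ?_)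
  change -∑ i : Fin n, (fderiv ℝ (fun x => ω.lift (x + v)) x (stdVec i)).curryLeft (stdVec i) = _
  rw [fderiv_comp_add_right]
  rfl

theorem hodgeLaplacian_translate (hv : ∀ γ ∈ Γ, lin γ v = v) :
    ∀ {k : ℕ} (ω : CcForm Γ k),
      hodgeLaplacian Γ k (ω.translate hv) = (hodgeLaplacian Γ k ω).translate hv
  | 0, ω => by
    change deltaForm Γ 0 (dForm Γ 0 (ω.translate hv)) = _
    rw [dForm_translate, deltaForm_translate]
    rfl
  | k + 1, ω => by
    change dForm Γ k (deltaForm Γ k (ω.translate hv)) +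
      deltaForm Γ (k + 1) (dForm Γ (k + 1) (ω.translate hv)) = _
    rw [dForm_translate, deltaForm_translate, deltaForm_translate, dForm_translate]
    rfl

/-- The translation commutes with `Γ`, so the preimage of the Dirichlet domain is again a
fundamental domain. -/
theorem l2Inner_translate (hΓ : LocFin Γ) (hfree : FixedPointFree Γ)
    (hv : ∀ γ ∈ Γ, lin γ v = v) (ω η : CcForm Γ k) :
    l2Inner (ω.translate hv) (η.translate hv) = l2Inner ω η := by
  have hcount : Countable Γ := hΓ.countable
  have hD := isFundamentalDomain_dirichletDomain hΓ hfree
  let f : Euc n ≃ᵐ Euc n := MeasurableEquiv.addRight v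
  have hf : MeasurePreserving f := measurePreserving_add_right volume v
  have hD' : IsFundamentalDomain Γ (f ⁻¹' dirichletDomain Γ) volume :=
    hD.preimage_of_equiv (e := id) hf.quasiMeasurePreserving Function.bijective_id
      fun γ x => (apply_add_of_lin_eq hv γ.2 x).symm
  have h1 : l2Inner (ω.translate hv) (η.translate hv) =
      ∫ x in f ⁻¹' dirichletDomain Γ, covecInner (ω.lift (f x)) (η.lift (f x)) :=
    hD.setIntegral_eq hD' fun γ x => (ω.translate hv).covecInner_invariant (η.translate hv) γ.2 x
  rw [h1, hf.setIntegral_preimage_emb f.measurableEmbedding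
    (fun x => covecInner (ω.lift x) (η.lift x))]
  rfl

theorem l2Inner_eq_zero_of_disjoint {ω η : CcForm Γ k}
    (h : ∀ x, ω.lift x = 0 ∨ η.lift x = 0) : l2Inner ω η = 0 := by
  have h1 : ∀ x, covecInner (ω.lift x) (η.lift x) = 0 := fun x => by
    rcases h x with h | h
    · rw [h, covecInner_zero_left]
    · rw [h, covecInner_comm, covecInner_zero_left]
  simp only [l2Inner, h1, integral_zero]

theorem exists_orthonormal_translates {P : Euc n →L[ℝ] Euc n} (hΓ : LocFin Γ)
    (hfree : FixedPointFree Γ) (hP : CocompactAlong Γ P) (hv0 : v ≠ 0) (hPv : P v = v)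
    (hv : ∀ γ ∈ Γ, lin γ v = v) {ω : CcForm Γ k} (hω : ω ≠ 0) (N : ℕ) :
    ∃ w : Fin N → CcForm Γ k, Orthonormal ℝ w ∧ ∀ i,
      l2Inner (hodgeLaplacian Γ k (w i)) (w i) =
        l2Inner (hodgeLaplacian Γ k ω) ω / l2Inner ω ω := by
  have ha := l2Inner_self_pos hΓ hfree hω
  set a := l2Inner ω ω with hadef
  obtain ⟨r, B, hr, -, hωr, -⟩ := ω.exists_bound
  have hsupp : ∀ x, ω.lift x ≠ 0 → ‖P x‖ ≤ r := fun x hx => by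
    obtain ⟨γ, hγ, h⟩ := hωr x hx
    rw [← hP.inv γ hγ]
    exact (hP.norm_le _).trans h
  have hvn : 0 < ‖v‖ := norm_pos_iff.2 hv0
  -- Under `P` the support of `ω` lies in the ball of radius `r`, so shifts differing by at least `2
  -- r + 1` along `v` have disjoint supports.
  let s : ℝ := (2 * r + 1) / ‖v‖
  have hs : s * ‖v‖ = 2 * r + 1 := div_mul_cancel₀ _ hvn.ne'
  have hvt : ∀ t : ℝ, ∀ γ ∈ Γ, lin γ (t • v) = t • v := fun t γ hγ => by
    rw [map_smul, hv γ hγ]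
  let τ : Fin N → CcForm Γ k := fun i => ω.translate (hvt ((i : ℕ) * s))
  have hsq : (Real.sqrt a)⁻¹ * (Real.sqrt a)⁻¹ = a⁻¹ := by
    rw [← mul_inv, Real.mul_self_sqrt ha.le]
  have hsm : ∀ θ η : CcForm Γ k,
      l2Inner ((Real.sqrt a)⁻¹ • θ) ((Real.sqrt a)⁻¹ • η) = a⁻¹ * l2Inner θ η := by
    intro θ η
    rw [← inner_eq_l2Inner, real_inner_smul_left, real_inner_smul_right, ← mul_assoc, hsq]
    rfl
  refine ⟨fun i => (Real.sqrt a)⁻¹ • τ i, ?_, fun i => ?_⟩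
  · rw [orthonormal_iff_ite]
    intro i j
    rw [inner_eq_l2Inner, hsm]
    split_ifs with hij
    · rw [hij, l2Inner_translate hΓ hfree, inv_mul_cancel₀ ha.ne']
    · rw [l2Inner_eq_zero_of_disjoint, mul_zero]
      intro x
      by_contra! hx
      have h1 := hsupp _ hx.1
      have h2 := hsupp _ hx.2
      rw [map_add, map_smul, hPv] at h1 h2
      have h3 : ‖(((i : ℕ) * s - (j : ℕ) * s : ℝ)) • v‖ ≤ r + r := by
        have h4 : ((((i : ℕ) * s - (j : ℕ) * s : ℝ)) • v) =
            (P x + ((i : ℕ) * s : ℝ) • v) - (P x + ((j : ℕ) * s : ℝ) • v) := by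
          rw [sub_smul]
          abel
        rw [h4]
        exact (norm_sub_le _ _).trans (add_le_add h1 h2)
      rw [← sub_mul, norm_smul, norm_mul, mul_assoc] at h3
      have hs0 : ‖s‖ * ‖v‖ = 2 * r + 1 := by
        rw [Real.norm_of_nonneg (div_nonneg (by linarith) hvn.le), hs]
      rw [hs0] at h3
      have h5 : (1 : ℝ) ≤ ‖((i : ℕ) : ℝ) - ((j : ℕ) : ℝ)‖ := by
        have h6 : (((i : ℕ) : ℤ) - ((j : ℕ) : ℤ)) ≠ 0 := by
          intro h
          exact hij (Fin.ext (by omega))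
        have h7 := Int.one_le_abs h6
        rw [Real.norm_eq_abs]
        exact_mod_cast h7
      nlinarith
  · rw [map_smul, hsm, hodgeLaplacian_translate, l2Inner_translate hΓ hfree, div_eq_inv_mul]

/-! ### The bottom of the essential spectrum -/

theorem mul_norm_sq_le_of_le_bottomRayleigh {lam : ℝ} (h : (lam : EReal) ≤ bottomRayleigh Γ k)
    (hΓ : LocFin Γ) (hfree : FixedPointFree Γ) (ω : CcForm Γ k) :
    lam * ‖ω‖ ^ 2 ≤ inner ℝ (hodgeLaplacian Γ k ω) ω := by
  by_cases hω : ω = 0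
  · simp [hω]
  · have h1 := h.trans (iInf₂_le ω hω)
    rw [EReal.coe_le_coe_iff, le_div_iff₀ (l2Inner_self_pos hΓ hfree hω)] at h1
    rwa [← real_inner_self_eq_norm_sq]

/-- A real number strictly between a point below the bottom and the bottom itself is a lower bound
of the form, so that point has a resolvent. -/
theorem bottomRayleigh_le_bottomEss (hΓ : LocFin Γ) (hfree : FixedPointFree Γ) (k : ℕ) :
    bottomRayleigh Γ k ≤ bottomEss Γ k := by
  refine le_iInf₂ fun μ hμ => ?_
  by_contra! hlt
  obtain ⟨lam, h1, h2⟩ := EReal.lt_iff_exists_real_btwn.1 hlt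
  exact notMem_graphSpectrum_of_lt (hodgeLaplacian Γ k)
    (fun ω η => l2Inner_hodgeLaplacian_comm hΓ hfree ω η) (EReal.coe_lt_coe_iff.1 h1)
    (mul_norm_sq_le_of_le_bottomRayleigh h2.le hΓ hfree) hμ.1

theorem bottomEss_le_bottomRayleigh {P : Euc n →L[ℝ] Euc n} (hΓ : LocFin Γ)
    (hfree : FixedPointFree Γ) (hP : CocompactAlong Γ P) (hv0 : v ≠ 0) (hPv : P v = v)
    (hv : ∀ γ ∈ Γ, lin γ v = v) (k : ℕ) : bottomEss Γ k ≤ bottomRayleigh Γ k := by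
  have h0 : ((0 : ℝ) : EReal) ≤ bottomRayleigh Γ k := le_iInf₂ fun ω _ =>
    EReal.coe_le_coe_iff.2 (div_nonneg (l2Inner_hodgeLaplacian_self_nonneg hΓ hfree ω)
      (l2Inner_self_nonneg ω))
  -- The value `⊤` is the infimum over no forms at all; otherwise the bottom is a real number, being
  -- nonnegative.
  by_cases htop : bottomRayleigh Γ k = ⊤
  · rw [htop]
    exact le_top
  lift bottomRayleigh Γ k to ℝ using
    ⟨htop, fun h => by rw [h] at h0; exact absurd h0 (by simp)⟩ with lam hlam
  refine iInf₂_le lam (mem_graphEssSpectrum (hodgeLaplacian Γ k)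
    (fun ω η => l2Inner_hodgeLaplacian_comm hΓ hfree ω η) (EReal.coe_le_coe_iff.1 h0)
    (mul_norm_sq_le_of_le_bottomRayleigh hlam.le hΓ hfree) fun ε hε N => ?_)
  have h1 : bottomRayleigh Γ k < ((lam + ε : ℝ) : EReal) := by
    rw [← hlam, EReal.coe_lt_coe_iff]
    linarith
  obtain ⟨ω, hω⟩ := iInf_lt_iff.1 h1
  obtain ⟨hω0, hω⟩ := iInf_lt_iff.1 hω
  obtain ⟨w, hw, hwe⟩ := exists_orthonormal_translates hΓ hfree hP hv0 hPv hv hω0 N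
  exact ⟨w, hw, fun i => (hwe i).trans_le (EReal.coe_lt_coe_iff.1 hω).le⟩

end FlatForms
-- The theorem
theorem mainTheorem5 (n : ℕ) (Γ : Subgroup (EucGroup n)) (hdisc : DiscreteTopology Γ)
    (hfree : FixedPointFree Γ) (hnc : ¬ CompactSpace (FlatQuotient Γ)) :
    (∃ V : Submodule ℝ (Euc n), IsLatticeSubspace Γ V) ∧
    ∀ V : Submodule ℝ (Euc n), IsLatticeSubspace Γ V → ∀ k : ℕ, k ≤ n →
      bottomRayleigh (gammaTwo Γ V) k ≤ bottomRayleigh Γ k ∧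
      bottomEss (gammaTwo Γ V) k ≤ bottomEss Γ k ∧
      bottomEss (gammaTwo Γ V) k = bottomRayleigh (gammaTwo Γ V) k := by
  have hΓ := locFin_of_discrete hdisc
  refine ⟨exists_isLatticeSubspace hdisc hfree, fun V hV k _ => ?_⟩
  have hΓ₂ : LocFin (gammaTwo Γ V) := hΓ.mono gammaTwo_le
  have hfree₂ : FixedPointFree (gammaTwo Γ V) := hfree.mono gammaTwo_le
  have hP := cocompactAlong_gammaTwo hΓ hV
  obtain ⟨v, hv, hv0⟩ := exists_mem_orthogonal_vTwo_ne_zero hΓ hV hnc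
  have hle := bottomRayleigh_le_of_le hΓ hfree gammaTwo_le hP k
  have heq : bottomEss (gammaTwo Γ V) k = bottomRayleigh (gammaTwo Γ V) k :=
    le_antisymm (bottomEss_le_bottomRayleigh hΓ₂ hfree₂ hP hv0
      (Submodule.starProjection_eq_self_iff.2 hv)
      (fun _ hγ => lin_eq_of_mem_gammaTwo hV hγ hv) k)
      (bottomRayleigh_le_bottomEss hΓ₂ hfree₂ k)
  exact ⟨hle, heq.trans_le (hle.trans (bottomRayleigh_le_bottomEss hΓ hfree k)), heq⟩
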